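/- Let $g\ge 2$, let $\Sigma_g$ be a closed oriented surface of genus $g$ with fundamental class $[\Sigma_g]\in H_2(\Sigma_g;\mathbb Z)$, and let $\mathcal M_g$ be its mapping class group, i.e. the group of isotopy classes of orientation preserving homeomorphisms of $\Sigma_g$, acting on $H^1(\Sigma_g;\mathbb R)$ by $\varphi\cdot w=(\varphi^{-1})^*w$. Let $\iota(u,v)=\langle u\cup v,[\Sigma_g]\rangle$ be the cup product pairing on $H^1(\Sigma_g;\mathbb Q)$. Let $\Lambda^2_{\mathbb Z}H^1(\Sigma_g;\mathbb R)$ be the second exterior power over $\mathbb Z$ of $H^1(\Sigma_g;\mathbb R)$ regarded as an abelian group, with the induced action of $\mathcal M_g$, and let $\left(\Lambda^2_{\mathbb Z}H^1(\Sigma_g;\mathbb R)\right)_{\mathcal M_g}$ be its group of coinvariants. Let $S^2_{\mathbb Q}\mathbb R$ be the second symmetric power of $\mathbb R$ regarded as a vector space over $\mathbb Q$; for $a,b\in\mathbb R$ write $\hat a\,\hat b\in S^2_{\mathbb Q}\mathbb R$ for the symmetric product of $a$ and $b$. Then there is one and only one isomorphism of abelian groups $$\left(\Lambda^2_{\mathbb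 Z}H^1(\Sigma_g;\mathbb R)\right)_{\mathcal M_g}\;\cong\; S^2_{\mathbb Q}\mathbb R$$ that sends the class of $$\Big(\sum_i a_iu_i\Big)\wedge\Big(\sum_j b_jv_j\Big)\quad\text{to}\quad \sum_{i,j}\iota(u_i,v_j)\,\hat a_i\,\hat b_j$$ for all finite families $a_i,b_j\in\mathbb R$ and $u_i,v_j\in H^1(\Sigma_g;\mathbb Q)$. -/

import Mathlib

namespace SurfaceTopology


universe u v w

/-! ### Singular chains, cochains, homology and cohomology -/

/-- Singular `n`-simplices of `X`. -/
abbrev SingularSimplex (n : ℕ) (X : Type u) [TopologicalSpace X] : Type u :=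
  C(stdSimplex ℝ (Fin (n + 1)), X)

/-- The affine map of standard simplices induced by a map of vertices. -/
noncomputable def simplexMap {m n : ℕ} (f : Fin (m + 1) → Fin (n + 1)) :
    C(stdSimplex ℝ (Fin (m + 1)), stdSimplex ℝ (Fin (n + 1))) :=
  ⟨stdSimplex.map f, stdSimplex.continuous_map f⟩

/-- The `i`-th face (the one opposite to the vertex `i`) of a singular simplex. -/
noncomputable def face {X : Type u} [TopologicalSpace X] {n : ℕ} (i : Fin (n + 2))
    (σ : SingularSimplex (n + 1) X) : SingularSimplex n X :=
  σ.comp (simplexMap i.succAbove)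

/-- The singular boundary `∂ σ = ∑ i, (-1)^i (face i σ)` on integral singular chains. -/
noncomputable def boundary (X : Type u) [TopologicalSpace X] (n : ℕ) :
    (SingularSimplex (n + 1) X →₀ ℤ) →+ (SingularSimplex n X →₀ ℤ) :=
  (Finsupp.linearCombination ℤ (fun σ : SingularSimplex (n + 1) X =>
    ∑ i : Fin (n + 2), Finsupp.single (face i σ) ((-1 : ℤ) ^ (i : ℕ)))).toAddMonoidHom

/-- Integral singular cycles. -/
noncomputable def cycles (X : Type u) [TopologicalSpace X] :
    (n : ℕ) → AddSubgroup (SingularSimplex n X →₀ ℤ)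
  | 0 => ⊤
  | n + 1 => (boundary X n).ker

/-- Integral singular boundaries. -/
noncomputable def boundaries (X : Type u) [TopologicalSpace X] (n : ℕ) :
    AddSubgroup (SingularSimplex n X →₀ ℤ) :=
  (boundary X n).range

/-- Integral singular homology `H_n(X; ℤ)`. -/
def Homology (X : Type u) [TopologicalSpace X] (n : ℕ) : Type u :=
  cycles X n ⧸ (boundaries X n).addSubgroupOf (cycles X n)

noncomputable instance (X : Type u) [TopologicalSpace X] (n : ℕ) : AddCommGroup (Homology X n) :=
  inferInstanceAs (AddCommGroup (cycles X n ⧸ (boundaries X n).addSubgroupOf (cycles X n)))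

/-- The singular coboundary `(δ c) σ = ∑ i, (-1)^i c (face i σ)`. -/
noncomputable def coboundary (X : Type u) [TopologicalSpace X] (A : Type v) [CommRing A] (n : ℕ) :
    (SingularSimplex n X → A) →ₗ[A] (SingularSimplex (n + 1) X → A) where
  toFun c σ := ∑ i : Fin (n + 2), (-1 : A) ^ (i : ℕ) * c (face i σ)
  map_add' c d := by
    funext σ
    simp [mul_add, Finset.sum_add_distrib]
  map_smul' a c := by
    funext σ
    simp only [Pi.smul_apply, smul_eq_mul, RingHom.id_apply, Finset.mul_sum]
    exact Finset.sum_congr rfl fun i _ => by ring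

/-- Singular cocycles with coefficients in `A`. -/
noncomputable def cocycles (X : Type u) [TopologicalSpace X] (A : Type v) [CommRing A] (n : ℕ) :
    Submodule A (SingularSimplex n X → A) :=
  LinearMap.ker (coboundary X A n)

/-- Singular coboundaries with coefficients in `A`. -/
noncomputable def coboundaries (X : Type u) [TopologicalSpace X] (A : Type v) [CommRing A] :
    (n : ℕ) → Submodule A (SingularSimplex n X → A)
  | 0 => ⊥
  | n + 1 => LinearMap.range (coboundary X A n)

/-- Singular cohomology `H^n(X; A)`. -/
def Cohomology (X : Type u) [TopologicalSpace X] (A : Type v) [CommRing A] (n : ℕ) :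
    Type (max u v) :=
  cocycles X A n ⧸ (coboundaries X A n).submoduleOf (cocycles X A n)

noncomputable instance (X : Type u) [TopologicalSpace X] (A : Type v) [CommRing A] (n : ℕ) :
    AddCommGroup (Cohomology X A n) :=
  inferInstanceAs
    (AddCommGroup (cocycles X A n ⧸ (coboundaries X A n).submoduleOf (cocycles X A n)))

noncomputable instance (X : Type u) [TopologicalSpace X] (A : Type v) [CommRing A] (n : ℕ) :
    Module A (Cohomology X A n) :=
  inferInstanceAs
    (Module A (cocycles X A n ⧸ (coboundaries X A n).submoduleOf (cocycles X A n)))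

/-- The class of a cocycle. -/
noncomputable def Cohomology.mk (X : Type u) [TopologicalSpace X] (A : Type v) [CommRing A]
    (n : ℕ) : cocycles X A n →ₗ[A] Cohomology X A n :=
  Submodule.mkQ _

/-! ### Functoriality -/

theorem face_comp {X : Type u} {Y : Type v} [TopologicalSpace X] [TopologicalSpace Y]
    (f : C(X, Y)) {n : ℕ} (i : Fin (n + 2)) (σ : SingularSimplex (n + 1) X) :
    face i (f.comp σ) = f.comp (face i σ) := rfl

/-- The map of integral singular chains induced by a continuous map. -/
noncomputable def chainMap {X : Type u} {Y : Type v} [TopologicalSpace X] [TopologicalSpace Y]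
    (f : C(X, Y)) (n : ℕ) : (SingularSimplex n X →₀ ℤ) →+ (SingularSimplex n Y →₀ ℤ) :=
  Finsupp.mapDomain.addMonoidHom (fun σ => f.comp σ)

theorem boundary_chainMap {X : Type u} {Y : Type v} [TopologicalSpace X] [TopologicalSpace Y]
    (f : C(X, Y)) (n : ℕ) (z : SingularSimplex (n + 1) X →₀ ℤ) :
    boundary Y n (chainMap f (n + 1) z) = chainMap f n (boundary X n z) := by
  induction z using Finsupp.induction_linear with
  | zero => simp
  | add a b ha hb => simp only [map_add, ha, hb]
  | single σ k =>
    simp [boundary, chainMap, Finsupp.mapDomain_single, face_comp, Finsupp.mapDomain_finsetSum,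
      Finsupp.mapDomain_smul]

theorem chainMap_mem_cycles {X : Type u} {Y : Type v} [TopologicalSpace X] [TopologicalSpace Y]
    (f : C(X, Y)) (n : ℕ) (z : SingularSimplex n X →₀ ℤ) (hz : z ∈ cycles X n) :
    chainMap f n z ∈ cycles Y n := by
  cases n with
  | zero => trivial
  | succ n =>
    have h : boundary X n z = 0 := hz
    change boundary Y n _ = 0
    rw [boundary_chainMap, h, map_zero]

/-- The map of cycles induced by a continuous map. -/
noncomputable def cyclesMap {X : Type u} {Y : Type v} [TopologicalSpace X] [TopologicalSpace Y]
    (f : C(X, Y)) (n : ℕ) : cycles X n →+ cycles Y n :=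
  ((chainMap f n).comp (cycles X n).subtype).codRestrict (cycles Y n)
    (fun z => chainMap_mem_cycles f n z.1 z.2)

/-- The induced map `f_*` in integral homology. -/
noncomputable def pushforward {X : Type u} {Y : Type v} [TopologicalSpace X] [TopologicalSpace Y]
    (f : C(X, Y)) (n : ℕ) : Homology X n →+ Homology Y n :=
  QuotientAddGroup.map _ _ (cyclesMap f n) (by
    rintro ⟨z, hz⟩ ⟨y, hy⟩
    exact ⟨chainMap f (n + 1) y, by rw [boundary_chainMap, hy]; rfl⟩)

theorem pushforward_id {X : Type u} [TopologicalSpace X] (n : ℕ) (z : Homology X n) :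
    pushforward (ContinuousMap.id X) n z = z := by
  obtain ⟨z, rfl⟩ := QuotientAddGroup.mk_surjective z
  refine congrArg _ (Subtype.ext ?_)
  exact Finsupp.mapDomain_id

theorem pushforward_comp {X : Type u} {Y : Type v} {Z : Type w} [TopologicalSpace X]
    [TopologicalSpace Y] [TopologicalSpace Z] (g : C(Y, Z)) (f : C(X, Y)) (n : ℕ)
    (z : Homology X n) :
    pushforward (g.comp f) n z = pushforward g n (pushforward f n z) := by
  obtain ⟨z, rfl⟩ := QuotientAddGroup.mk_surjective z
  refine congrArg _ (Subtype.ext ?_)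
  exact Finsupp.mapDomain_comp (f := fun σ => f.comp σ) (g := fun σ => g.comp σ)

/-- The map of singular cochains induced by a continuous map. -/
def cochainMap {X : Type u} {Y : Type v} [TopologicalSpace X] [TopologicalSpace Y]
    (f : C(X, Y)) (A : Type w) [CommRing A] (n : ℕ) :
    (SingularSimplex n Y → A) →ₗ[A] (SingularSimplex n X → A) where
  toFun c σ := c (f.comp σ)
  map_add' _ _ := rfl
  map_smul' _ _ := rfl

theorem coboundary_cochainMap {X : Type u} {Y : Type v} [TopologicalSpace X] [TopologicalSpace Y]
    (f : C(X, Y)) (A : Type w) [CommRing A] (n : ℕ) (c : SingularSimplex n Y → A) :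
    coboundary X A n (cochainMap f A n c) = cochainMap f A (n + 1) (coboundary Y A n c) := rfl

/-- The map of cocycles induced by a continuous map. -/
noncomputable def cocyclesMap {X : Type u} {Y : Type v} [TopologicalSpace X] [TopologicalSpace Y]
    (f : C(X, Y)) (A : Type w) [CommRing A] (n : ℕ) : cocycles Y A n →ₗ[A] cocycles X A n :=
  (cochainMap f A n).restrict (fun c hc => by
    have h : coboundary Y A n c = 0 := hc
    change coboundary X A n _ = 0
    rw [coboundary_cochainMap, h, map_zero])

/-- The induced map `f^*` in cohomology. -/
noncomputable def pullback {X : Type u} {Y : Type v} [TopologicalSpace X] [TopologicalSpace Y]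
    (f : C(X, Y)) (A : Type w) [CommRing A] (n : ℕ) :
    Cohomology Y A n →ₗ[A] Cohomology X A n :=
  Submodule.mapQ _ _ (cocyclesMap f A n) (by
    rintro ⟨c, hc⟩ h
    cases n with
    | zero =>
      have h0 : c = 0 := h
      subst h0
      exact Submodule.zero_mem _
    | succ n =>
      obtain ⟨b, hb⟩ := h
      exact ⟨cochainMap f A n b, by rw [coboundary_cochainMap, hb]; rfl⟩)

theorem pullback_mk {X : Type u} {Y : Type v} [TopologicalSpace X] [TopologicalSpace Y]
    (f : C(X, Y)) (A : Type w) [CommRing A] (n : ℕ) (c : cocycles Y A n) :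
    pullback f A n (Cohomology.mk Y A n c) = Cohomology.mk X A n (cocyclesMap f A n c) := rfl

theorem Cohomology.mk_surjective (X : Type u) [TopologicalSpace X] (A : Type v) [CommRing A]
    (n : ℕ) : Function.Surjective (Cohomology.mk X A n) :=
  Submodule.mkQ_surjective _

theorem pullback_id {X : Type u} [TopologicalSpace X] (A : Type w) [CommRing A] (n : ℕ) :
    pullback (ContinuousMap.id X) A n = LinearMap.id := by
  ext c
  obtain ⟨c, rfl⟩ := Cohomology.mk_surjective X A n c
  rfl

theorem pullback_comp {X : Type u} {Y : Type v} {Z : Type*} [TopologicalSpace X]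
    [TopologicalSpace Y] [TopologicalSpace Z] (g : C(Y, Z)) (f : C(X, Y)) (A : Type w)
    [CommRing A] (n : ℕ) :
    pullback (g.comp f) A n = pullback f A n ∘ₗ pullback g A n := by
  ext c
  obtain ⟨c, rfl⟩ := Cohomology.mk_surjective Z A n c
  rfl

/-- The change of coefficients `H^n(X; A) → H^n(X; B)` along a ring homomorphism. -/
noncomputable def changeCoeff (X : Type u) [TopologicalSpace X] {A : Type v} {B : Type w}
    [CommRing A] [CommRing B] (φ : A →+* B) (n : ℕ) :
    Cohomology X A n →ₛₗ[φ] Cohomology X B n :=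
  have key : ∀ (m : ℕ) (c : SingularSimplex m X → A),
      coboundary X B m (fun σ => φ (c σ)) = fun σ => φ (coboundary X A m c σ) := by
    intro m c
    funext σ
    simp [coboundary, map_sum]
  let φc : cocycles X A n →ₛₗ[φ] cocycles X B n :=
    { toFun := fun c => ⟨fun σ => φ (c.1 σ), by
        have h : coboundary X A n c.1 = 0 := c.2
        change coboundary X B n _ = 0
        rw [key, h]
        funext σ
        simp⟩
      map_add' := fun c d => Subtype.ext (funext fun σ => by simp)
      map_smul' := fun a c => Subtype.ext (funext fun σ => by simp) }
  Submodule.mapQ _ _ φc (by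
    rintro ⟨c, hc⟩ h
    cases n with
    | zero =>
      have h0 : c = 0 := h
      subst h0
      change (fun σ => φ _) = (0 : SingularSimplex 0 X → B)
      funext σ
      simp
    | succ n =>
      obtain ⟨b, hb⟩ := h
      refine ⟨fun σ => φ (b σ), ?_⟩
      rw [key, hb]
      rfl)

/-! ### Cup product of degree one classes and evaluation on homology -/

theorem simplexMap_comp {l m n : ℕ} (f : Fin (m + 1) → Fin (n + 1)) (h : Fin (l + 1) → Fin (m + 1)) :
    (simplexMap f).comp (simplexMap h) = simplexMap (f ∘ h) := by
  ext1 x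
  exact stdSimplex.map_comp_apply h f x

theorem face_face {X : Type u} [TopologicalSpace X] {n : ℕ} (i : Fin (n + 3)) (j : Fin (n + 2))
    (σ : SingularSimplex (n + 2) X) :
    face j (face i σ) = σ.comp (simplexMap (i.succAbove ∘ j.succAbove)) := by
  rw [← simplexMap_comp]
  rfl

/-- The cup product of two `1`-cochains: `(α ∪ β) σ = α (σ|[v₀,v₁]) * β (σ|[v₁,v₂])`. -/
noncomputable def cupCochain {X : Type u} [TopologicalSpace X] {A : Type v} [CommRing A] :
    (SingularSimplex 1 X → A) →ₗ[A] (SingularSimplex 1 X → A) →ₗ[A] (SingularSimplex 2 X → A) :=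
  LinearMap.mk₂ A (fun α β σ => α (face 2 σ) * β (face 0 σ))
    (fun _ _ _ => funext fun _ => add_mul _ _ _) (fun _ _ _ => funext fun _ => mul_assoc _ _ _)
    (fun _ _ _ => funext fun _ => mul_add _ _ _)
    (fun _ _ _ => funext fun _ => mul_left_comm _ _ _)

theorem coboundary_zero_apply {X : Type u} [TopologicalSpace X] {A : Type v} [CommRing A]
    (c : SingularSimplex 0 X → A) (σ : SingularSimplex 1 X) :
    coboundary X A 0 c σ = c (face 0 σ) - c (face 1 σ) := by
  change (∑ i : Fin 2, (-1 : A) ^ (i : ℕ) * c (face i σ)) = _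
  rw [Fin.sum_univ_two]
  simp
  ring

theorem coboundary_one_apply {X : Type u} [TopologicalSpace X] {A : Type v} [CommRing A]
    (c : SingularSimplex 1 X → A) (σ : SingularSimplex 2 X) :
    coboundary X A 1 c σ = c (face 0 σ) - c (face 1 σ) + c (face 2 σ) := by
  change (∑ i : Fin 3, (-1 : A) ^ (i : ℕ) * c (face i σ)) = _
  rw [Fin.sum_univ_three]
  simp
  ring

theorem coboundary_two_apply {X : Type u} [TopologicalSpace X] {A : Type v} [CommRing A]
    (c : SingularSimplex 2 X → A) (σ : SingularSimplex 3 X) :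
    coboundary X A 2 c σ = c (face 0 σ) - c (face 1 σ) + c (face 2 σ) - c (face 3 σ) := by
  change (∑ i : Fin 4, (-1 : A) ^ (i : ℕ) * c (face i σ)) = _
  rw [Fin.sum_univ_four]
  simp [Odd.neg_one_pow (by decide : Odd 3)]
  ring

theorem cocycle_one {X : Type u} [TopologicalSpace X] {A : Type v} [CommRing A]
    (α : cocycles X A 1) (σ : SingularSimplex 2 X) :
    α.1 (face 1 σ) = α.1 (face 2 σ) + α.1 (face 0 σ) := by
  have h := congrFun (show coboundary X A 1 α.1 = 0 from α.2) σ
  rw [coboundary_one_apply, Pi.zero_apply] at h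
  linear_combination -h

theorem cup_mem_cocycles {X : Type u} [TopologicalSpace X] {A : Type v} [CommRing A]
    (α β : cocycles X A 1) : cupCochain α.1 β.1 ∈ cocycles X A 2 := by
  change coboundary X A 2 _ = 0
  funext τ
  have e02 : face 2 (face 0 τ) = face 0 (face 3 τ) := by
    rw [face_face, face_face]; congr 2; try (funext i; fin_cases i <;> rfl)
  have e12 : face 2 (face 1 τ) = face 1 (face 3 τ) := by
    rw [face_face, face_face]; congr 2; try (funext i; fin_cases i <;> rfl)
  have e22 : face 2 (face 2 τ) = face 2 (face 3 τ) := by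
    rw [face_face, face_face]; congr 2; try (funext i; fin_cases i <;> rfl)
  have e10 : face 0 (face 1 τ) = face 0 (face 0 τ) := by
    rw [face_face, face_face]; congr 2
  have e20 : face 0 (face 2 τ) = face 1 (face 0 τ) := by
    rw [face_face, face_face]; congr 2; try (funext i; fin_cases i <;> rfl)
  have h1 := cocycle_one α (face 3 τ)
  have h2 := cocycle_one β (face 0 τ)
  rw [e02] at h2
  rw [coboundary_two_apply]
  simp only [cupCochain, LinearMap.mk₂_apply, Pi.zero_apply, e02, e12, e22, e10, e20, h1, h2]
  ring

/-- The cup product of two `1`-cocycles. -/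
noncomputable def cupCocycle (X : Type u) [TopologicalSpace X] (A : Type v) [CommRing A] :
    cocycles X A 1 →ₗ[A] cocycles X A 1 →ₗ[A] cocycles X A 2 :=
  LinearMap.mk₂ A (fun α β => ⟨cupCochain α.1 β.1, cup_mem_cocycles α β⟩)
    (fun _ _ _ => Subtype.ext (by simp)) (fun _ _ _ => Subtype.ext (by simp))
    (fun _ _ _ => Subtype.ext (by simp)) (fun _ _ _ => Subtype.ext (by simp))

theorem cup_coboundary_left {X : Type u} [TopologicalSpace X] {A : Type v} [CommRing A]
    (α β : cocycles X A 1) (h : α ∈ (coboundaries X A 1).submoduleOf (cocycles X A 1)) :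
    Cohomology.mk X A 2 (cupCocycle X A α β) = 0 := by
  obtain ⟨f, hf⟩ := h
  refine (Submodule.Quotient.mk_eq_zero _).2 ?_
  refine ⟨fun σ => f (face 1 σ) * β.1 σ, ?_⟩
  funext σ
  have hβ := cocycle_one β σ
  have e1 : face 1 (face 1 σ) = face 1 (face 2 σ) := by
    rw [face_face, face_face]; congr 2; funext i; fin_cases i; rfl
  have e0 : face 1 (face 0 σ) = face 0 (face 2 σ) := by
    rw [face_face, face_face]; congr 2; funext i; fin_cases i; rfl
  change _ = α.1 (face 2 σ) * β.1 (face 0 σ)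
  have hα : α.1 (face 2 σ) = f (face 0 (face 2 σ)) - f (face 1 (face 2 σ)) := by
    have := congrFun hf (face 2 σ)
    rw [coboundary_zero_apply] at this
    exact this.symm
  rw [coboundary_one_apply]
  simp only [hα, hβ, e1, e0]
  ring

theorem cup_coboundary_right {X : Type u} [TopologicalSpace X] {A : Type v} [CommRing A]
    (α β : cocycles X A 1) (h : β ∈ (coboundaries X A 1).submoduleOf (cocycles X A 1)) :
    Cohomology.mk X A 2 (cupCocycle X A α β) = 0 := by
  obtain ⟨f, hf⟩ := h
  refine (Submodule.Quotient.mk_eq_zero _).2 ?_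
  refine ⟨fun σ => -(α.1 σ * f (face 0 σ)), ?_⟩
  funext σ
  have hα := cocycle_one α σ
  have e1 : face 0 (face 1 σ) = face 0 (face 0 σ) := by
    rw [face_face, face_face]; congr 2
  have e0 : face 0 (face 2 σ) = face 1 (face 0 σ) := by
    rw [face_face, face_face]; congr 2; funext i; fin_cases i; rfl
  change _ = α.1 (face 2 σ) * β.1 (face 0 σ)
  have hβ : β.1 (face 0 σ) = f (face 0 (face 0 σ)) - f (face 1 (face 0 σ)) := by
    have := congrFun hf (face 0 σ)
    rw [coboundary_zero_apply] at this
    exact this.symm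
  rw [coboundary_one_apply]
  simp only [hα, hβ, e1, e0]
  ring

/-- The cup product `H^1(X; A) × H^1(X; A) → H^2(X; A)`. -/
noncomputable def cup (X : Type u) [TopologicalSpace X] (A : Type v) [CommRing A] :
    Cohomology X A 1 →ₗ[A] Cohomology X A 1 →ₗ[A] Cohomology X A 2 :=
  Submodule.liftQ _
    (LinearMap.mk₂ A
      (fun (α : cocycles X A 1) (β : Cohomology X A 1) =>
        Submodule.liftQ ((coboundaries X A 1).submoduleOf (cocycles X A 1))
          (Cohomology.mk X A 2 ∘ₗ cupCocycle X A α)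
          (fun β hβ => cup_coboundary_right α β hβ) β)
      (by
        intro α α' β
        obtain ⟨β, rfl⟩ := Cohomology.mk_surjective X A 1 β
        change Cohomology.mk X A 2 _ = Cohomology.mk X A 2 _ + Cohomology.mk X A 2 _
        simp)
      (by
        intro a α β
        obtain ⟨β, rfl⟩ := Cohomology.mk_surjective X A 1 β
        change Cohomology.mk X A 2 _ = a • Cohomology.mk X A 2 _
        simp)
      (fun α β β' => map_add _ β β')
      (fun a α β => map_smul _ a β))
    (by
      intro α hα
      change _ = (0 : _ →ₗ[A] _)
      ext β
      obtain ⟨β, rfl⟩ := Cohomology.mk_surjective X A 1 β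
      exact cup_coboundary_left α β hα)

theorem cup_mk {X : Type u} [TopologicalSpace X] {A : Type v} [CommRing A]
    (α β : cocycles X A 1) :
    cup X A (Cohomology.mk X A 1 α) (Cohomology.mk X A 1 β) =
      Cohomology.mk X A 2 (cupCocycle X A α β) := rfl

/-- The evaluation `⟨c, ∑ k_σ σ⟩ = ∑ k_σ c(σ)` of a cochain on a chain. -/
noncomputable def evalChain {X : Type u} [TopologicalSpace X] {A : Type v} [CommRing A] {n : ℕ}
    (c : SingularSimplex n X → A) : (SingularSimplex n X →₀ ℤ) →+ A :=
  (Finsupp.linearCombination ℤ c).toAddMonoidHom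

theorem evalChain_boundary {X : Type u} [TopologicalSpace X] {A : Type v} [CommRing A] {n : ℕ}
    (c : SingularSimplex n X → A) (z : SingularSimplex (n + 1) X →₀ ℤ) :
    evalChain c (boundary X n z) = evalChain (coboundary X A n c) z := by
  induction z using Finsupp.induction_linear with
  | zero => simp
  | add a b ha hb => simp only [map_add, ha, hb]
  | single σ k => simp [evalChain, boundary, coboundary, map_sum]

/-- The Kronecker pairing `H^2(X; A) × H_2(X; ℤ) → A`, for a fixed class in `H_2(X; ℤ)`. -/
noncomputable def evalClass {X : Type u} [TopologicalSpace X] (A : Type v) [CommRing A]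
    (o : Homology X 2) : Cohomology X A 2 →ₗ[A] A :=
  Submodule.liftQ _
    { toFun := fun c : cocycles X A 2 =>
        QuotientAddGroup.lift ((boundaries X 2).addSubgroupOf (cycles X 2))
          ((evalChain c.1).comp (cycles X 2).subtype) (by
            rintro ⟨z, hz⟩ ⟨y, hy⟩
            have hy' : boundary X 2 y = z := hy
            have hc : coboundary X A 2 c.1 = 0 := c.2
            change evalChain c.1 z = 0
            rw [← hy', evalChain_boundary, hc]
            simp [evalChain]) o
      map_add' := by
        intro c d
        obtain ⟨z, rfl⟩ := QuotientAddGroup.mk_surjective o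
        change evalChain (c.1 + d.1) z.1 = evalChain c.1 z.1 + evalChain d.1 z.1
        simp [evalChain, Finsupp.linearCombination_apply, Finsupp.sum, Finset.sum_add_distrib]
      map_smul' := by
        intro a c
        obtain ⟨z, rfl⟩ := QuotientAddGroup.mk_surjective o
        change evalChain (a • c.1) z.1 = a * evalChain c.1 z.1
        simp only [evalChain, Finsupp.linearCombination_apply, Finsupp.sum, Finset.mul_sum,
          LinearMap.toAddMonoidHom_coe, Pi.smul_apply, smul_eq_mul, mul_smul_comm] }
    (by
      rintro ⟨c, hc⟩ ⟨b, hb⟩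
      obtain ⟨⟨z, hz⟩, rfl⟩ := QuotientAddGroup.mk_surjective o
      have hb' : coboundary X A 1 b = c := hb
      have hz' : boundary X 1 z = 0 := hz
      change evalChain c z = 0
      rw [← hb', ← evalChain_boundary, hz', map_zero])

/-- The intersection (cup product) pairing `ι(u, v) = ⟨u ∪ v, o⟩` on `H^1(X; A)`,
where `o` is the fundamental class. -/
noncomputable def intersectionPairing {X : Type u} [TopologicalSpace X] (o : Homology X 2)
    (A : Type v) [CommRing A] : Cohomology X A 1 →ₗ[A] Cohomology X A 1 →ₗ[A] A :=
  (cup X A).compr₂ (evalClass A o)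

/-! ### The closed oriented surface of genus `g` -/

/-- The point with parameter `t` on the boundary of the closed unit disc, regarded as a polygon
with `4 * g` sides, the `k`-th side being `k ≤ t ≤ k + 1`. -/
noncomputable def polygonBoundary (g : ℕ) (t : ℝ) : Metric.closedBall (0 : ℂ) 1 :=
  ⟨Complex.exp ((2 * Real.pi * (t / (4 * g)) : ℝ) * Complex.I), by
    rw [mem_closedBall_zero_iff, Complex.norm_exp_ofReal_mul_I]⟩

/-- The side identifications of the `4 * g`-gon according to the boundary word
`a₁ b₁ a₁⁻¹ b₁⁻¹ ⋯ a_g b_g a_g⁻¹ b_g⁻¹`. -/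
inductive SideIdentification (g : ℕ) :
    Metric.closedBall (0 : ℂ) 1 → Metric.closedBall (0 : ℂ) 1 → Prop
  | a (i : ℕ) (hi : i < g) (s : ℝ) (hs : s ∈ Set.Icc (0 : ℝ) 1) :
      SideIdentification g (polygonBoundary g (4 * i + s)) (polygonBoundary g (4 * i + 3 - s))
  | b (i : ℕ) (hi : i < g) (s : ℝ) (hs : s ∈ Set.Icc (0 : ℝ) 1) :
      SideIdentification g (polygonBoundary g (4 * i + 1 + s)) (polygonBoundary g (4 * i + 4 - s))

/-- The standard closed surface of genus `g` (`g ≥ 1`): the `4 * g`-gon with its sides identified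
in pairs, with the quotient topology. -/
def StandardSurface (g : ℕ) : Type := Quot (SideIdentification g)

instance (g : ℕ) : TopologicalSpace (StandardSurface g) :=
  inferInstanceAs (TopologicalSpace (Quot (SideIdentification g)))

/-- `X` is a closed orientable surface of genus `g` (`g ≥ 1`). -/
def IsSurfaceOfGenus (g : ℕ) (X : Type u) [TopologicalSpace X] : Prop :=
  Nonempty (X ≃ₜ StandardSurface g)

/-- `o` is a fundamental class, i.e. a generator of `H_2(X; ℤ)`. For a closed connected orientable
surface `H_2(X; ℤ)` is infinite cyclic, and the choice of a generator is the choice of an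
orientation. -/
def IsFundamentalClass {X : Type u} [TopologicalSpace X] (o : Homology X 2) : Prop :=
  ∀ z : Homology X 2, ∃ k : ℤ, z = k • o

/-! ### The mapping class group and its action on cohomology -/

/-- The group of orientation preserving homeomorphisms, i.e. of those which fix the fundamental
class `o`. -/
def HomeoPlus (X : Type u) [TopologicalSpace X] (o : Homology X 2) : Subgroup (X ≃ₜ X) where
  carrier := {f | pushforward (f : C(X, X)) 2 o = o}
  one_mem' := pushforward_id 2 o
  mul_mem' := by
    intro f h hf hh
    change pushforward ((f : C(X, X)).comp (h : C(X, X))) 2 o = o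
    rw [pushforward_comp, show pushforward (h : C(X, X)) 2 o = o from hh,
      show pushforward (f : C(X, X)) 2 o = o from hf]
  inv_mem' := by
    intro f hf
    change pushforward (f.symm : C(X, X)) 2 o = o
    have h : pushforward ((f.symm : C(X, X)).comp (f : C(X, X))) 2 o = o := by
      have e : (f.symm : C(X, X)).comp (f : C(X, X)) = ContinuousMap.id X := by
        ext x
        exact f.symm_apply_apply x
      rw [e, pushforward_id]
    rwa [pushforward_comp, show pushforward (f : C(X, X)) 2 o = o from hf] at h

/-- `f` is isotopic to the identity, i.e. connected to it by a continuous family of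
homeomorphisms. -/
def IsotopicToId {X : Type u} [TopologicalSpace X] (f : X ≃ₜ X) : Prop :=
  ∃ F : unitInterval → (X ≃ₜ X), Continuous (fun p : unitInterval × X => F p.1 p.2) ∧ F 0 = 1 ∧ F 1 = f

/-- The normal subgroup of the orientation preserving homeomorphisms isotopic to the identity. -/
def HomeoZero (X : Type u) [TopologicalSpace X] (o : Homology X 2) :
    Subgroup (HomeoPlus X o) where
  carrier := {f | IsotopicToId f.1}
  one_mem' := ⟨fun _ => 1, continuous_snd, rfl, rfl⟩
  mul_mem' := by
    rintro f h ⟨F, hF, hF0, hF1⟩ ⟨G, hG, hG0, hG1⟩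
    refine ⟨fun t => F t * G t, ?_, by simp [hF0, hG0], by simp [hF1, hG1]⟩
    exact hF.comp (continuous_fst.prodMk hG)
  inv_mem' := by
    rintro f ⟨F, hF, hF0, hF1⟩
    refine ⟨fun t => f.1⁻¹ * F (unitInterval.symm t), ?_, by simp [hF1], by simp [hF0]⟩
    exact f.1.symm.continuous.comp
      (hF.comp ((unitInterval.continuous_symm.comp continuous_fst).prodMk continuous_snd))

instance (X : Type u) [TopologicalSpace X] (o : Homology X 2) : (HomeoZero X o).Normal where
  conj_mem := by
    rintro f ⟨F, hF, hF0, hF1⟩ h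
    refine ⟨fun t => h.1 * F t * h.1⁻¹, ?_, by simp [hF0], by simp [hF1]⟩
    exact h.1.continuous.comp
      (hF.comp (continuous_fst.prodMk (h.1.symm.continuous.comp continuous_snd)))

/-- The mapping class group: isotopy classes of orientation preserving homeomorphisms. -/
abbrev MappingClassGroup (X : Type u) [TopologicalSpace X] (o : Homology X 2) : Type u :=
  HomeoPlus X o ⧸ HomeoZero X o

/-- The action `f · w = (f⁻¹)^* w` of the orientation preserving homeomorphisms on `H^1(X; A)`. -/
noncomputable def homeoAction (X : Type u) [TopologicalSpace X] (o : Homology X 2) (A : Type v)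
    [CommRing A] : Representation A (HomeoPlus X o) (Cohomology X A 1) where
  toFun f := pullback (f.1.symm : C(X, X)) A 1
  map_one' := pullback_id A 1
  map_mul' f h := pullback_comp (h.1.symm : C(X, X)) (f.1.symm : C(X, X)) A 1

theorem simplexMap_const {m : ℕ} (j : Fin 2) (x : stdSimplex ℝ (Fin (m + 1))) :
    simplexMap (n := 1) (fun _ => j) x = stdSimplex.vertex j := by
  have h : simplexMap (n := 1) (fun _ => j) x =
      (simplexMap (m := 0) (n := 1) (fun _ => j)).comp (simplexMap (n := 0) (fun _ => 0)) x := by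
    rw [simplexMap_comp]
    rfl
  rw [h, ContinuousMap.comp_apply]
  generalize simplexMap (n := 0) (fun _ => 0) x = y
  have hy : y = stdSimplex.vertex (0 : Fin 1) := Subsingleton.elim _ _
  rw [hy]
  exact stdSimplex.map_vertex _ _

/-- Homeomorphisms isotopic to the identity act trivially on `H^1`. -/
theorem pullback_of_isotopicToId {X : Type u} [TopologicalSpace X] (A : Type v) [CommRing A]
    (f : X ≃ₜ X) (hf : IsotopicToId f) : pullback (f : C(X, X)) A 1 = LinearMap.id := by
  obtain ⟨F, hF, hF0, hF1⟩ := hf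
  ext c
  obtain ⟨c, rfl⟩ := Cohomology.mk_surjective X A 1 c
  let K (σ : SingularSimplex 1 X) (m : ℕ) (h q : Fin (m + 1) → Fin 2) : SingularSimplex m X :=
    ⟨fun x => F (stdSimplexHomeomorphUnitInterval (simplexMap (n := 1) h x))
        (σ (simplexMap (n := 1) q x)),
      hF.comp ((stdSimplexHomeomorphUnitInterval.continuous.comp
        (simplexMap (n := 1) h).continuous).prodMk
          (σ.continuous.comp (simplexMap (n := 1) q).continuous))⟩
  have faceK : ∀ (σ : SingularSimplex 1 X) (m : ℕ) (h q : Fin (m + 2) → Fin 2) (i : Fin (m + 2)),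
      face i (K σ (m + 1) h q) = K σ m (h ∘ i.succAbove) (q ∘ i.succAbove) := by
    intro σ m h q i
    ext x
    change F (stdSimplexHomeomorphUnitInterval (stdSimplex.map h (stdSimplex.map i.succAbove x)))
        (σ (stdSimplex.map q (stdSimplex.map i.succAbove x))) = _
    rw [stdSimplex.map_comp_apply, stdSimplex.map_comp_apply]
    rfl
  have hid : ∀ x : stdSimplex ℝ (Fin 2), simplexMap (m := 1) (n := 1) id x = x :=
    stdSimplex.map_id_apply
  let b : SingularSimplex 0 X → A := fun p => c.1
    ⟨fun x => F (stdSimplexHomeomorphUnitInterval x) (p (simplexMap (n := 0) (fun _ => 0) x)),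
      hF.comp (stdSimplexHomeomorphUnitInterval.continuous.prodMk
        (p.continuous.comp (simplexMap (n := 0) (fun _ => 0)).continuous))⟩
  have hb : ∀ (σ : SingularSimplex 1 X) (i : Fin 2),
      b (face i σ) = c.1 (K σ 1 id (fun _ => i.succAbove 0)) := by
    intro σ i
    refine congrArg c.1 ?_
    ext x
    change F (stdSimplexHomeomorphUnitInterval x) (σ (stdSimplex.map _ (stdSimplex.map _ x))) =
      F (stdSimplexHomeomorphUnitInterval (stdSimplex.map id x)) (σ (stdSimplex.map _ x))
    rw [stdSimplex.map_comp_apply, stdSimplex.map_id_apply]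
    rfl
  have h0 : ∀ σ : SingularSimplex 1 X, K σ 1 (fun _ => 0) id = σ := by
    intro σ
    ext x
    change F (stdSimplexHomeomorphUnitInterval _) (σ (simplexMap (m := 1) (n := 1) id x)) = σ x
    rw [simplexMap_const, hid, show stdSimplexHomeomorphUnitInterval (stdSimplex.vertex 0) = 0 from
      stdSimplexHomeomorphUnitInterval_zero, hF0]
    rfl
  have h1 : ∀ σ : SingularSimplex 1 X, K σ 1 (fun _ => 1) id = (f : C(X, X)).comp σ := by
    intro σ
    ext x
    change F (stdSimplexHomeomorphUnitInterval _) (σ (simplexMap (m := 1) (n := 1) id x)) = f (σ x)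
    rw [simplexMap_const, hid, show stdSimplexHomeomorphUnitInterval (stdSimplex.vertex 1) = 1 from
      stdSimplexHomeomorphUnitInterval_one, hF1]
  have key : ∀ σ : SingularSimplex 1 X,
      c.1 ((f : C(X, X)).comp σ) - c.1 σ = b (face 0 σ) - b (face 1 σ) := by
    intro σ
    have t1 := cocycle_one c (K σ 2 ![0, 1, 1] ![0, 0, 1])
    have t2 := cocycle_one c (K σ 2 ![0, 0, 1] ![0, 1, 1])
    simp only [faceK] at t1 t2
    have a1 : (![0, 1, 1] : Fin 3 → Fin 2) ∘ (1 : Fin 3).succAbove = id := by decide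
    have a0 : (![0, 1, 1] : Fin 3 → Fin 2) ∘ (0 : Fin 3).succAbove = fun _ => 1 := by decide
    have a2 : (![0, 1, 1] : Fin 3 → Fin 2) ∘ (2 : Fin 3).succAbove = id := by decide
    have b1 : (![0, 0, 1] : Fin 3 → Fin 2) ∘ (1 : Fin 3).succAbove = id := by decide
    have b0 : (![0, 0, 1] : Fin 3 → Fin 2) ∘ (0 : Fin 3).succAbove = id := by decide
    have b2 : (![0, 0, 1] : Fin 3 → Fin 2) ∘ (2 : Fin 3).succAbove = fun _ => 0 := by decide
    erw [a1, a0, a2, b1, b0, b2] at t1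
    erw [a1, a0, a2, b1, b0, b2] at t2
    rw [h1] at t1
    rw [h0] at t2
    rw [hb, hb]
    change c.1 ((f : C(X, X)).comp σ) - c.1 σ =
      c.1 (K σ 1 id (fun _ => 1)) - c.1 (K σ 1 id (fun _ => 0))
    linear_combination t2 - t1
  refine (Submodule.Quotient.eq _).2 ?_
  refine ⟨b, ?_⟩
  funext σ
  rw [coboundary_zero_apply, ← key]
  rfl

/-- The action of the mapping class group on `H^1(X; A)`, induced by `f · w = (f⁻¹)^* w`. -/
noncomputable def mcgAction (X : Type u) [TopologicalSpace X] (o : Homology X 2) (A : Type v)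
    [CommRing A] : Representation A (MappingClassGroup X o) (Cohomology X A 1) :=
  QuotientGroup.lift (HomeoZero X o) (homeoAction X o A) (by
    intro f hf
    exact pullback_of_isotopicToId A f⁻¹.1 ((HomeoZero X o).inv_mem hf))

theorem mcgAction_mk {X : Type u} [TopologicalSpace X] (o : Homology X 2) (A : Type v)
    [CommRing A] (f : HomeoPlus X o) :
    mcgAction X o A (QuotientGroup.mk f) = pullback (f.1.symm : C(X, X)) A 1 := rfl

/-- The diagonal action of the mapping class group on the second exterior power over `ℤ` of
`H^1(X; ℝ)`, regarded as an abelian group. -/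
noncomputable def mcgActionExtSq (X : Type u) [TopologicalSpace X] (o : Homology X 2) :
    Representation ℤ (MappingClassGroup X o) (⋀[ℤ]^2 (Cohomology X ℝ 1)) where
  toFun φ := exteriorPower.map 2 ((mcgAction X o ℝ φ).restrictScalars ℤ)
  map_one' := by
    have h : ((mcgAction X o ℝ 1).restrictScalars ℤ : Cohomology X ℝ 1 →ₗ[ℤ] Cohomology X ℝ 1) =
        LinearMap.id := by
      rw [map_one]
      rfl
    rw [h]
    ext x
    simp
  map_mul' φ ψ := by
    rw [map_mul]
    exact exteriorPower.map_comp ((mcgAction X o ℝ ψ).restrictScalars ℤ)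
      ((mcgAction X o ℝ φ).restrictScalars ℤ)

/-- The class of `x ∧ y` in the coinvariants of the second exterior power. -/
noncomputable def wedgeClass {X : Type u} [TopologicalSpace X] (o : Homology X 2)
    (x y : Cohomology X ℝ 1) : (mcgActionExtSq X o).Coinvariants :=
  Representation.Coinvariants.mk (mcgActionExtSq X o) (exteriorPower.ιMulti ℤ 2 ![x, y])

/-- The element `∑ i, a_i u_i` of `H^1(X; ℝ)`, for real `a_i` and rational classes `u_i`. -/
noncomputable def realCombination {X : Type u} [TopologicalSpace X] {m : ℕ} (a : Fin m → ℝ)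
    (x : Fin m → Cohomology X ℚ 1) : Cohomology X ℝ 1 :=
  ∑ i, a i • changeCoeff X (algebraMap ℚ ℝ) 1 (x i)

/-- The second symmetric power of `ℝ`, regarded as a vector space over `ℚ`. -/
abbrev SymSq : Type := SymmetricPower ℚ (Fin 2) ℝ

/-- The product `â b̂` in the second symmetric power of `ℝ` over `ℚ`. -/
noncomputable def symMul (a b : ℝ) : SymSq := SymmetricPower.tprod ℚ ![a, b]

end SurfaceTopology

/-!
The surface is the quotient of the closed unit disc, seen as a `4 g`-gon, by the usual side
identifications. All topological input is obtained from the polygon by hand.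

*Cohomology.* Integrating a `1`-cocycle along the sides of the polygon gives the periods of its
class. Since the disc is contractible, the pulled back cocycle has a potential; if the periods
vanish, the potential descends to the surface, and it is a primitive near every point because the
surface is covered by three open sets which contract, compatibly with the identifications, to the
centre of the polygon, to its corners and to the midpoints of its sides (`period_injective`).
Conversely the strip joining a side to the side identified with it defines a map to the circle,
whose class has one period equal to `1` and the others equal to `0` (`exists_period_eq_single`).
Hence `H^1` with any coefficients is the space of period vectors.

*The pairing.* The polygon, cut into cones over its sides, is a `2`-cycle, and evaluating cup
products on it gives the standard symplectic form on periods (`intersectionPairing_polygonClass`).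
As its class is an integral multiple of the fundamental class, and the symplectic form is not
zero, the intersection pairing is a nonzero rational multiple of the symplectic form
(`exists_intersectionPairing_eq`). For the same reason a homeomorphism is orientation preserving
as soon as it preserves the symplectic form (`mem_homeoPlus`), and every orientation preserving
homeomorphism preserves the intersection pairing.

*Mapping classes.* Two kinds of mapping classes suffice: the rotation of the polygon by four
sides, which permutes the handles cyclically (`exists_rotation`), and the Dehn twists along the
strips, which act on periods by transvections (`period_twist`).

*Coinvariants.* Let `a_i(x)`, `b_i(x)` be the real classes dual to the sides, with period `x`. The
twists show that in the coinvariants only the elements `a_i(x) ∧ b_i(y)` survive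
(`wedgeClass_dualClass_eq_zero`) and that they are symmetric in `x` and `y`
(`wedgeClass_dualClass_symm`); the rotation shows that they do not depend on `i`. So the
coinvariants are generated by a symmetric biadditive function of two real numbers. Such a function
is automatically balanced over `ℚ` (`biadditive_rat_smul`), hence defined on the symmetric square
over `ℚ` (`exists_symSq_lift`). This is inverse to the map induced by the invariant pairing
(`exists_addEquiv`). Uniqueness holds because every real class is a real combination of rational
classes (`exists_realCombination`).
-/

namespace SurfaceTopology

universe u v w

/-! ### Affine simplices and potentials of cocycles -/

section Potential

variable {X : Type u} [TopologicalSpace X]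
variable {E : Type w} [AddCommGroup E] [TopologicalSpace E] [IsTopologicalAddGroup E]
  [Module ℝ E] [ContinuousSMul ℝ E]

/-- The affine map of the standard simplex into a topological vector space with the given images
of the vertices. -/
noncomputable def affineSimplex {n : ℕ} (p : Fin (n + 1) → E) : SingularSimplex n E :=
  ⟨fun v => ∑ i, v.1 i • p i, continuous_finsetSum _ fun i _ =>
    ((continuous_apply i).comp continuous_subtype_val).smul continuous_const⟩

theorem affineSimplex_simplexMap {m n : ℕ} (p : Fin (n + 1) → E) (f : Fin (m + 1) → Fin (n + 1)) :
    (affineSimplex p).comp (simplexMap f) = affineSimplex (p ∘ f) := by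
  ext v
  change ∑ i, FunOnFinite.linearMap ℝ ℝ f v.1 i • p i = ∑ i, v.1 i • p (f i)
  simp only [FunOnFinite.linearMap_apply_apply, Finset.sum_smul]
  rw [← Finset.sum_fiberwise Finset.univ f (fun i => v.1 i • p (f i))]
  refine Finset.sum_congr rfl fun j _ => Finset.sum_congr rfl fun i hi => ?_
  rw [(Finset.mem_filter.1 hi).2]

theorem face_comp_affineSimplex (F : C(E, X)) {n : ℕ} (p : Fin (n + 2) → E) (i : Fin (n + 2)) :
    face i (F.comp (affineSimplex p) : SingularSimplex (n + 1) X) =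
      F.comp (affineSimplex (p ∘ i.succAbove)) := by
  rw [face_comp]
  exact congrArg _ (affineSimplex_simplexMap p i.succAbove)

/-- The affine path from `p` to `q`, parametrised by the whole real line. -/
noncomputable def segmentPath (p q : E) : C(ℝ, E) :=
  ⟨fun t => (1 - t) • p + t • q, by fun_prop⟩

/-- The singular `1`-simplex given by the restriction of a path `ℝ → X` to the unit interval. -/
def pathSimplex (γ : C(ℝ, X)) : SingularSimplex 1 X :=
  ⟨fun v => γ (v.1 1), γ.continuous.comp ((continuous_apply 1).comp continuous_subtype_val)⟩

theorem pathSimplex_congr {γ δ : C(ℝ, X)} (h : ∀ t ∈ Set.Icc (0 : ℝ) 1, γ t = δ t) :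
    pathSimplex γ = pathSimplex δ := by
  ext v
  exact h _ ⟨v.2.1 1, stdSimplex.le_one v 1⟩

/-- The parametrisation of the standard `1`-simplex by the real line, constant outside the unit
interval. -/
noncomputable def simplexParam : C(ℝ, stdSimplex ℝ (Fin 2)) :=
  ⟨fun t => stdSimplexHomeomorphUnitInterval.symm (Set.projIcc 0 1 zero_le_one t), by fun_prop⟩

theorem pathSimplex_comp_simplexParam (σ : SingularSimplex 1 X) :
    pathSimplex (σ.comp simplexParam) = σ := by
  ext v
  change σ (stdSimplexHomeomorphUnitInterval.symm (Set.projIcc 0 1 zero_le_one (v.1 1))) = σ v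
  congr 1
  rw [Homeomorph.symm_apply_eq, Set.projIcc_of_mem zero_le_one
    (show v.1 1 ∈ Set.Icc (0 : ℝ) 1 from ⟨v.2.1 1, stdSimplex.le_one v 1⟩)]
  rfl

theorem pathSimplex_segmentPath (F : C(E, X)) (p q : E) :
    pathSimplex (F.comp (segmentPath p q)) = F.comp (affineSimplex ![p, q]) := by
  ext v
  change F ((1 - v.1 1) • p + v.1 1 • q) = F (∑ i, v.1 i • ![p, q] i)
  rw [Fin.sum_univ_two, ← show v.1 0 = 1 - v.1 1 from eq_sub_of_add_eq (stdSimplex.add_eq_one v)]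
  rfl

variable {A : Type v} [CommRing A]

theorem cocycle_triangle (α : cocycles X A 1) (F : C(E, X)) (p q r : E) :
    α.1 (pathSimplex (F.comp (segmentPath p r))) =
      α.1 (pathSimplex (F.comp (segmentPath p q))) +
        α.1 (pathSimplex (F.comp (segmentPath q r))) := by
  have h := cocycle_one α (F.comp (affineSimplex ![p, q, r]))
  simp only [face_comp_affineSimplex] at h
  simp only [pathSimplex_segmentPath]
  convert h using 5 <;> (funext i; fin_cases i <;> rfl)

theorem cocycle_const (α : cocycles X A 1) (x : X) :
    α.1 (pathSimplex (ContinuousMap.const ℝ x)) = 0 := by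
  have h := cocycle_triangle α (ContinuousMap.const ℝ x) (0 : ℝ) 0 0
  exact left_eq_add.1 h

/-- Pulled back to a topological vector space, a cocycle of degree one is the coboundary of a
function: contract a path linearly to the origin and cut the square swept out into two
triangles. -/
theorem exists_potential (α : cocycles X A 1) (F : C(E, X)) :
    ∃ ψ : E → A, ∀ γ : C(ℝ, E), α.1 (pathSimplex (F.comp γ)) = ψ (γ 1) - ψ (γ 0) := by
  refine ⟨fun p => -α.1 (pathSimplex (F.comp (segmentPath p 0))), fun γ => ?_⟩
  let G : C(ℝ × ℝ, X) := ⟨fun x => F ((1 - x.2) • γ x.1), by fun_prop⟩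
  have h1 := cocycle_triangle α G (0, 0) (1, 0) (1, 1)
  have h2 := cocycle_triangle α G (0, 0) (0, 1) (1, 1)
  have e1 : G.comp (segmentPath (0, 0) (1, 0)) = F.comp γ := by
    ext t; simp [G, segmentPath]
  have e2 : G.comp (segmentPath (1, 0) (1, 1)) = F.comp (segmentPath (γ 1) 0) := by
    ext t; simp [G, segmentPath]
  have e3 : G.comp (segmentPath (0, 0) (0, 1)) = F.comp (segmentPath (γ 0) 0) := by
    ext t; simp [G, segmentPath]
  have e4 : G.comp (segmentPath (0, 1) (1, 1)) = ContinuousMap.const ℝ (F 0) := by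
    ext t; simp [G, segmentPath]
  rw [e1, e2] at h1
  rw [e3, e4, cocycle_const] at h2
  linear_combination h2 - h1

/-- A cocycle all of whose values are differences of the values of a function at the ends of
paths is a coboundary. -/
theorem mk_eq_zero_of_potential (α : cocycles X A 1) (φ : X → A)
    (h : ∀ γ : C(ℝ, X), α.1 (pathSimplex γ) = φ (γ 1) - φ (γ 0)) :
    Cohomology.mk X A 1 α = 0 := by
  refine (Submodule.Quotient.mk_eq_zero _).2 ⟨fun p => φ (p (stdSimplex.vertex 0)), ?_⟩
  funext σ
  rw [coboundary_zero_apply]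
  have h1 := h (σ.comp simplexParam)
  rw [pathSimplex_comp_simplexParam] at h1
  refine Eq.trans ?_ h1.symm
  have e : ∀ i : Fin 2, face i σ (stdSimplex.vertex 0) = σ (stdSimplex.vertex (i.succAbove 0)) :=
    fun i => congrArg σ (stdSimplex.map_vertex _ _)
  have e1 : simplexParam 1 = stdSimplex.vertex 1 := by
    change stdSimplexHomeomorphUnitInterval.symm (Set.projIcc 0 1 zero_le_one 1) = _
    rw [Homeomorph.symm_apply_eq, Set.projIcc_right]
    rfl
  have e0 : simplexParam 0 = stdSimplex.vertex 0 := by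
    change stdSimplexHomeomorphUnitInterval.symm (Set.projIcc 0 1 zero_le_one 0) = _
    rw [Homeomorph.symm_apply_eq, Set.projIcc_left]
    rfl
  rw [e, e, ContinuousMap.comp_apply, ContinuousMap.comp_apply, e0, e1]
  rfl

end Potential

/-! ### The polygon and its side identifications -/

section Polygon

variable {g : ℕ}

/-- The point of the unit circle with parameter `t`, as a complex number. The side number `k` of
the polygon is `k ≤ t ≤ k + 1`. -/
noncomputable def circlePoint (g : ℕ) : C(ℝ, ℂ) :=
  ⟨fun t => Complex.exp ((2 * Real.pi * (t / (4 * g)) : ℝ) * Complex.I), by fun_prop⟩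

theorem circlePoint_apply (t : ℝ) :
    circlePoint g t = Complex.exp ((2 * Real.pi * (t / (4 * g)) : ℝ) * Complex.I) := rfl

theorem norm_circlePoint (t : ℝ) : ‖circlePoint g t‖ = 1 :=
  Complex.norm_exp_ofReal_mul_I _

theorem circlePoint_add (s t : ℝ) : circlePoint g (s + t) = circlePoint g s * circlePoint g t := by
  simp only [circlePoint_apply, ← Complex.exp_add]
  push_cast
  ring_nf

theorem circlePoint_zero : circlePoint g 0 = 1 := by simp [circlePoint_apply]

theorem circlePoint_neg (t : ℝ) : circlePoint g (-t) = (starRingEnd ℂ) (circlePoint g t) := by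
  simp only [circlePoint_apply, ← Complex.exp_conj, map_mul, Complex.conj_ofReal, Complex.conj_I]
  push_cast
  ring_nf

theorem circlePoint_period (hg : g ≠ 0) (t : ℝ) :
    circlePoint g (t + 4 * g) = circlePoint g t := by
  have : circlePoint g (4 * g) = 1 := by
    have h : (g : ℝ) ≠ 0 := by exact_mod_cast hg
    rw [circlePoint_apply, div_self (by positivity), Complex.exp_eq_one_iff]
    exact ⟨1, by push_cast; ring⟩
  rw [circlePoint_add, this, mul_one]

/-- The parameter of the initial point of the side `a_i` (for `j = (i, 0)`) or `b_i`
(for `j = (i, 1)`). The side starting at `corner j` is identified with the side ending at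
`corner j + 3`. -/
def corner (j : Fin g × Fin 2) : ℝ := 4 * (j.1 : ℕ) + (j.2 : ℕ)

/-- A presentation of a space `X` as the quotient of the `4 g`-gon by the side identifications. -/
structure PolygonModel (g : ℕ) (X : Type u) [TopologicalSpace X] where
  /-- The quotient map. -/
  proj : Metric.closedBall (0 : ℂ) 1 → X
  isQuotientMap : Topology.IsQuotientMap proj
  proj_eq_iff : ∀ p q, proj p = proj q ↔ Relation.EqvGen (SideIdentification g) p q

theorem IsSurfaceOfGenus.nonempty_model {X : Type u} [TopologicalSpace X]
    (h : IsSurfaceOfGenus g X) : Nonempty (PolygonModel g X) := by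
  obtain ⟨e⟩ := h
  refine ⟨⟨fun p => e.symm (Quot.mk _ p), ?_, fun p q => ?_⟩⟩
  · exact e.symm.isQuotientMap.comp isQuotientMap_quot_mk
  · exact e.symm.injective.eq_iff.trans Quot.eq

/-- The radial retraction of the plane onto the closed unit disc. -/
noncomputable def discRetraction : C(ℂ, Metric.closedBall (0 : ℂ) 1) :=
  ⟨fun z => ⟨((max 1 ‖z‖)⁻¹ : ℝ) • z, by
    have h : 0 < max 1 ‖z‖ := lt_max_of_lt_left one_pos
    rw [mem_closedBall_zero_iff, norm_smul, Real.norm_of_nonneg (by positivity), inv_mul_le_iff₀ h]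
    simp⟩, by
    refine Continuous.subtype_mk (Continuous.smul
      (Continuous.inv₀ (continuous_const.max continuous_norm) fun z => ?_) continuous_id) _
    exact (lt_max_of_lt_left one_pos).ne'⟩

theorem discRetraction_of_norm_le {z : ℂ} (hz : ‖z‖ ≤ 1) :
    discRetraction z = ⟨z, mem_closedBall_zero_iff.2 hz⟩ := by
  refine Subtype.ext ?_
  change ((max 1 ‖z‖)⁻¹ : ℝ) • z = z
  rw [max_eq_left hz, inv_one, one_smul]

namespace PolygonModel

variable {X : Type u} [TopologicalSpace X] (M : PolygonModel g X)

/-- The quotient map of the polygon, extended to the plane by the radial retraction. -/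
noncomputable def map : C(ℂ, X) :=
  (⟨M.proj, M.isQuotientMap.continuous⟩ : C(_, X)).comp discRetraction

theorem map_of_norm_le {z : ℂ} (hz : ‖z‖ ≤ 1) :
    M.map z = M.proj ⟨z, mem_closedBall_zero_iff.2 hz⟩ :=
  congrArg M.proj (discRetraction_of_norm_le hz)

theorem proj_eq_map (p : Metric.closedBall (0 : ℂ) 1) : M.proj p = M.map p :=
  (M.map_of_norm_le (mem_closedBall_zero_iff.1 p.2)).symm

theorem exists_map_eq (x : X) : ∃ z : ℂ, ‖z‖ ≤ 1 ∧ M.map z = x := by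
  obtain ⟨p, rfl⟩ := M.isQuotientMap.surjective x
  exact ⟨p, mem_closedBall_zero_iff.1 p.2, (M.proj_eq_map p).symm⟩

theorem map_side (j : Fin g × Fin 2) {s : ℝ} (hs : s ∈ Set.Icc (0 : ℝ) 1) :
    M.map (circlePoint g (corner j + s)) = M.map (circlePoint g (corner j + 3 - s)) := by
  rw [M.map_of_norm_le (norm_circlePoint _).le, M.map_of_norm_le (norm_circlePoint _).le,
    M.proj_eq_iff]
  obtain ⟨i, e⟩ := j
  fin_cases e
  · convert! Relation.EqvGen.rel _ _ (SideIdentification.a i i.2 s hs) using 2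
    · simp [corner, circlePoint_apply, polygonBoundary]
    · simp [corner, circlePoint_apply, polygonBoundary]
  · convert! Relation.EqvGen.rel _ _ (SideIdentification.b i i.2 s hs) using 2
    · simp [corner, circlePoint_apply, polygonBoundary]
    · simp [corner, circlePoint_apply, polygonBoundary]
      ring_nf

/-- A function on the disc compatible with the side identifications factors through `X`. -/
theorem factor_of_side {Y : Type*} (f : ℂ → Y)
    (hf : ∀ (j : Fin g × Fin 2), ∀ s ∈ Set.Icc (0 : ℝ) 1,
      f (circlePoint g (corner j + s)) = f (circlePoint g (corner j + 3 - s)))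
    {z w : ℂ} (hz : ‖z‖ ≤ 1) (hw : ‖w‖ ≤ 1) (h : M.map z = M.map w) : f z = f w := by
  rw [M.map_of_norm_le hz, M.map_of_norm_le hw, M.proj_eq_iff] at h
  have key : ∀ p q : Metric.closedBall (0 : ℂ) 1,
      Relation.EqvGen (SideIdentification g) p q → f p = f q := by
    intro p q h
    induction h with
    | rel p q h =>
      cases h with
      | a i hi s hs =>
        have := hf (⟨i, hi⟩, 0) s hs
        simp only [corner, Fin.val_zero, Nat.cast_zero, add_zero] at this
        exact this
      | b i hi s hs =>
        have := hf (⟨i, hi⟩, 1) s hs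
        simp only [corner, Fin.val_one, Nat.cast_one] at this
        refine this.trans (congrArg (fun t => f (circlePoint g t)) ?_)
        ring
    | refl => rfl
    | symm _ _ _ ih => exact ih.symm
    | trans _ _ _ _ _ ih1 ih2 => exact ih1.trans ih2
  exact key _ _ h

theorem exists_function_descent {Y : Type*} (f : ℂ → Y)
    (hf : ∀ (j : Fin g × Fin 2), ∀ s ∈ Set.Icc (0 : ℝ) 1,
      f (circlePoint g (corner j + s)) = f (circlePoint g (corner j + 3 - s))) :
    ∃ F : X → Y, ∀ z : ℂ, ‖z‖ ≤ 1 → F (M.map z) = f z := by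
  choose r hr hr' using M.exists_map_eq
  exact ⟨fun x => f (r x), fun z hz => M.factor_of_side f hf (hr _) hz (hr' _)⟩

theorem continuous_of_comp_map {Y : Type*} [TopologicalSpace Y] {F : X → Y} {f : ℂ → Y}
    (hf : Continuous f) (h : ∀ z : ℂ, ‖z‖ ≤ 1 → F (M.map z) = f z) : Continuous F := by
  rw [M.isQuotientMap.continuous_iff]
  have e : F ∘ M.proj = f ∘ Subtype.val := by
    funext p
    rw [Function.comp_apply, M.proj_eq_map, h _ (mem_closedBall_zero_iff.1 p.2)]
    rfl
  rw [e]
  exact hf.comp continuous_subtype_val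

theorem exists_descent {Y : Type*} [TopologicalSpace Y] (f : C(ℂ, Y))
    (hf : ∀ (j : Fin g × Fin 2), ∀ s ∈ Set.Icc (0 : ℝ) 1,
      f (circlePoint g (corner j + s)) = f (circlePoint g (corner j + 3 - s))) :
    ∃ F : C(X, Y), ∀ z : ℂ, ‖z‖ ≤ 1 → F (M.map z) = f z := by
  obtain ⟨F, hF⟩ := M.exists_function_descent f hf
  exact ⟨⟨F, M.continuous_of_comp_map f.continuous hF⟩, hF⟩

/-! ### Periods of cocycles along the sides -/

variable {A : Type v} [CommRing A]

/-- The path in `X` along the side starting at `corner j`; it is a loop. -/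
noncomputable def sidePath (j : Fin g × Fin 2) : C(ℝ, X) :=
  M.map.comp ⟨fun t => circlePoint g (corner j + t), by fun_prop⟩

theorem sidePath_zero_eq_one (j : Fin g × Fin 2) : M.sidePath j 0 = M.sidePath j 1 := by
  have hm : ∀ t : ℝ, ∀ j', M.sidePath j' t = M.map (circlePoint g (corner j' + t)) :=
    fun _ _ => rfl
  have h0 : (0 : ℝ) ∈ Set.Icc (0 : ℝ) 1 := by simp
  have h1 : (1 : ℝ) ∈ Set.Icc (0 : ℝ) 1 := by simp
  obtain ⟨i, e⟩ := j
  have ha0 := M.map_side (i, 0) h0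
  have ha1 := M.map_side (i, 0) h1
  have hb0 := M.map_side (i, 1) h0
  have hb1 := M.map_side (i, 1) h1
  rw [hm, hm]
  simp only [corner, Fin.val_zero, Fin.val_one, Nat.cast_zero, Nat.cast_one] at *
  ring_nf at *
  fin_cases e
  · simp only [Nat.cast_zero, add_zero]
    rw [ha0, ← hb1, ha1]
  · simp only [Nat.cast_one]
    ring_nf
    rw [ha1]

/-- The periods of a cocycle along the sides of the polygon. -/
noncomputable def cocyclePeriod : cocycles X A 1 →ₗ[A] (Fin g × Fin 2 → A) where
  toFun α j := α.1 (pathSimplex (M.sidePath j))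
  map_add' _ _ := rfl
  map_smul' _ _ := rfl

/-- The periods of a cohomology class along the sides of the polygon. -/
noncomputable def period (A : Type v) [CommRing A] :
    Cohomology X A 1 →ₗ[A] (Fin g × Fin 2 → A) :=
  Submodule.liftQ _ M.cocyclePeriod (by
    rintro ⟨c, hc⟩ ⟨b, rfl⟩
    funext j
    change coboundary X A 0 b (pathSimplex (M.sidePath j)) = 0
    rw [coboundary_zero_apply, sub_eq_zero]
    congr 1
    ext v
    change M.sidePath j ((stdSimplex.map _ v).1 1) = M.sidePath j ((stdSimplex.map _ v).1 1)
    have hv : v = stdSimplex.vertex (0 : Fin 1) := Subsingleton.elim _ _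
    subst hv
    rw [stdSimplex.map_vertex, stdSimplex.map_vertex]
    simpa using (M.sidePath_zero_eq_one j).symm)

theorem period_mk (α : cocycles X A 1) (j : Fin g × Fin 2) :
    M.period A (Cohomology.mk X A 1 α) j = α.1 (pathSimplex (M.sidePath j)) := rfl

/-- `φ` is a potential of the pullback of the cocycle `α` to the polygon. -/
def IsPotential (α : cocycles X A 1) (φ : ℂ → A) : Prop :=
  ∀ γ : C(ℝ, ℂ), α.1 (pathSimplex (M.map.comp γ)) = φ (γ 1) - φ (γ 0)

theorem exists_isPotential (α : cocycles X A 1) : ∃ φ : ℂ → A, M.IsPotential α φ :=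
  exists_potential α M.map

variable {M}

theorem IsPotential.period_eq {α : cocycles X A 1} {φ : ℂ → A} (h : M.IsPotential α φ)
    (j : Fin g × Fin 2) : M.period A (Cohomology.mk X A 1 α) j =
      φ (circlePoint g (corner j + 1)) - φ (circlePoint g (corner j)) := by
  rw [period_mk, sidePath, h]
  simp

/-- Along identified sides a potential changes by the same amounts, because both sides are
mapped to the same path of the surface. -/
theorem IsPotential.side {α : cocycles X A 1} {φ : ℂ → A} (h : M.IsPotential α φ)
    (j : Fin g × Fin 2) {s : ℝ} (hs : s ∈ Set.Icc (0 : ℝ) 1) :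
    φ (circlePoint g (corner j + s)) - φ (circlePoint g (corner j)) =
      φ (circlePoint g (corner j + 3 - s)) - φ (circlePoint g (corner j + 3)) := by
  have h1 := h ⟨fun t => circlePoint g (corner j + t * s), by fun_prop⟩
  have h2 := h ⟨fun t => circlePoint g (corner j + 3 - t * s), by fun_prop⟩
  simp only [ContinuousMap.coe_mk, one_mul, zero_mul, add_zero, sub_zero] at h1 h2
  rw [← h1, ← h2]
  refine congrArg α.1 (pathSimplex_congr fun t ht => ?_)
  exact M.map_side j ⟨mul_nonneg ht.1 hs.1, mul_le_one₀ ht.2 hs.1 hs.2⟩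

/-- The values of a potential at the corners of the `i`-th handle. In particular the values
at the first and the last corner agree. -/
theorem IsPotential.corner_values {α : cocycles X A 1} {φ : ℂ → A} (h : M.IsPotential α φ)
    (i : Fin g) :
    let c := φ (circlePoint g (4 * (i : ℕ)))
    let a := M.period A (Cohomology.mk X A 1 α) (i, 0)
    let b := M.period A (Cohomology.mk X A 1 α) (i, 1)
    φ (circlePoint g (4 * (i : ℕ) + 1)) = c + a ∧ φ (circlePoint g (4 * (i : ℕ) + 2)) = c + a + b ∧
      φ (circlePoint g (4 * (i : ℕ) + 3)) = c + b ∧ φ (circlePoint g (4 * (i : ℕ) + 4)) = c := by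
  intro c a b
  have h1 : (1 : ℝ) ∈ Set.Icc (0 : ℝ) 1 := by simp
  have pa : a = _ := h.period_eq (i, 0)
  have pb : b = _ := h.period_eq (i, 1)
  have sa := h.side (i, 0) h1
  have sb := h.side (i, 1) h1
  simp only [corner, Fin.val_zero, Fin.val_one, Nat.cast_zero, Nat.cast_one,
    add_zero] at pa pb sa sb
  have e1 : (4 * (i : ℕ) + 1 + 1 : ℝ) = 4 * (i : ℕ) + 2 := by ring
  have e2 : (4 * (i : ℕ) + 3 - 1 : ℝ) = 4 * (i : ℕ) + 2 := by ring
  have e3 : (4 * (i : ℕ) + 1 + 3 - 1 : ℝ) = 4 * (i : ℕ) + 3 := by ring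
  have e4 : (4 * (i : ℕ) + 1 + 3 : ℝ) = 4 * (i : ℕ) + 4 := by ring
  rw [e1] at pb
  rw [e2] at sa
  rw [e1, e3, e4] at sb
  refine ⟨?_, ?_, ?_, ?_⟩ <;> grind

end PolygonModel

end Polygon

/-! ### Classes with vanishing periods -/

section Injectivity

namespace PolygonModel

variable {g : ℕ} {X : Type u} [TopologicalSpace X] {M : PolygonModel g X}
  {A : Type v} [CommRing A]

/-- If a potential on the polygon descends to a function on the surface, then this function is a
primitive of the cocycle on every open set `U` which contracts to finitely many points along
tracks that lift to the polygon. The contraction is given upstairs, by a homotopy `H` on a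
saturated open subset `W` of the disc. -/
theorem IsPotential.exact_of_contraction {α : cocycles X A 1} {φ : ℂ → A}
    (hα : M.IsPotential α φ) {Φ : X → A} (hΦ : ∀ z : ℂ, ‖z‖ ≤ 1 → Φ (M.map z) = φ z)
    (W : Set ℂ) (hW : IsOpen W)
    (hsat : ∀ (j : Fin g × Fin 2), ∀ s ∈ Set.Icc (0 : ℝ) 1,
      (circlePoint g (corner j + s) ∈ W ↔ circlePoint g (corner j + 3 - s) ∈ W))
    (H : ℂ → ℝ → ℂ) (hH : ContinuousOn (Function.uncurry H) (W ×ˢ Set.univ))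
    (hcompat : ∀ (j : Fin g × Fin 2), ∀ s ∈ Set.Icc (0 : ℝ) 1, ∀ l ∈ Set.Icc (0 : ℝ) 1,
      circlePoint g (corner j + s) ∈ W →
      M.map (H (circlePoint g (corner j + s)) l) = M.map (H (circlePoint g (corner j + 3 - s)) l))
    (h0 : ∀ z ∈ W, H z 0 = z) (S : Set ℂ) (hS : S.Finite) (hS1 : ∀ z ∈ S, ‖z‖ ≤ 1)
    (h1 : ∀ z ∈ W, H z 1 ∈ S) :
    ∃ U : Set X, IsOpen U ∧ (∀ z : ℂ, ‖z‖ ≤ 1 → (M.map z ∈ U ↔ z ∈ W)) ∧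
      ∀ γ : C(ℝ, X), (∀ t, γ t ∈ U) → α.1 (pathSimplex γ) = Φ (γ 1) - Φ (γ 0) := by
  classical
  obtain ⟨U, hU⟩ := M.exists_function_descent (fun z => z ∈ W)
    (fun j s hs => propext (hsat j s hs))
  have hU' : ∀ z : ℂ, ‖z‖ ≤ 1 → (M.map z ∈ {x | U x} ↔ z ∈ W) := fun z hz => iff_of_eq (hU z hz)
  have hUp : ∀ p : Metric.closedBall (0 : ℂ) 1, M.proj p ∈ {x | U x} ↔ (p : ℂ) ∈ W := by
    intro p
    rw [M.proj_eq_map]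
    exact hU' _ (mem_closedBall_zero_iff.1 p.2)
  have hUo : IsOpen {x | U x} := by
    rw [← M.isQuotientMap.isOpen_preimage]
    have : M.proj ⁻¹' {x | U x} = Subtype.val ⁻¹' W := Set.ext fun p => hUp p
    rw [this]
    exact hW.preimage continuous_subtype_val
  refine ⟨{x | U x}, hUo, hU', fun γ hγ => ?_⟩
  -- By compatibility with the side identifications the homotopy descends to the surface.
  have hG : ∀ l : unitInterval, ∃ G : X → X, ∀ z : ℂ, ‖z‖ ≤ 1 →
      G (M.map z) = if z ∈ W then M.map (H z l) else M.map z := by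
    intro l
    refine M.exists_function_descent _ fun j s hs => ?_
    by_cases hm : circlePoint g (corner j + s) ∈ W
    · rw [if_pos hm, if_pos ((hsat j s hs).1 hm)]
      exact hcompat j s hs l l.2 hm
    · rw [if_neg hm, if_neg fun h => hm ((hsat j s hs).2 h)]
      exact M.map_side j hs
  choose G hG using hG
  have hG' : ∀ l z, ‖z‖ ≤ 1 → z ∈ W → G l (M.map z) = M.map (H z l) := by
    intro l z hz hzW
    rw [hG l z hz, if_pos hzW]
  have hq := M.isQuotientMap.restrictPreimage_isOpen hUo
  have hGc : Continuous fun x : {x | U x} × unitInterval => G x.2 x.1 := by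
    refine hq.continuous_lift_prod_left ?_
    have : (fun p : (M.proj ⁻¹' {x | U x}) × unitInterval =>
        G p.2 (Set.restrictPreimage {x | U x} M.proj p.1)) =
        fun p => M.map (Function.uncurry H (p.1.1.1, p.2)) := by
      funext p
      have hp := mem_closedBall_zero_iff.1 p.1.1.2
      change G p.2 (M.proj p.1.1) = _
      rw [M.proj_eq_map, hG' _ _ hp ((hUp _).1 p.1.2)]
      rfl
    rw [this]
    refine M.map.continuous.comp (hH.comp_continuous (by fun_prop) fun p => ?_)
    exact ⟨(hUp _).1 p.1.2, trivial⟩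
  -- The end of the contraction is locally constant: upstairs it takes values in the discrete set
  -- `S`, and the topology downstairs is the quotient topology.
  have hlc : IsLocallyConstant fun x : {x | U x} => G 1 x := by
    intro B
    rw [← hq.isOpen_preimage]
    let r : (M.proj ⁻¹' {x | U x}) → S := fun p => ⟨H p.1.1 1, h1 _ ((hUp _).1 p.2)⟩
    have hr : Continuous r := by
      refine Continuous.subtype_mk ?_ _
      refine hH.comp_continuous (f := fun p : (M.proj ⁻¹' {x | U x}) => ((p.1.1 : ℂ), (1 : ℝ)))
        (by fun_prop) fun p => ⟨(hUp _).1 p.2, trivial⟩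
    have := hS.to_subtype
    have e : (Set.restrictPreimage {x | U x} M.proj) ⁻¹' ((fun x : {x | U x} => G 1 x) ⁻¹' B) =
        r ⁻¹' {z | M.map z ∈ B} := by
      ext p
      have hp := mem_closedBall_zero_iff.1 p.1.2
      change G 1 (M.proj p.1) ∈ B ↔ M.map (H p.1.1 1) ∈ B
      rw [M.proj_eq_map, hG' _ _ hp ((hUp _).1 p.2)]
      rfl
    rw [e]
    exact (isOpen_discrete _).preimage hr
  let K : C(ℝ × ℝ, X) := ⟨fun x => G (Set.projIcc 0 1 zero_le_one x.2) (γ x.1),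
    hGc.comp (f := fun x : ℝ × ℝ =>
      ((⟨γ x.1, hγ x.1⟩ : {x | U x}), Set.projIcc (0 : ℝ) 1 zero_le_one x.2))
      (by fun_prop)⟩
  obtain ⟨κ, hκ⟩ := exists_potential α K
  have hrep : ∀ t, ∃ z : ℂ, ‖z‖ ≤ 1 ∧ M.map z = γ t ∧ z ∈ W := by
    intro t
    obtain ⟨z, hz, hzt⟩ := M.exists_map_eq (γ t)
    exact ⟨z, hz, hzt, (hU' z hz).1 (hzt ▸ hγ t)⟩
  -- The track of a point lifts to the polygon, where the potential is known.
  have track : ∀ t, κ (t, 1) - κ (t, 0) = Φ (G 1 (γ t)) - Φ (γ t) := by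
    intro t
    obtain ⟨z, hz, hzt, hzW⟩ := hrep t
    have hc : Continuous fun l : ℝ => H z (Set.projIcc (0 : ℝ) 1 zero_le_one l) :=
      hH.comp_continuous
        (f := fun l : ℝ => (z, ((Set.projIcc (0 : ℝ) 1 zero_le_one l : unitInterval) : ℝ)))
        (continuous_const.prodMk (continuous_subtype_val.comp continuous_projIcc))
        fun p => ⟨hzW, trivial⟩
    have e1 : _ = κ (t, 1) - κ (t, 0) := hκ ⟨fun l => (t, l), by fun_prop⟩
    have e2 : _ = φ (H z (Set.projIcc (0 : ℝ) 1 zero_le_one 1)) -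
        φ (H z (Set.projIcc (0 : ℝ) 1 zero_le_one 0)) := hα ⟨_, hc⟩
    rw [Set.projIcc_left, Set.projIcc_right] at e2
    change _ = φ (H z 1) - φ (H z 0) at e2
    rw [← hzt, hG' 1 z hz hzW, hΦ z hz, ← e1]
    change _ = Φ (M.map (H z 1)) - _
    rw [hΦ _ (hS1 _ (h1 z hzW))]
    rw [h0 z hzW] at e2
    rw [← e2]
    refine congrArg (fun δ => α.1 (pathSimplex δ)) (ContinuousMap.ext fun l => ?_)
    change G _ (γ t) = M.map (H z _)
    rw [← hzt, hG' _ z hz hzW]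
    rfl
  have hconst : ∀ t, G 1 (γ t) = G 1 (γ 0) := by
    intro t
    exact (hlc.comp_continuous (f := fun t : ℝ => (⟨γ t, hγ t⟩ : {x | U x}))
      (by fun_prop)).apply_eq_of_preconnectedSpace t 0
  have hpath : ∀ l : ℝ, κ (1, l) - κ (0, l) =
      α.1 (pathSimplex (K.comp ⟨fun t => (t, l), by fun_prop⟩)) :=
    fun l => (hκ ⟨fun t => (t, l), by fun_prop⟩).symm
  have top : κ (1, 1) - κ (0, 1) = 0 := by
    rw [hpath, ← cocycle_const α (G 1 (γ 0))]
    refine congrArg (fun δ => α.1 (pathSimplex δ)) (ContinuousMap.ext fun t => ?_)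
    change G (Set.projIcc 0 1 zero_le_one 1) (γ t) = G 1 (γ 0)
    rw [Set.projIcc_right]
    exact hconst t
  have bottom : κ (1, 0) - κ (0, 0) = α.1 (pathSimplex γ) := by
    rw [hpath]
    refine congrArg (fun δ => α.1 (pathSimplex δ)) (ContinuousMap.ext fun t => ?_)
    change G (Set.projIcc 0 1 zero_le_one 0) (γ t) = γ t
    obtain ⟨z, hz, hzt, hzW⟩ := hrep t
    rw [Set.projIcc_left, ← hzt, hG' _ z hz hzW]
    exact congrArg _ (h0 z hzW)
  have t0 := track 0
  have t1 := track 1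
  rw [hconst 1] at t1
  linear_combination top - bottom + t0 - t1

/-- A cocycle which is locally the coboundary of a given function is the coboundary of that
function. -/
theorem eq_sub_of_locally (α : cocycles X A 1) (Φ : X → A)
    (h : ∀ x : X, ∃ U : Set X, IsOpen U ∧ x ∈ U ∧
      ∀ γ : C(ℝ, X), (∀ t, γ t ∈ U) → α.1 (pathSimplex γ) = Φ (γ 1) - Φ (γ 0))
    (γ : C(ℝ, X)) : α.1 (pathSimplex γ) = Φ (γ 1) - Φ (γ 0) := by
  obtain ⟨κ, hκ⟩ := exists_potential α γ
  have hlc : IsLocallyConstant fun t => κ t - Φ (γ t) := by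
    rw [IsLocallyConstant.iff_eventually_eq]
    intro t₀
    obtain ⟨U, hU, hx, hUγ⟩ := h (γ t₀)
    obtain ⟨r, hr, hball⟩ := Metric.isOpen_iff.1 (hU.preimage γ.continuous) t₀ hx
    filter_upwards [Metric.ball_mem_nhds t₀ hr] with t ht
    let δ : C(ℝ, ℝ) := ⟨fun s => t₀ + (Set.projIcc (0 : ℝ) 1 zero_le_one s : ℝ) * (t - t₀),
      by fun_prop⟩
    have h1 := hκ δ
    have h2 := hUγ (γ.comp δ) fun s => by
      refine hball ?_
      have hs := (Set.projIcc (0 : ℝ) 1 zero_le_one s).2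
      rw [Metric.mem_ball, Real.dist_eq] at ht ⊢
      refine lt_of_le_of_lt ?_ ht
      change |t₀ + _ * (t - t₀) - t₀| ≤ _
      rw [add_sub_cancel_left, abs_mul, abs_of_nonneg hs.1]
      exact mul_le_of_le_one_left (abs_nonneg _) hs.2
    have e0 : δ 0 = t₀ := by simp [δ]
    have e1 : δ 1 = t := by simp [δ]
    rw [ContinuousMap.comp_apply, ContinuousMap.comp_apply, h1, e0, e1] at h2
    linear_combination h2
  have h1 := hκ (ContinuousMap.id ℝ)
  have h2 := hlc.apply_eq_of_preconnectedSpace 1 0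
  simp only [ContinuousMap.comp_id, ContinuousMap.id_apply] at h1
  rw [h1]
  linear_combination h2

/-- The homotopy `z ↦ z exp (-l log (ε z ^ (4 g)) / (4 g))`, for `ε = ± 1`. It contracts the part
of the disc where it is continuous to the corners (`ε = 1`) or the midpoints of the sides
(`ε = -1`), and moves the points of a side within that side. -/
noncomputable def sideContraction (g : ℕ) (ε : ℂ) (z : ℂ) (l : ℝ) : ℂ :=
  z * Complex.exp (-(l * Complex.log (ε * z ^ (4 * g)) / (4 * g)))

theorem circlePoint_pow (hg : g ≠ 0) (t : ℝ) :
    circlePoint g t ^ (4 * g) = Complex.exp (2 * Real.pi * t * Complex.I) := by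
  have h : (g : ℂ) ≠ 0 := by exact_mod_cast hg
  rw [circlePoint_apply, ← Complex.exp_nat_mul]
  congr 1
  push_cast
  field_simp

theorem sideContraction_circlePoint (hg : g ≠ 0) {ε : ℂ} {c t l : ℝ}
    (hε : ε = Complex.exp (-(2 * Real.pi * c * Complex.I))) (hc : |t - c| < 1 / 2) :
    sideContraction g ε (circlePoint g t) l = circlePoint g (t - l * (t - c)) := by
  have h : (g : ℂ) ≠ 0 := by exact_mod_cast hg
  have e : ε * circlePoint g t ^ (4 * g) =
      Complex.exp ((2 * Real.pi * (t - c) : ℝ) * Complex.I) := by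
    rw [circlePoint_pow hg, hε, ← Complex.exp_add]
    push_cast
    ring_nf
  rw [abs_lt] at hc
  have hpi := Real.pi_pos
  rw [sideContraction, e, Complex.log_exp, circlePoint_apply, circlePoint_apply, ← Complex.exp_add]
  · congr 1
    push_cast
    field_simp
    ring
  · simp only [Complex.mul_im, Complex.ofReal_re, Complex.I_im, Complex.ofReal_im, Complex.I_re]
    nlinarith
  · simp only [Complex.mul_im, Complex.ofReal_re, Complex.I_im, Complex.ofReal_im, Complex.I_re]
    nlinarith

theorem exp_two_pi_nat (n : ℕ) : Complex.exp (2 * Real.pi * n * Complex.I) = 1 := by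
  rw [Complex.exp_eq_one_iff]
  exact ⟨n, by push_cast; ring⟩

theorem neg_one_not_mem_slitPlane : (-1 : ℂ) ∉ Complex.slitPlane := by
  simp [Complex.mem_slitPlane_iff]

/-- The centre of the contraction on a side: an end of the side if `ε = 1`, its midpoint if
`ε = -1`. -/
theorem exists_center (hg : g ≠ 0) {ε : ℂ} (hε : ε = 1 ∨ ε = -1) (k : ℕ) {s : ℝ}
    (hs : s ∈ Set.Icc (0 : ℝ) 1)
    (hW : ε * circlePoint g (k + s) ^ (4 * g) ∈ Complex.slitPlane) :
    ∃ d ∈ Set.Icc (0 : ℝ) 1, |s - d| < 1 / 2 ∧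
      ε = Complex.exp (2 * Real.pi * d * Complex.I) ∧
      ε = Complex.exp (-(2 * Real.pi * d * Complex.I)) := by
  have e : ∀ t : ℝ, circlePoint g (k + t) ^ (4 * g) =
      Complex.exp (2 * Real.pi * t * Complex.I) := by
    intro t
    rw [circlePoint_pow hg]
    push_cast
    rw [mul_add, add_mul, Complex.exp_add, exp_two_pi_nat, one_mul]
  have hhalf : Complex.exp (2 * Real.pi * (1 / 2 : ℝ) * Complex.I) = -1 := by
    rw [← Complex.exp_pi_mul_I]; congr 1; push_cast; ring
  have h0 : Complex.exp (2 * Real.pi * (0 : ℝ) * Complex.I) = 1 := by simp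
  have h1 : Complex.exp (2 * Real.pi * (1 : ℝ) * Complex.I) = 1 := by
    simpa only [Nat.cast_one, Complex.ofReal_one] using exp_two_pi_nat 1
  rw [e] at hW
  obtain ⟨hs0, hs1⟩ := hs
  rcases hε with rfl | rfl
  · rcases lt_trichotomy s (1 / 2) with h | h | h
    · refine ⟨0, by simp, by rw [abs_lt]; constructor <;> linarith, h0.symm, ?_⟩
      rw [Complex.exp_neg, h0, inv_one]
    · rw [h, hhalf, one_mul] at hW
      exact absurd hW neg_one_not_mem_slitPlane
    · refine ⟨1, by simp, by rw [abs_lt]; constructor <;> linarith, h1.symm, ?_⟩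
      rw [Complex.exp_neg, h1, inv_one]
  · have hs0' : s ≠ 0 := by
      rintro rfl
      rw [h0, mul_one] at hW
      exact neg_one_not_mem_slitPlane hW
    have hs1' : s ≠ 1 := by
      rintro rfl
      rw [h1, mul_one] at hW
      exact neg_one_not_mem_slitPlane hW
    have := lt_of_le_of_ne hs0 hs0'.symm
    have := lt_of_le_of_ne hs1 hs1'
    refine ⟨1 / 2, by norm_num, by rw [abs_lt]; constructor <;> linarith, hhalf.symm, ?_⟩
    rw [Complex.exp_neg, hhalf, inv_neg, inv_one]

theorem corner_eq (j : Fin g × Fin 2) : corner j = ((4 * (j.1 : ℕ) + j.2 : ℕ) : ℝ) := by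
  simp [corner]

theorem conj_circlePoint_pow (hg : g ≠ 0) (j : Fin g × Fin 2) (s : ℝ) :
    circlePoint g (corner j + 3 - s) ^ (4 * g) =
      (starRingEnd ℂ) (circlePoint g (corner j + s) ^ (4 * g)) := by
  rw [map_pow, ← circlePoint_neg, circlePoint_pow hg, circlePoint_pow hg, corner_eq]
  have e := exp_two_pi_nat (2 * (4 * (j.1 : ℕ) + j.2) + 3)
  rw [← one_mul (Complex.exp (2 * Real.pi * ((-(_ + s) : ℝ) : ℂ) * Complex.I)), ← e,
    ← Complex.exp_add]
  congr 1
  push_cast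
  ring

/-- Exactness on the part of the surface where `z ^ (4 g)` avoids the negative (`ε = 1`) or the
positive (`ε = -1`) real half-axis. The two parts cover everything except the centre. -/
theorem IsPotential.exact_near_sides (hg : g ≠ 0) {α : cocycles X A 1} {φ : ℂ → A}
    (hα : M.IsPotential α φ) {Φ : X → A} (hΦ : ∀ z : ℂ, ‖z‖ ≤ 1 → Φ (M.map z) = φ z)
    {ε : ℂ} (hε : ε = 1 ∨ ε = -1) :
    ∃ U : Set X, IsOpen U ∧
      (∀ z : ℂ, ‖z‖ ≤ 1 → (M.map z ∈ U ↔ ε * z ^ (4 * g) ∈ Complex.slitPlane)) ∧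
      ∀ γ : C(ℝ, X), (∀ t, γ t ∈ U) → α.1 (pathSimplex γ) = Φ (γ 1) - Φ (γ 0) := by
  have hgC : (g : ℂ) ≠ 0 := by exact_mod_cast hg
  have hn : 4 * g ≠ 0 := by omega
  have hε1 : ‖ε‖ = 1 := by rcases hε with rfl | rfl <;> simp
  have hεsq : ε * ε = 1 := by rcases hε with rfl | rfl <;> norm_num
  have hεconj : (starRingEnd ℂ) ε = ε := by rcases hε with rfl | rfl <;> simp
  refine hα.exact_of_contraction hΦ {z | ε * z ^ (4 * g) ∈ Complex.slitPlane}
    (Complex.isOpen_slitPlane.preimage (by fun_prop)) (fun j s hs => ?_)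
    (sideContraction g ε) ?_ ?_ ?_ {z | z ^ (4 * g) = ε} ?_ ?_ ?_
  · simp only [Set.mem_ofPred_eq]
    rw [conj_circlePoint_pow hg j s]
    nth_rewrite 2 [← hεconj]
    rw [← map_mul, Complex.mem_slitPlane_iff, Complex.mem_slitPlane_iff, Complex.conj_re,
      Complex.conj_im, neg_ne_zero]
  · intro x hx
    refine ContinuousAt.continuousWithinAt ?_
    have hx' : ε * x.1 ^ (4 * g) ∈ Complex.slitPlane := hx.1
    unfold sideContraction Function.uncurry
    have : ContinuousAt (fun x : ℂ × ℝ => Complex.log (ε * x.1 ^ (4 * g))) x :=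
      ContinuousAt.clog (by fun_prop) hx'
    fun_prop
  · intro j s hs l hl hW
    rw [corner_eq] at *
    obtain ⟨d, hd, hsd, e1, e2⟩ := exists_center hg hε _ hs hW
    have hside := M.map_side j (s := s - l * (s - d))
      ⟨by nlinarith [hs.1, hd.1, hl.1, hl.2], by nlinarith [hs.2, hd.2, hl.1, hl.2]⟩
    rw [corner_eq] at hside
    have hk : ∀ n : ℕ, Complex.exp (-(2 * Real.pi * n * Complex.I)) = 1 := fun n => by
      rw [Complex.exp_neg, exp_two_pi_nat, inv_one]
    have c1 := sideContraction_circlePoint (c := (4 * (j.1 : ℕ) + j.2 : ℕ) + d)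
      (t := (4 * (j.1 : ℕ) + j.2 : ℕ) + s) (l := l) hg (e2.trans (by
        rw [← one_mul (Complex.exp (-(2 * Real.pi * (d : ℂ) * Complex.I))),
          ← hk (4 * (j.1 : ℕ) + j.2), ← Complex.exp_add]
        congr 1
        push_cast
        ring)) (by rwa [add_sub_add_left_eq_sub])
    have c2 := sideContraction_circlePoint (c := (4 * (j.1 : ℕ) + j.2 : ℕ) + 3 - d)
      (t := (4 * (j.1 : ℕ) + j.2 : ℕ) + 3 - s) (l := l) hg (e1.trans (by
        rw [← one_mul (Complex.exp (2 * Real.pi * (d : ℂ) * Complex.I)),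
          ← hk (4 * (j.1 : ℕ) + j.2 + 3), ← Complex.exp_add]
        congr 1
        push_cast
        ring)) (by rwa [sub_sub_sub_cancel_left, abs_sub_comm])
    rw [c1, c2]
    convert hside using 3 <;> ring
  · intro z _
    simp [sideContraction]
  · refine ((Polynomial.nthRoots (4 * g) ε).toFinset.finite_toSet).subset fun z hz => ?_
    simpa [Polynomial.mem_nthRoots (Nat.pos_of_ne_zero hn)] using hz
  · intro z hz
    have : ‖z‖ ^ (4 * g) = 1 := by rw [← norm_pow, show z ^ (4 * g) = ε from hz, hε1]
    exact ((pow_eq_one_iff_of_nonneg (norm_nonneg z) hn).1 this).le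
  · intro z hz
    have hne : ε * z ^ (4 * g) ≠ 0 := Complex.slitPlane_ne_zero hz
    change sideContraction g ε z 1 ^ (4 * g) = ε
    rw [sideContraction, mul_pow, ← Complex.exp_nat_mul]
    have : ((4 * g : ℕ) : ℂ) * -(((1 : ℝ) : ℂ) * Complex.log (ε * z ^ (4 * g)) / (4 * g)) =
        -Complex.log (ε * z ^ (4 * g)) := by
      push_cast
      field_simp
    rw [this, Complex.exp_neg, Complex.exp_log hne]
    have hz0 : z ^ (4 * g) ≠ 0 := right_ne_zero_of_mul hne
    have hε0 : ε ≠ 0 := left_ne_zero_of_mul hne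
    field_simp
    rw [sq, hεsq]

theorem IsPotential.exact_in_interior {α : cocycles X A 1} {φ : ℂ → A}
    (hα : M.IsPotential α φ) {Φ : X → A} (hΦ : ∀ z : ℂ, ‖z‖ ≤ 1 → Φ (M.map z) = φ z) :
    ∃ U : Set X, IsOpen U ∧ (∀ z : ℂ, ‖z‖ ≤ 1 → (M.map z ∈ U ↔ ‖z‖ < 1)) ∧
      ∀ γ : C(ℝ, X), (∀ t, γ t ∈ U) → α.1 (pathSimplex γ) = Φ (γ 1) - Φ (γ 0) := by
  refine hα.exact_of_contraction hΦ {z | ‖z‖ < 1} (isOpen_lt continuous_norm continuous_const)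
    (fun j s hs => ?_) (fun z l => (1 - l) • z) ?_ ?_ ?_ {0} (Set.finite_singleton _) ?_ ?_
  · simp [norm_circlePoint]
  · unfold Function.uncurry
    fun_prop
  · intro j s hs l hl h
    simp [norm_circlePoint] at h
  · simp
  · simp
  · simp

/-- A class of degree one is determined by its periods: if these vanish, then a potential on the
polygon descends to a function on the surface, and it is a primitive locally, hence globally. -/
theorem period_injective (hg : g ≠ 0) (M : PolygonModel g X) :
    Function.Injective (M.period A) := by
  rw [injective_iff_map_eq_zero]
  intro u hu
  obtain ⟨α, rfl⟩ := Cohomology.mk_surjective X A 1 u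
  obtain ⟨φ, hφ⟩ := M.exists_isPotential α
  obtain ⟨Φ, hΦ⟩ := M.exists_function_descent φ (by
    intro j s hs
    have h := hφ.side j hs
    obtain ⟨i, e⟩ := j
    obtain ⟨h1, -, h3, h4⟩ := hφ.corner_values i
    simp only [hu, Pi.zero_apply, add_zero] at h1 h3 h4
    fin_cases e
    · simp only [corner, Nat.cast_zero, add_zero] at h ⊢
      rw [h3] at h
      exact sub_left_injective h
    · simp only [corner, Nat.cast_one] at h ⊢
      rw [show (4 * (i : ℕ) + 1 + 3 : ℝ) = 4 * (i : ℕ) + 4 by ring, h4, h1] at h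
      rw [show (4 * (i : ℕ) + 1 + 3 - s : ℝ) = 4 * (i : ℕ) + 4 - s by ring] at *
      exact sub_left_injective h)
  refine mk_eq_zero_of_potential α Φ (eq_sub_of_locally α Φ fun x => ?_)
  obtain ⟨z, hz, rfl⟩ := M.exists_map_eq x
  by_cases h0 : z = 0
  · obtain ⟨U, hU, hUz, h⟩ := hφ.exact_in_interior hΦ
    exact ⟨U, hU, (hUz z hz).2 (by simp [h0]), h⟩
  by_cases hw : 1 * z ^ (4 * g) ∈ Complex.slitPlane
  · obtain ⟨U, hU, hUz, h⟩ := hφ.exact_near_sides hg hΦ (Or.inl rfl)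
    exact ⟨U, hU, (hUz z hz).2 hw, h⟩
  · obtain ⟨U, hU, hUz, h⟩ := hφ.exact_near_sides hg hΦ (Or.inr rfl)
    refine ⟨U, hU, (hUz z hz).2 ?_, h⟩
    have hne : z ^ (4 * g) ≠ 0 := pow_ne_zero _ h0
    rw [one_mul, Complex.mem_slitPlane_iff, not_or, not_not, not_lt] at hw
    rw [Complex.mem_slitPlane_iff, neg_one_mul, Complex.neg_re]
    left
    rw [neg_pos]
    refine lt_of_le_of_ne hw.1 fun h => hne (Complex.ext h hw.2)

end PolygonModel

end Injectivity

/-! ### The class of a map to the circle -/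

section CircleClass

instance {n : ℕ} : LocallyPathConnectedSpace (stdSimplex ℝ (Fin (n + 1))) :=
  (convex_stdSimplex ℝ _).locallyPathConnectedSpace

instance {n : ℕ} : ContractibleSpace (stdSimplex ℝ (Fin (n + 1))) :=
  (convex_stdSimplex ℝ _).contractibleSpace ⟨_, single_mem_stdSimplex ℝ 0⟩

theorem exists_circle_lift {n : ℕ} (f : C(stdSimplex ℝ (Fin (n + 1)), AddCircle (1 : ℝ))) :
    ∃ F : C(stdSimplex ℝ (Fin (n + 1)), ℝ), ∀ v, (F v : AddCircle (1 : ℝ)) = f v := by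
  obtain ⟨r, hr⟩ := QuotientAddGroup.mk_surjective (f (stdSimplex.vertex 0))
  obtain ⟨F, ⟨-, hF⟩, -⟩ := (AddCircle.isCoveringMap_coe (1 : ℝ)).existsUnique_continuousMap_lifts
    f (stdSimplex.vertex 0) r hr
  exact ⟨F, congrFun hF⟩

/-- Two real lifts of a map to the circle differ by an integer, so the differences of their integral
parts agree. -/
theorem circle_lift_unique {n : ℕ} {F G : C(stdSimplex ℝ (Fin (n + 1)), ℝ)}
    (h : ∀ v, (F v : AddCircle (1 : ℝ)) = G v) (v w : stdSimplex ℝ (Fin (n + 1))) :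
    ⌊F v⌋ - ⌊F w⌋ = ⌊G v⌋ - ⌊G w⌋ := by
  have cov := AddCircle.isCoveringMap_coe (1 : ℝ)
  obtain ⟨m, hm⟩ := (AddCircle.coe_eq_zero_iff (1 : ℝ) (x := F w - G w)).1 (by
    rw [AddCircle.coe_sub, h, sub_self])
  rw [zsmul_one] at hm
  have e := cov.eq_of_comp_eq F.continuous (G.continuous.add continuous_const)
    (funext fun x => by
      have hm0 : ((m : ℝ) : AddCircle (1 : ℝ)) = 0 :=
        (AddCircle.coe_eq_zero_iff (1 : ℝ)).2 ⟨m, zsmul_one m⟩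
      change (F x : AddCircle (1 : ℝ)) = ((G x + m : ℝ) : AddCircle (1 : ℝ))
      rw [AddCircle.coe_add, hm0, add_zero, h]) w
    (show F w = G w + (m : ℝ) by linarith)
  have e' : ∀ x, F x = G x + m := congrFun e
  rw [e', e', Int.floor_add_intCast, Int.floor_add_intCast]
  ring

variable {X : Type u} [TopologicalSpace X] {A : Type v} [CommRing A]

/-- The integral cocycle representing the class of a map `f` to the circle: on a path it is the
difference of the integral parts of a real lift of `f` at the ends. -/
theorem exists_circle_cocycle (A : Type v) [CommRing A] (f : C(X, AddCircle (1 : ℝ))) :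
    ∃ α : cocycles X A 1, ∀ (σ : SingularSimplex 1 X) (F : C(stdSimplex ℝ (Fin 2), ℝ)),
      (∀ v, (F v : AddCircle (1 : ℝ)) = f (σ v)) →
      α.1 σ = ((⌊F (stdSimplex.vertex 1)⌋ - ⌊F (stdSimplex.vertex 0)⌋ : ℤ) : A) := by
  choose L hL using fun σ : SingularSimplex 1 X => exists_circle_lift (f.comp σ)
  let c : SingularSimplex 1 X → A := fun σ =>
    ((⌊L σ (stdSimplex.vertex 1)⌋ - ⌊L σ (stdSimplex.vertex 0)⌋ : ℤ) : A)
  have hc : ∀ (σ : SingularSimplex 1 X) (F : C(stdSimplex ℝ (Fin 2), ℝ)),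
      (∀ v, (F v : AddCircle (1 : ℝ)) = f (σ v)) →
      c σ = ((⌊F (stdSimplex.vertex 1)⌋ - ⌊F (stdSimplex.vertex 0)⌋ : ℤ) : A) := by
    intro σ F hF
    exact congrArg _ (circle_lift_unique (fun v => (hL σ v).trans (hF v).symm) _ _)
  refine ⟨⟨c, ?_⟩, hc⟩
  change coboundary X A 1 c = 0
  funext σ
  obtain ⟨F, hF⟩ := exists_circle_lift (f.comp σ)
  have hface : ∀ i : Fin 3, c (face i σ) = ((⌊F (stdSimplex.vertex (i.succAbove 1))⌋ -
      ⌊F (stdSimplex.vertex (i.succAbove 0))⌋ : ℤ) : A) := by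
    intro i
    rw [hc (face i σ) (F.comp (simplexMap i.succAbove)) fun v => hF _]
    have hv : ∀ k : Fin 2, simplexMap i.succAbove (stdSimplex.vertex k) =
        stdSimplex.vertex (i.succAbove k) := fun k => stdSimplex.map_vertex _ _
    rw [ContinuousMap.comp_apply, ContinuousMap.comp_apply, hv, hv]
  rw [coboundary_one_apply, hface, hface, hface, Pi.zero_apply]
  have e1 : (0 : Fin 3).succAbove (1 : Fin 2) = 2 := rfl
  have e2 : (0 : Fin 3).succAbove (0 : Fin 2) = 1 := rfl
  have e3 : (1 : Fin 3).succAbove (1 : Fin 2) = 2 := rfl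
  have e4 : (1 : Fin 3).succAbove (0 : Fin 2) = 0 := rfl
  have e5 : (2 : Fin 3).succAbove (1 : Fin 2) = 1 := rfl
  have e6 : (2 : Fin 3).succAbove (0 : Fin 2) = 0 := rfl
  rw [e1, e2, e3, e4, e5, e6]
  push_cast
  ring

end CircleClass

/-! ### Strips joining identified sides -/

section Strip

variable {g : ℕ}

/-- The centre `corner j + 3 / 2` of the arc which starts at the side number `corner j` and ends
with the side identified with it. -/
noncomputable def stripCenter (j : Fin g × Fin 2) : ℝ := corner j + 3 / 2

/-- The coordinate transverse to the chords orthogonal to the direction of `stripCenter j`,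
normalised so that the chord from `corner j + s` to `corner j + 3 - s` has coordinate `s`. -/
noncomputable def stripCoord (j : Fin g × Fin 2) : C(ℂ, ℝ) :=
  ⟨fun z => 3 / 2 - 2 * g / Real.pi * Real.arccos (z * circlePoint g (-stripCenter j)).re,
    continuous_const.sub (continuous_const.mul (Real.continuous_arccos.comp
      (Complex.continuous_re.comp (continuous_id.mul continuous_const))))⟩

theorem re_circlePoint (t : ℝ) : (circlePoint g t).re = Real.cos (Real.pi * t / (2 * g)) := by
  rw [circlePoint_apply, Complex.exp_ofReal_mul_I_re]
  congr 1
  ring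

theorem im_circlePoint (t : ℝ) : (circlePoint g t).im = Real.sin (Real.pi * t / (2 * g)) := by
  rw [circlePoint_apply, Complex.exp_ofReal_mul_I_im]
  congr 1
  ring

theorem stripCoord_circlePoint (hg : g ≠ 0) (j : Fin g × Fin 2) {t : ℝ}
    (ht : |t - stripCenter j| ≤ 2 * g) :
    stripCoord j (circlePoint g t) = 3 / 2 - |t - stripCenter j| := by
  have h : (0 : ℝ) < g := by exact_mod_cast Nat.pos_of_ne_zero hg
  have hpi := Real.pi_pos
  change 3 / 2 - 2 * g / Real.pi *
    Real.arccos (circlePoint g t * circlePoint g (-stripCenter j)).re = _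
  rw [← circlePoint_add, ← sub_eq_add_neg, re_circlePoint, ← Real.cos_abs, Real.arccos_cos]
  · rw [abs_div, abs_mul, abs_of_pos hpi, abs_of_pos (by positivity : (0 : ℝ) < 2 * g)]
    field_simp
  · positivity
  · rw [abs_div, abs_mul, abs_of_pos hpi, abs_of_pos (by positivity : (0 : ℝ) < 2 * g),
      div_le_iff₀ (by positivity)]
    gcongr

theorem stripCoord_nonpos (hg : g ≠ 0) (j : Fin g × Fin 2) {t : ℝ}
    (h1 : 3 / 2 ≤ |t - stripCenter j|) (h2 : |t - stripCenter j| ≤ 4 * g - 3 / 2) :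
    stripCoord j (circlePoint g t) ≤ 0 := by
  by_cases h : |t - stripCenter j| ≤ 2 * g
  · rw [stripCoord_circlePoint hg j h]
    linarith
  · rw [not_le] at h
    have hg0 : (0 : ℝ) ≤ g := Nat.cast_nonneg g
    rcases abs_cases (t - stripCenter j) with ⟨e, -⟩ | ⟨e, -⟩
    · have e' : |t - 4 * g - stripCenter j| = 4 * g - |t - stripCenter j| := by
        rw [e, abs_of_nonpos (by linarith)]
        ring
      rw [show t = (t - 4 * g) + 4 * g by ring, circlePoint_period hg,
        stripCoord_circlePoint hg j (by linarith)]
      linarith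
    · have e' : |t + 4 * g - stripCenter j| = 4 * g - |t - stripCenter j| := by
        rw [e, abs_of_nonneg (by linarith)]
        ring
      rw [← circlePoint_period hg t, stripCoord_circlePoint hg j (by linarith)]
      linarith

theorem one_le_stripCoord (hg : g ≠ 0) (j : Fin g × Fin 2) {t : ℝ}
    (h : |t - stripCenter j| ≤ 1 / 2) : 1 ≤ stripCoord j (circlePoint g t) := by
  have h1 : (1 : ℝ) ≤ g := by exact_mod_cast Nat.one_le_iff_ne_zero.2 hg
  rw [stripCoord_circlePoint hg j (by linarith)]
  linarith

theorem stripCoord_side (hg : g ≠ 0) (j : Fin g × Fin 2) {s : ℝ} (hs : s ∈ Set.Icc (0 : ℝ) 1) :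
    stripCoord j (circlePoint g (corner j + s)) = s := by
  have h1 : (1 : ℝ) ≤ g := by exact_mod_cast Nat.one_le_iff_ne_zero.2 hg
  have e : |corner j + s - stripCenter j| = 3 / 2 - s := by
    rw [stripCenter, abs_of_nonpos (by linarith [hs.2])]
    ring
  rw [stripCoord_circlePoint hg j (by linarith [hs.1]), e]
  ring

theorem stripCoord_opposite_side (hg : g ≠ 0) (j : Fin g × Fin 2) {s : ℝ}
    (hs : s ∈ Set.Icc (0 : ℝ) 1) :
    stripCoord j (circlePoint g (corner j + 3 - s)) = s := by
  have h1 : (1 : ℝ) ≤ g := by exact_mod_cast Nat.one_le_iff_ne_zero.2 hg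
  have e : |corner j + 3 - s - stripCenter j| = 3 / 2 - s := by
    rw [stripCenter, abs_of_nonneg (by linarith [hs.2])]
    ring
  rw [stripCoord_circlePoint hg j (by linarith [hs.1]), e]
  ring

/-- The sides other than the two joined by the strip lie on one side of the strip. -/
theorem stripCoord_other_side (hg : g ≠ 0) {j k : Fin g × Fin 2} (hjk : k ≠ j) :
    ((∀ s ∈ Set.Icc (0 : ℝ) 1, stripCoord j (circlePoint g (corner k + s)) ≤ 0) ∨
      (∀ s ∈ Set.Icc (0 : ℝ) 1, 1 ≤ stripCoord j (circlePoint g (corner k + s)))) ∧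
    ((∀ s ∈ Set.Icc (0 : ℝ) 1, stripCoord j (circlePoint g (corner k + 3 - s)) ≤ 0) ∨
      (∀ s ∈ Set.Icc (0 : ℝ) 1, 1 ≤ stripCoord j (circlePoint g (corner k + 3 - s)))) := by
  have hg1 : (1 : ℝ) ≤ g := by exact_mod_cast Nat.one_le_iff_ne_zero.2 hg
  obtain ⟨i, e⟩ := j
  obtain ⟨i', e'⟩ := k
  have far : ∀ t : ℝ, (4 * (i : ℕ) + (e : ℕ) + 3 ≤ t ∨ t ≤ 4 * (i : ℕ) + (e : ℕ)) → 0 ≤ t →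
      t ≤ 4 * g → stripCoord (i, e) (circlePoint g t) ≤ 0 := by
    intro t h h0 h1
    have hi0 : (0 : ℝ) ≤ (i : ℕ) := Nat.cast_nonneg _
    have hi1 : ((i : ℕ) : ℝ) + 1 ≤ g := by exact_mod_cast i.2
    have he0 : (0 : ℝ) ≤ (e : ℕ) := Nat.cast_nonneg _
    have he1 : ((e : ℕ) : ℝ) ≤ 1 := by exact_mod_cast Nat.le_of_lt_succ e.2
    apply stripCoord_nonpos hg <;> simp only [stripCenter, corner]
    · rcases h with h | h
      · rw [abs_of_nonneg] <;> linarith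
      · rw [abs_of_nonpos] <;> linarith
    · rw [abs_le]
      constructor <;> linarith
  have near : ∀ t : ℝ, 4 * (i : ℕ) + (e : ℕ) + 1 ≤ t → t ≤ 4 * (i : ℕ) + (e : ℕ) + 2 →
      1 ≤ stripCoord (i, e) (circlePoint g t) := by
    intro t h0 h1
    apply one_le_stripCoord hg
    simp only [stripCenter, corner]
    rw [abs_le]
    constructor <;> linarith
  have hi0 : (0 : ℝ) ≤ (i' : ℕ) := Nat.cast_nonneg _
  have hi1 : ((i' : ℕ) : ℝ) + 1 ≤ g := by exact_mod_cast i'.2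
  have he0 : (0 : ℝ) ≤ (e' : ℕ) := Nat.cast_nonneg _
  have he1 : ((e' : ℕ) : ℝ) ≤ 1 := by exact_mod_cast Nat.le_of_lt_succ e'.2
  have hf0 : (0 : ℝ) ≤ (e : ℕ) := Nat.cast_nonneg _
  have hf1 : ((e : ℕ) : ℝ) ≤ 1 := by exact_mod_cast Nat.le_of_lt_succ e.2
  by_cases hi : i' = i
  · subst hi
    fin_cases e <;> fin_cases e' <;> simp only [corner, Fin.zero_eta, Fin.mk_one,
      Nat.cast_zero, Nat.cast_one, add_zero] at *
    · exact absurd rfl hjk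
    · refine ⟨Or.inr fun s hs => near _ ?_ ?_, Or.inl fun s hs => far _ (Or.inl ?_) ?_ ?_⟩ <;>
        linarith [hs.1, hs.2]
    · refine ⟨Or.inl fun s hs => far _ (Or.inr ?_) ?_ ?_, Or.inr fun s hs => near _ ?_ ?_⟩ <;>
        linarith [hs.1, hs.2]
    · exact absurd rfl hjk
  · simp only [corner]
    have h : ((i : ℕ) : ℝ) + 1 ≤ (i' : ℕ) ∨ ((i' : ℕ) : ℝ) + 1 ≤ (i : ℕ) := by
      have : (i' : ℕ) ≠ i := fun h => hi (Fin.ext h)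
      rcases lt_or_gt_of_ne this with h | h
      · exact Or.inr (by exact_mod_cast h)
      · exact Or.inl (by exact_mod_cast h)
    rcases h with h | h
    · refine ⟨Or.inl fun s hs => far _ (Or.inl ?_) ?_ ?_,
        Or.inl fun s hs => far _ (Or.inl ?_) ?_ ?_⟩ <;> linarith [hs.1, hs.2]
    · refine ⟨Or.inl fun s hs => far _ (Or.inr ?_) ?_ ?_,
        Or.inl fun s hs => far _ (Or.inr ?_) ?_ ?_⟩ <;> linarith [hs.1, hs.2]

/-- The coordinate across the strip, cut off to the unit interval. Its values at identified points
agree modulo `1`. -/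
noncomputable def stripRamp (j : Fin g × Fin 2) : C(ℂ, ℝ) :=
  ⟨fun z => max 0 (min 1 (stripCoord j z)), by fun_prop⟩

theorem stripRamp_of_nonpos {j : Fin g × Fin 2} {z : ℂ} (h : stripCoord j z ≤ 0) :
    stripRamp j z = 0 :=
  max_eq_left ((min_le_right _ _).trans h)

theorem stripRamp_of_one_le {j : Fin g × Fin 2} {z : ℂ} (h : 1 ≤ stripCoord j z) :
    stripRamp j z = 1 := by
  change max 0 (min 1 (stripCoord j z)) = 1
  rw [min_eq_left h, max_eq_right zero_le_one]

theorem stripRamp_of_mem {j : Fin g × Fin 2} {z : ℂ} (h : stripCoord j z ∈ Set.Icc (0 : ℝ) 1) :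
    stripRamp j z = stripCoord j z := by
  change max 0 (min 1 (stripCoord j z)) = _
  rw [min_eq_right h.2, max_eq_right h.1]

namespace PolygonModel

variable {X : Type u} [TopologicalSpace X]

/-- Crossing a strip once winds once around the circle. -/
theorem exists_stripMap (hg : g ≠ 0) (M : PolygonModel g X) (j : Fin g × Fin 2) :
    ∃ f : C(X, AddCircle (1 : ℝ)), ∀ z : ℂ, ‖z‖ ≤ 1 → f (M.map z) = (stripRamp j z : ℝ) := by
  refine M.exists_descent ⟨fun z => (stripRamp j z : AddCircle (1 : ℝ)), by
    exact (AddCircle.continuous_mk' 1).comp (stripRamp j).continuous⟩ fun k s hs => ?_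
  change ((stripRamp j _ : ℝ) : AddCircle (1 : ℝ)) = ((stripRamp j _ : ℝ) : AddCircle (1 : ℝ))
  by_cases hk : k = j
  · subst hk
    have e1 := stripCoord_side hg k hs
    have e2 := stripCoord_opposite_side hg k hs
    rw [stripRamp_of_mem (by rwa [e1]), stripRamp_of_mem (by rwa [e2]), e1, e2]
  · have hp : ((1 : ℝ) : AddCircle (1 : ℝ)) = 0 := AddCircle.coe_period 1
    have key : ∀ z, (stripCoord j z ≤ 0 ∨ 1 ≤ stripCoord j z) →
        ((stripRamp j z : ℝ) : AddCircle (1 : ℝ)) = 0 := by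
      rintro z (h | h)
      · rw [stripRamp_of_nonpos h, AddCircle.coe_zero]
      · rw [stripRamp_of_one_le h, hp]
    obtain ⟨h1, h2⟩ := stripCoord_other_side hg hk
    rw [key _ (h1.imp (fun h => h s hs) fun h => h s hs),
      key _ (h2.imp (fun h => h s hs) fun h => h s hs)]

/-- The class of the map to the circle given by a strip has period `1` along the side where the
strip begins and period `0` along the others. -/
theorem exists_period_eq_single (hg : g ≠ 0) (M : PolygonModel g X) (A : Type v) [CommRing A]
    (j : Fin g × Fin 2) : ∃ u : Cohomology X A 1, M.period A u = Pi.single j 1 := by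
  obtain ⟨f, hf⟩ := M.exists_stripMap hg j
  obtain ⟨α, hα⟩ := exists_circle_cocycle A f
  refine ⟨Cohomology.mk X A 1 α, funext fun k => ?_⟩
  rw [period_mk, hα _ ⟨fun v => stripRamp j (circlePoint g (corner k + v.1 1)), by
    exact (stripRamp j).continuous.comp ((circlePoint g).continuous.comp (continuous_const.add
      ((continuous_apply 1).comp continuous_subtype_val)))⟩
    fun v => (hf _ (norm_circlePoint _).le).symm]
  have e1 : (Pi.single (1 : Fin 2) (1 : ℝ) : Fin 2 → ℝ) 1 = 1 := by simp
  have e0 : (Pi.single (0 : Fin 2) (1 : ℝ) : Fin 2 → ℝ) 1 = 0 := by simp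
  change ((⌊stripRamp j (circlePoint g
      (corner k + (Pi.single (1 : Fin 2) (1 : ℝ) : Fin 2 → ℝ) 1))⌋ -
    ⌊stripRamp j (circlePoint g
      (corner k + (Pi.single (0 : Fin 2) (1 : ℝ) : Fin 2 → ℝ) 1))⌋ : ℤ) : A) = _
  rw [e0, e1]
  have h0 : (0 : ℝ) ∈ Set.Icc (0 : ℝ) 1 := by simp
  have h1 : (1 : ℝ) ∈ Set.Icc (0 : ℝ) 1 := by simp
  by_cases hk : k = j
  · subst hk
    have s0 := stripCoord_side hg k h0
    have s1 := stripCoord_side hg k h1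
    rw [stripRamp_of_mem (by rwa [s1]), stripRamp_of_mem (by rwa [s0]), s1, s0]
    simp
  · rw [Pi.single_eq_of_ne hk]
    rcases (stripCoord_other_side hg hk).1 with h | h
    · rw [stripRamp_of_nonpos (h 0 h0), stripRamp_of_nonpos (h 1 h1)]
      simp
    · rw [stripRamp_of_one_le (h 0 h0), stripRamp_of_one_le (h 1 h1)]
      simp

theorem period_surjective (hg : g ≠ 0) (M : PolygonModel g X) (A : Type v) [CommRing A] :
    Function.Surjective (M.period A) := by
  intro p
  choose u hu using M.exists_period_eq_single hg A
  refine ⟨∑ j, p j • u j, ?_⟩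
  simp only [map_sum, map_smul, hu]
  exact (pi_eq_sum_univ' p).symm

/-- The first cohomology of the surface in terms of periods. -/
noncomputable def periodEquiv (hg : g ≠ 0) (M : PolygonModel g X) (A : Type v) [CommRing A] :
    Cohomology X A 1 ≃ₗ[A] (Fin g × Fin 2 → A) :=
  LinearEquiv.ofBijective (M.period A) ⟨period_injective hg M, M.period_surjective hg A⟩

end PolygonModel

end Strip

/-! ### The fundamental cycle and the intersection pairing -/

section ConeChain

variable {X : Type u} [TopologicalSpace X]

/-- The square swept out by a path in the plane under linear contraction to the origin. -/
noncomputable def coneSquare (F : C(ℂ, X)) (γ : C(ℝ, ℂ)) : C(ℝ × ℝ, X) :=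
  F.comp ⟨fun x => (1 - x.2) • γ x.1, by fun_prop⟩

/-- The singular `2`-chain consisting of the two triangles of `coneSquare`. -/
noncomputable def coneChain (F : C(ℂ, X)) (γ : C(ℝ, ℂ)) : SingularSimplex 2 X →₀ ℤ :=
  Finsupp.single ((coneSquare F γ).comp (affineSimplex ![(0, 0), (1, 0), (1, 1)])) 1 -
    Finsupp.single ((coneSquare F γ).comp (affineSimplex ![(0, 0), (0, 1), (1, 1)])) 1

theorem faces_affine_triangle {E : Type w} [AddCommGroup E] [TopologicalSpace E]
    [IsTopologicalAddGroup E] [Module ℝ E] [ContinuousSMul ℝ E] (F : C(E, X)) (p q r : E) :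
    face 0 (F.comp (affineSimplex ![p, q, r]) : SingularSimplex 2 X) =
        pathSimplex (F.comp (segmentPath q r)) ∧
      face 1 (F.comp (affineSimplex ![p, q, r]) : SingularSimplex 2 X) =
        pathSimplex (F.comp (segmentPath p r)) ∧
      face 2 (F.comp (affineSimplex ![p, q, r]) : SingularSimplex 2 X) =
        pathSimplex (F.comp (segmentPath p q)) := by
  simp only [face_comp_affineSimplex, pathSimplex_segmentPath]
  refine ⟨?_, ?_, ?_⟩ <;> congr 2 <;> (funext i; fin_cases i <;> rfl)

theorem coneSquare_edges (F : C(ℂ, X)) (γ : C(ℝ, ℂ)) :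
    (coneSquare F γ).comp (segmentPath (0, 0) (1, 0)) = F.comp γ ∧
      (coneSquare F γ).comp (segmentPath (1, 0) (1, 1)) = F.comp (segmentPath (γ 1) 0) ∧
      (coneSquare F γ).comp (segmentPath (0, 0) (0, 1)) = F.comp (segmentPath (γ 0) 0) ∧
      (coneSquare F γ).comp (segmentPath (0, 1) (1, 1)) = ContinuousMap.const ℝ (F 0) := by
  refine ⟨?_, ?_, ?_, ?_⟩ <;> ext t <;> simp [coneSquare, segmentPath]

theorem boundary_one_single (σ : SingularSimplex 2 X) :
    boundary X 1 (Finsupp.single σ 1) = Finsupp.single (face 0 σ) 1 - Finsupp.single (face 1 σ) 1 +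
      Finsupp.single (face 2 σ) 1 := by
  simp only [boundary, LinearMap.toAddMonoidHom_coe, Finsupp.linearCombination_single, one_smul]
  rw [Fin.sum_univ_three]
  simp only [Fin.val_zero, Fin.val_one, Fin.val_two, pow_zero, pow_one, neg_one_sq,
    Finsupp.single_neg]
  abel

theorem boundary_coneChain (F : C(ℂ, X)) (γ : C(ℝ, ℂ)) :
    boundary X 1 (coneChain F γ) = Finsupp.single (pathSimplex (F.comp γ)) 1 +
      Finsupp.single (pathSimplex (F.comp (segmentPath (γ 1) 0))) 1 -
      Finsupp.single (pathSimplex (F.comp (segmentPath (γ 0) 0))) 1 -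
      Finsupp.single (pathSimplex (ContinuousMap.const ℝ (F 0))) 1 := by
  obtain ⟨a0, a1, a2⟩ := faces_affine_triangle (coneSquare F γ) (0, 0) (1, 0) (1, 1)
  obtain ⟨b0, b1, b2⟩ := faces_affine_triangle (coneSquare F γ) (0, 0) (0, 1) (1, 1)
  obtain ⟨e1, e2, e3, e4⟩ := coneSquare_edges F γ
  rw [coneChain, map_sub, boundary_one_single, boundary_one_single, a0, a1, a2, b0, b1, b2, e1, e2,
    e3, e4]
  abel

theorem evalChain_coneChain {A : Type v} [CommRing A] (F : C(ℂ, X)) (γ : C(ℝ, ℂ))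
    (α β : cocycles X A 1) :
    evalChain (cupCochain α.1 β.1) (coneChain F γ) =
      α.1 (pathSimplex (F.comp γ)) * β.1 (pathSimplex (F.comp (segmentPath (γ 1) 0))) := by
  obtain ⟨a0, a1, a2⟩ := faces_affine_triangle (coneSquare F γ) (0, 0) (1, 0) (1, 1)
  obtain ⟨b0, b1, b2⟩ := faces_affine_triangle (coneSquare F γ) (0, 0) (0, 1) (1, 1)
  obtain ⟨e1, e2, e3, e4⟩ := coneSquare_edges F γ
  rw [coneChain, map_sub]
  simp only [evalChain, LinearMap.toAddMonoidHom_coe, Finsupp.linearCombination_single, one_smul,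
    cupCochain, LinearMap.mk₂_apply]
  rw [a0, a2, b0, b2, e1, e2, e3, e4, cocycle_const, mul_zero, sub_zero]

end ConeChain

/-- The standard symplectic form on the space of period vectors. -/
def symplecticForm {g : ℕ} {A : Type v} [CommRing A] (p q : Fin g × Fin 2 → A) : A :=
  ∑ i, (p (i, 0) * q (i, 1) - p (i, 1) * q (i, 0))

namespace PolygonModel

variable {g : ℕ} {X : Type u} [TopologicalSpace X] (M : PolygonModel g X)

/-- The polygon as a singular `2`-chain: the sum of the cones over its sides. The sides `a_i⁻¹`
and `b_i⁻¹` are traversed backwards, so that they become the same singular simplices of the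
quotient as `a_i` and `b_i`. -/
noncomputable def polygonChain : SingularSimplex 2 X →₀ ℤ :=
  ∑ i : Fin g,
    (coneChain M.map ⟨fun t => circlePoint g (4 * (i : ℕ) + t), by fun_prop⟩ +
      coneChain M.map ⟨fun t => circlePoint g (4 * (i : ℕ) + 1 + t), by fun_prop⟩ -
      coneChain M.map ⟨fun t => circlePoint g (4 * (i : ℕ) + 3 - t), by fun_prop⟩ -
      coneChain M.map ⟨fun t => circlePoint g (4 * (i : ℕ) + 4 - t), by fun_prop⟩)

theorem side_paths (i : Fin g) :
    pathSimplex (M.map.comp ⟨fun t => circlePoint g (4 * (i : ℕ) + t), by fun_prop⟩) =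
        pathSimplex (M.sidePath (i, 0)) ∧
      pathSimplex (M.map.comp ⟨fun t => circlePoint g (4 * (i : ℕ) + 1 + t), by fun_prop⟩) =
        pathSimplex (M.sidePath (i, 1)) ∧
      pathSimplex (M.map.comp ⟨fun t => circlePoint g (4 * (i : ℕ) + 3 - t), by fun_prop⟩) =
        pathSimplex (M.sidePath (i, 0)) ∧
      pathSimplex (M.map.comp ⟨fun t => circlePoint g (4 * (i : ℕ) + 4 - t), by fun_prop⟩) =
        pathSimplex (M.sidePath (i, 1)) := by
  have ca : corner (i, 0) = 4 * ((i : ℕ) : ℝ) := by simp [corner]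
  have cb : corner (i, 1) = 4 * ((i : ℕ) : ℝ) + 1 := by simp [corner]
  refine ⟨?_, ?_, ?_, ?_⟩ <;> refine pathSimplex_congr fun t ht => ?_
  · change M.map (circlePoint g _) = M.map (circlePoint g _)
    rw [ca]
  · change M.map (circlePoint g _) = M.map (circlePoint g _)
    rw [cb]
  · change M.map (circlePoint g _) = M.map (circlePoint g _)
    rw [M.map_side _ ht, ca]
  · change M.map (circlePoint g _) = M.map (circlePoint g _)
    rw [M.map_side _ ht, cb]
    ring_nf

/-- The boundaries of the cones over the sides of one handle add up to the difference of two
radii, and these differences telescope. -/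
theorem polygonChain_mem_cycles (hg : g ≠ 0) : M.polygonChain ∈ cycles X 2 := by
  change boundary X 1 M.polygonChain = 0
  let r : ℕ → (SingularSimplex 1 X →₀ ℤ) := fun n =>
    Finsupp.single (pathSimplex (M.map.comp (segmentPath (circlePoint g (4 * (n : ℝ))) 0))) 1
  have h : ∀ i : Fin g, boundary X 1
      (coneChain M.map ⟨fun t => circlePoint g (4 * (i : ℕ) + t), by fun_prop⟩ +
        coneChain M.map ⟨fun t => circlePoint g (4 * (i : ℕ) + 1 + t), by fun_prop⟩ -
        coneChain M.map ⟨fun t => circlePoint g (4 * (i : ℕ) + 3 - t), by fun_prop⟩ -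
        coneChain M.map ⟨fun t => circlePoint g (4 * (i : ℕ) + 4 - t), by fun_prop⟩) =
      r (i + 1) - r i := by
    intro i
    obtain ⟨e1, e2, e3, e4⟩ := M.side_paths i
    have c1 : (4 * (i : ℕ) + 1 + 1 : ℝ) = 4 * (i : ℕ) + 2 := by ring
    have c2 : (4 * (i : ℕ) + 3 - 1 : ℝ) = 4 * (i : ℕ) + 2 := by ring
    have c3 : (4 * (i : ℕ) + 4 - 1 : ℝ) = 4 * (i : ℕ) + 3 := by ring
    have c4 : (4 * ((i + 1 : ℕ) : ℝ) : ℝ) = 4 * (i : ℕ) + 4 := by push_cast; ring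
    simp only [map_add, map_sub, boundary_coneChain, e1, e2, e3, e4, ContinuousMap.coe_mk, add_zero,
      sub_zero, c1, c2, c3, r, c4]
    abel
  rw [polygonChain, map_sum, Finset.sum_congr rfl fun i _ => h i,
    Fin.sum_univ_eq_sum_range (fun n => r (n + 1) - r n), Finset.sum_range_sub, sub_eq_zero]
  have e : circlePoint g (4 * (g : ℝ)) = circlePoint g (4 * ((0 : ℕ) : ℝ)) := by
    rw [Nat.cast_zero, mul_zero, ← circlePoint_period hg 0, zero_add]
  simp only [r, e]

/-- The class of the polygon in the second homology of the surface. -/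
noncomputable def polygonClass (hg : g ≠ 0) : Homology X 2 :=
  QuotientAddGroup.mk ⟨M.polygonChain, M.polygonChain_mem_cycles hg⟩

/-- The cup product on the cone over a side is the product of the period along the side with the
increment of a potential along the last radius; the sum over a handle is read off from
`IsPotential.corner_values`. -/
theorem intersectionPairing_polygonClass (hg : g ≠ 0) {A : Type v} [CommRing A]
    (u v : Cohomology X A 1) : intersectionPairing (M.polygonClass hg) A u v =
      symplecticForm (M.period A u) (M.period A v) := by
  obtain ⟨α, rfl⟩ := Cohomology.mk_surjective X A 1 u
  obtain ⟨β, rfl⟩ := Cohomology.mk_surjective X A 1 v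
  change evalChain (cupCochain α.1 β.1) M.polygonChain = _
  obtain ⟨φ, hφ⟩ := M.exists_isPotential β
  have hray : ∀ p : ℂ, β.1 (pathSimplex (M.map.comp (segmentPath p 0))) = φ 0 - φ p := by
    intro p
    rw [hφ]
    simp [segmentPath]
  rw [polygonChain, map_sum, symplecticForm]
  refine Finset.sum_congr rfl fun i _ => ?_
  obtain ⟨e1, e2, e3, e4⟩ := M.side_paths i
  have c1 : (4 * (i : ℕ) + 1 + 1 : ℝ) = 4 * (i : ℕ) + 2 := by ring
  have c2 : (4 * (i : ℕ) + 3 - 1 : ℝ) = 4 * (i : ℕ) + 2 := by ring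
  have c3 : (4 * (i : ℕ) + 4 - 1 : ℝ) = 4 * (i : ℕ) + 3 := by ring
  obtain ⟨v1, v2, v3, -⟩ := hφ.corner_values i
  simp only [map_add, map_sub, evalChain_coneChain, e1, e2, e3, e4, hray, ContinuousMap.coe_mk,
    c1, c2, c3, v1, v2, v3]
  simp only [← M.period_mk]
  ring

end PolygonModel

/-! ### Naturality of the intersection pairing -/

section Naturality

variable {X : Type u} [TopologicalSpace X] {A : Type v} [CommRing A]

theorem evalClass_zsmul (k : ℤ) (o : Homology X 2) (c : Cohomology X A 2) :
    evalClass A (k • o) c = k * evalClass A o c := by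
  obtain ⟨c, rfl⟩ := Cohomology.mk_surjective X A 2 c
  have hker : (boundaries X 2).addSubgroupOf (cycles X 2) ≤
      ((evalChain c.1).comp (cycles X 2).subtype).ker := by
    rintro ⟨z, hz⟩ ⟨y, hy⟩
    have hc : coboundary X A 2 c.1 = 0 := c.2
    change evalChain c.1 z = 0
    rw [← show boundary X 2 y = z from hy, evalChain_boundary, hc]
    simp [evalChain]
  have h := map_zsmul (QuotientAddGroup.lift ((boundaries X 2).addSubgroupOf (cycles X 2))
    ((evalChain c.1).comp (cycles X 2).subtype) hker) k o
  rw [zsmul_eq_mul] at h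
  exact h

theorem intersectionPairing_zsmul (k : ℤ) (o : Homology X 2) (u v : Cohomology X A 1) :
    intersectionPairing (k • o) A u v = k * intersectionPairing o A u v :=
  evalClass_zsmul k o _

theorem intersectionPairing_pushforward (f : C(X, X)) (o : Homology X 2)
    (u v : Cohomology X A 1) :
    intersectionPairing (pushforward f 2 o) A u v =
      intersectionPairing o A (pullback f A 1 u) (pullback f A 1 v) := by
  obtain ⟨α, rfl⟩ := Cohomology.mk_surjective X A 1 u
  obtain ⟨β, rfl⟩ := Cohomology.mk_surjective X A 1 v
  obtain ⟨⟨z, hz⟩, rfl⟩ := QuotientAddGroup.mk_surjective o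
  change evalChain (cupCochain α.1 β.1) (Finsupp.mapDomain (fun σ => f.comp σ) z) =
    evalChain (cupCochain (cochainMap f A 1 α.1) (cochainMap f A 1 β.1)) z
  simp only [evalChain, LinearMap.toAddMonoidHom_coe, Finsupp.linearCombination_mapDomain]
  rfl

theorem pullback_changeCoeff {B : Type w} [CommRing B] (r : A →+* B) (f : C(X, X))
    (u : Cohomology X A 1) :
    pullback f B 1 (changeCoeff X r 1 u) = changeCoeff X r 1 (pullback f A 1 u) := by
  obtain ⟨α, rfl⟩ := Cohomology.mk_surjective X A 1 u
  rfl

theorem PolygonModel.period_changeCoeff {g : ℕ} (M : PolygonModel g X) {B : Type w} [CommRing B]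
    (r : A →+* B) (u : Cohomology X A 1) (j : Fin g × Fin 2) :
    M.period B (changeCoeff X r 1 u) j = r (M.period A u j) := by
  obtain ⟨α, rfl⟩ := Cohomology.mk_surjective X A 1 u
  rfl

end Naturality

/-! ### Fundamental classes and orientation preserving homeomorphisms -/

namespace PolygonModel

variable {g : ℕ} {X : Type u} [TopologicalSpace X] (M : PolygonModel g X)

theorem exists_symplecticForm_eq_one (hg : g ≠ 0) :
    ∃ u v : Cohomology X ℚ 1, symplecticForm (M.period ℚ u) (M.period ℚ v) = 1 := by
  let i : Fin g := ⟨0, Nat.pos_of_ne_zero hg⟩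
  obtain ⟨u, hu⟩ := M.exists_period_eq_single hg ℚ (i, 0)
  obtain ⟨v, hv⟩ := M.exists_period_eq_single hg ℚ (i, 1)
  refine ⟨u, v, ?_⟩
  rw [hu, hv, symplecticForm, Finset.sum_eq_single i]
  · simp
  · intro i' _ hi
    simp [hi]
  · simp

/-- The intersection pairing is a nonzero multiple of the standard symplectic form. (The multiple
is `± 1`, but this plays no role.) -/
theorem exists_intersectionPairing_eq (hg : g ≠ 0) {o : Homology X 2}
    (ho : IsFundamentalClass o) : ∃ k : ℚ, k ≠ 0 ∧ ∀ u v : Cohomology X ℚ 1,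
      symplecticForm (M.period ℚ u) (M.period ℚ v) = k * intersectionPairing o ℚ u v := by
  obtain ⟨k, hk⟩ := ho (M.polygonClass hg)
  have h : ∀ u v : Cohomology X ℚ 1,
      symplecticForm (M.period ℚ u) (M.period ℚ v) = k * intersectionPairing o ℚ u v := by
    intro u v
    rw [← M.intersectionPairing_polygonClass hg, hk, intersectionPairing_zsmul]
  refine ⟨k, ?_, h⟩
  intro hk0
  obtain ⟨u, v, huv⟩ := M.exists_symplecticForm_eq_one hg
  have := h u v
  rw [hk0, zero_mul, huv] at this
  exact one_ne_zero this

/-- A homeomorphism preserving the standard symplectic form on periods is orientation preserving: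
it multiplies the fundamental class by an integer, and the pairing shows that the integer
is `1`. -/
theorem mem_homeoPlus (hg : g ≠ 0) {o : Homology X 2} (ho : IsFundamentalClass o) (f : X ≃ₜ X)
    (hf : ∀ u v : Cohomology X ℚ 1, symplecticForm (M.period ℚ (pullback (f : C(X, X)) ℚ 1 u))
      (M.period ℚ (pullback (f : C(X, X)) ℚ 1 v)) =
        symplecticForm (M.period ℚ u) (M.period ℚ v)) : f ∈ HomeoPlus X o := by
  change pushforward (f : C(X, X)) 2 o = o
  obtain ⟨m, hm⟩ := ho (pushforward (f : C(X, X)) 2 o)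
  obtain ⟨k, hk0, hk⟩ := M.exists_intersectionPairing_eq hg ho
  obtain ⟨u, v, huv⟩ := M.exists_symplecticForm_eq_one hg
  have h1 := intersectionPairing_pushforward (A := ℚ) (f : C(X, X)) o u v
  rw [hm, intersectionPairing_zsmul] at h1
  have h2 := hf u v
  rw [hk, hk, ← h1] at h2
  have h3 : intersectionPairing o ℚ u v ≠ 0 := by
    intro h
    have := hk u v
    rw [h, mul_zero, huv] at this
    exact one_ne_zero this
  have h4 : (m : ℚ) = 1 := by
    have h5 := mul_left_cancel₀ hk0 h2
    exact mul_right_cancel₀ h3 (by rw [h5, one_mul])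
  have h5 : m = 1 := by exact_mod_cast h4
  rw [hm, h5, one_smul]

end PolygonModel

/-! ### The rotation permuting the handles -/

section Rotation

variable {g : ℕ} {X : Type u} [TopologicalSpace X]

/-- The cyclic permutation of the handles. -/
def nextHandle (j : Fin g × Fin 2) : Fin g × Fin 2 :=
  (⟨((j.1 : ℕ) + 1) % g, Nat.mod_lt _ (Nat.zero_lt_of_lt j.1.2)⟩, j.2)

theorem circlePoint_corner_nextHandle (j : Fin g × Fin 2) (t : ℝ) :
    circlePoint g (corner (nextHandle j) + t) = circlePoint g (corner j + 4 + t) := by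
  have hg : g ≠ 0 := (Nat.zero_lt_of_lt j.1.2).ne'
  by_cases h : (j.1 : ℕ) + 1 < g
  · congr 1
    simp only [corner, nextHandle, Nat.mod_eq_of_lt h]
    push_cast
    ring
  · have h' : (j.1 : ℕ) + 1 = g := by have := j.1.2; omega
    have h2 : ((j.1 : ℕ) : ℝ) = g - 1 := eq_sub_of_add_eq (by exact_mod_cast h')
    rw [← circlePoint_period hg]
    congr 1
    simp only [corner, nextHandle, h', Nat.mod_self, h2]
    push_cast
    ring

theorem exists_nextHandle_eq (j : Fin g × Fin 2) : ∃ k, nextHandle k = j := by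
  obtain ⟨⟨i, hi⟩, e⟩ := j
  rcases i with _ | i
  · refine ⟨(⟨g - 1, by omega⟩, e), ?_⟩
    simp [nextHandle, Nat.sub_add_cancel hi]
  · refine ⟨(⟨i, by omega⟩, e), ?_⟩
    simp [nextHandle, Nat.mod_eq_of_lt hi]

namespace PolygonModel

/-- The rotation of the polygon by four sides induces a homeomorphism of the surface. -/
theorem exists_rotation (M : PolygonModel g X) : ∃ R : X ≃ₜ X,
    ∀ (A : Type v) [CommRing A] (u : Cohomology X A 1) (j : Fin g × Fin 2),
      M.period A (pullback (R : C(X, X)) A 1 u) j = M.period A u (nextHandle j) := by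
  have hn : ∀ {z : ℂ} (t : ℝ), ‖z‖ ≤ 1 → ‖z * circlePoint g t‖ ≤ 1 := by
    intro z t hz
    rwa [norm_mul, norm_circlePoint, mul_one]
  obtain ⟨F, hF⟩ := M.exists_descent
    ⟨fun z => M.map (z * circlePoint g 4), by fun_prop⟩ fun j s hs => by
      change M.map _ = M.map _
      have := M.map_side (nextHandle j) hs
      rw [add_sub_assoc, circlePoint_corner_nextHandle, circlePoint_corner_nextHandle] at this
      rw [← circlePoint_add, ← circlePoint_add]
      convert this using 3 <;> ring
  obtain ⟨G, hG⟩ := M.exists_descent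
    ⟨fun z => M.map (z * circlePoint g (-4)), by fun_prop⟩ fun j s hs => by
      change M.map _ = M.map _
      obtain ⟨k, rfl⟩ := exists_nextHandle_eq j
      rw [add_sub_assoc, circlePoint_corner_nextHandle, circlePoint_corner_nextHandle,
        ← circlePoint_add, ← circlePoint_add]
      convert M.map_side k hs using 3 <;> ring
  have hF' : ∀ z, ‖z‖ ≤ 1 → F (M.map z) = M.map (z * circlePoint g 4) := hF
  have hG' : ∀ z, ‖z‖ ≤ 1 → G (M.map z) = M.map (z * circlePoint g (-4)) := hG
  have hGF : ∀ x, G (F x) = x := by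
    intro x
    obtain ⟨z, hz, rfl⟩ := M.exists_map_eq x
    rw [hF' z hz, hG' _ (hn 4 hz), mul_assoc, ← circlePoint_add, add_neg_cancel, circlePoint_zero,
      mul_one]
  have hFG : ∀ x, F (G x) = x := by
    intro x
    obtain ⟨z, hz, rfl⟩ := M.exists_map_eq x
    rw [hG' z hz, hF' _ (hn (-4) hz), mul_assoc, ← circlePoint_add, neg_add_cancel,
      circlePoint_zero, mul_one]
  refine ⟨⟨⟨F, G, hGF, hFG⟩, F.continuous, G.continuous⟩, fun A _ u j => ?_⟩
  obtain ⟨α, rfl⟩ := Cohomology.mk_surjective X A 1 u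
  change α.1 (pathSimplex (F.comp (M.sidePath j))) = α.1 (pathSimplex (M.sidePath (nextHandle j)))
  refine congrArg α.1 (pathSimplex_congr fun t _ => ?_)
  change F (M.map (circlePoint g _)) = M.map (circlePoint g _)
  rw [hF' _ (norm_circlePoint _).le, circlePoint_corner_nextHandle, ← circlePoint_add]
  congr 2
  ring

end PolygonModel

end Rotation

/-! ### Dehn twists along the strips -/

section Twist

variable {g : ℕ} {X : Type u} [TopologicalSpace X]

/-- The retraction of the real line onto the unit interval. -/
noncomputable def clamp : C(ℝ, ℝ) := ⟨fun s => max 0 (min 1 s), by fun_prop⟩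

theorem clamp_mem (s : ℝ) : clamp s ∈ Set.Icc (0 : ℝ) 1 :=
  ⟨le_max_left _ _, max_le zero_le_one (min_le_left _ _)⟩

theorem clamp_of_mem {s : ℝ} (hs : s ∈ Set.Icc (0 : ℝ) 1) : clamp s = s := by
  change max 0 (min 1 s) = s
  rw [min_eq_right hs.2, max_eq_right hs.1]

/-- Half of the angle subtended by the chord with coordinate `s`. -/
noncomputable def chordAngle (g : ℕ) (s : ℝ) : ℝ := Real.pi * (3 / 2 - s) / (2 * g)

/-- The point dividing the chord from `corner j + s` to `corner j + 3 - s` in the ratio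
`r : 1 - r`. -/
noncomputable def chordPoint (j : Fin g × Fin 2) (s r : ℝ) : ℂ :=
  circlePoint g (stripCenter j) *
    ⟨Real.cos (chordAngle g s), Real.sin (chordAngle g s) * (2 * r - 1)⟩

theorem chordAngle_mem (hg : g ≠ 0) {s : ℝ} (hs : s ∈ Set.Icc (0 : ℝ) 1) :
    0 < chordAngle g s ∧ chordAngle g s < Real.pi := by
  have h1 : (1 : ℝ) ≤ g := by exact_mod_cast Nat.one_le_iff_ne_zero.2 hg
  have hpi := Real.pi_pos
  have : 0 < 3 / 2 - s := by linarith [hs.2]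
  constructor
  · unfold chordAngle
    positivity
  · rw [chordAngle, div_lt_iff₀ (by positivity)]
    gcongr
    linarith [hs.1]

theorem norm_chordPoint_le (j : Fin g × Fin 2) (s : ℝ) {r : ℝ} (hr : r ∈ Set.Icc (0 : ℝ) 1) :
    ‖chordPoint j s r‖ ≤ 1 := by
  rw [chordPoint, norm_mul, norm_circlePoint, one_mul]
  rw [← sq_le_one_iff₀ (norm_nonneg _), ← Complex.normSq_eq_norm_sq, Complex.normSq_mk]
  have h := Real.sin_sq_add_cos_sq (chordAngle g s)
  have h2 : (2 * r - 1) ^ 2 ≤ 1 := by nlinarith [hr.1, hr.2]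
  nlinarith [sq_nonneg (Real.sin (chordAngle g s))]

theorem circlePoint_eq_mk (t : ℝ) : circlePoint g t =
    ⟨Real.cos (Real.pi * t / (2 * g)), Real.sin (Real.pi * t / (2 * g))⟩ :=
  Complex.ext (re_circlePoint t) (im_circlePoint t)

theorem chordPoint_zero (j : Fin g × Fin 2) (s : ℝ) :
    chordPoint j s 0 = circlePoint g (corner j + s) := by
  have : corner j + s = stripCenter j + (s - 3 / 2) := by rw [stripCenter]; ring
  rw [this, circlePoint_add, circlePoint_eq_mk (s - 3 / 2), chordPoint]
  have e : Real.pi * (s - 3 / 2) / (2 * g) = -chordAngle g s := by rw [chordAngle]; ring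
  rw [e, Real.cos_neg, Real.sin_neg]
  congr 2
  ring

theorem chordPoint_one (j : Fin g × Fin 2) (s : ℝ) :
    chordPoint j s 1 = circlePoint g (corner j + 3 - s) := by
  have : corner j + 3 - s = stripCenter j + (3 / 2 - s) := by rw [stripCenter]; ring
  rw [this, circlePoint_add, circlePoint_eq_mk (3 / 2 - s), chordPoint]
  congr 2
  rw [chordAngle]
  ring

/-- The coordinate along the chords orthogonal to the direction of `stripCenter j`, running from
`0` to `1` on each chord of the strip. -/
noncomputable def chordCoord (j : Fin g × Fin 2) (z : ℂ) : ℝ :=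
  ((z * circlePoint g (-stripCenter j)).im / Real.sin (chordAngle g (stripRamp j z)) + 1) / 2

theorem stripRamp_mem (j : Fin g × Fin 2) (z : ℂ) : stripRamp j z ∈ Set.Icc (0 : ℝ) 1 :=
  clamp_mem _

theorem sin_chordAngle_pos (hg : g ≠ 0) {s : ℝ} (hs : s ∈ Set.Icc (0 : ℝ) 1) :
    0 < Real.sin (chordAngle g s) :=
  Real.sin_pos_of_pos_of_lt_pi (chordAngle_mem hg hs).1 (chordAngle_mem hg hs).2

theorem continuous_chordCoord (hg : g ≠ 0) (j : Fin g × Fin 2) : Continuous (chordCoord j) := by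
  unfold chordCoord
  refine Continuous.div_const (Continuous.add (Continuous.div ?_ ?_ fun z =>
    (sin_chordAngle_pos hg (stripRamp_mem j z)).ne') continuous_const) _
  · fun_prop
  · unfold chordAngle
    fun_prop

theorem chordPoint_mul (j : Fin g × Fin 2) (s r : ℝ) :
    chordPoint j s r * circlePoint g (-stripCenter j) =
      ⟨Real.cos (chordAngle g s), Real.sin (chordAngle g s) * (2 * r - 1)⟩ := by
  rw [chordPoint, mul_right_comm, ← circlePoint_add, add_neg_cancel, circlePoint_zero, one_mul]

theorem stripCoord_chordPoint (hg : g ≠ 0) (j : Fin g × Fin 2) {s : ℝ}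
    (hs : s ∈ Set.Icc (0 : ℝ) 1) (r : ℝ) : stripCoord j (chordPoint j s r) = s := by
  have h : (g : ℝ) ≠ 0 := by exact_mod_cast hg
  have hpi := Real.pi_pos.ne'
  change 3 / 2 - 2 * g / Real.pi *
    Real.arccos (chordPoint j s r * circlePoint g (-stripCenter j)).re = s
  obtain ⟨h0, h1⟩ := chordAngle_mem hg hs
  rw [chordPoint_mul, Real.arccos_cos h0.le h1.le, chordAngle]
  field_simp
  ring

theorem chordCoord_chordPoint (hg : g ≠ 0) (j : Fin g × Fin 2) {s : ℝ}
    (hs : s ∈ Set.Icc (0 : ℝ) 1) (r : ℝ) : chordCoord j (chordPoint j s r) = r := by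
  have h := (sin_chordAngle_pos hg hs).ne'
  have e := stripCoord_chordPoint hg j hs r
  rw [chordCoord, chordPoint_mul, stripRamp_of_mem (by rwa [e]), e]
  field_simp
  ring

theorem chordPoint_coord (hg : g ≠ 0) (j : Fin g × Fin 2) {z : ℂ} (hz : ‖z‖ ≤ 1)
    (hs : stripCoord j z ∈ Set.Icc (0 : ℝ) 1) :
    chordPoint j (stripCoord j z) (chordCoord j z) = z ∧ chordCoord j z ∈ Set.Icc (0 : ℝ) 1 := by
  have h : (g : ℝ) ≠ 0 := by exact_mod_cast hg
  have hpi := Real.pi_pos.ne'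
  have hsin := sin_chordAngle_pos hg hs
  set w := z * circlePoint g (-stripCenter j) with hw
  have hwn : ‖w‖ ≤ 1 := by rwa [hw, norm_mul, norm_circlePoint, mul_one]
  have hre := (Complex.abs_re_le_norm w).trans hwn
  rw [abs_le] at hre
  have hang : chordAngle g (stripCoord j z) = Real.arccos w.re := by
    change Real.pi * (3 / 2 - (3 / 2 - 2 * g / Real.pi * Real.arccos w.re)) / (2 * g) = _
    field_simp
    ring
  have hcos : Real.cos (chordAngle g (stripCoord j z)) = w.re := by
    rw [hang, Real.cos_arccos hre.1 hre.2]
  have him : Real.sin (chordAngle g (stripCoord j z)) * (2 * chordCoord j z - 1) = w.im := by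
    rw [chordCoord, stripRamp_of_mem hs, ← hw]
    field_simp
    ring
  constructor
  · have : (⟨Real.cos (chordAngle g (stripCoord j z)),
        Real.sin (chordAngle g (stripCoord j z)) * (2 * chordCoord j z - 1)⟩ : ℂ) = w :=
      Complex.ext hcos him
    rw [chordPoint, this, hw, mul_left_comm, ← circlePoint_add, add_neg_cancel, circlePoint_zero,
      mul_one]
  · have h1 : w.re ^ 2 + w.im ^ 2 ≤ 1 := by
      have := (sq_le_one_iff₀ (norm_nonneg w)).2 hwn
      rw [← Complex.normSq_eq_norm_sq, Complex.normSq_apply] at this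
      linarith
    have h2 := Real.sin_sq_add_cos_sq (chordAngle g (stripCoord j z))
    rw [← hcos, ← him, mul_pow] at h1
    have h3 : Real.sin (chordAngle g (stripCoord j z)) ^ 2 * (2 * chordCoord j z - 1) ^ 2 ≤
        Real.sin (chordAngle g (stripCoord j z)) ^ 2 * 1 := by linarith
    have h4 := le_of_mul_le_mul_left h3 (by positivity)
    rw [sq_le_one_iff_abs_le_one, abs_le] at h4
    exact ⟨by linarith [h4.1], by linarith [h4.2]⟩

namespace PolygonModel

variable (M : PolygonModel g X)

/-- The annulus formed by the chords of a strip, as a map periodic in the second variable. -/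
noncomputable def annulus (j : Fin g × Fin 2) : C(ℝ × ℝ, X) :=
  ⟨fun x => M.map (chordPoint j (clamp x.1) (Int.fract x.2)), by
    refine ContinuousOn.comp_fract
      (f := fun (x : ℝ × ℝ) (r : ℝ) => M.map (chordPoint j (clamp x.1) r)) ?_ continuous_snd ?_
    · refine (M.map.continuous.comp ?_).continuousOn
      have e : (fun x : (ℝ × ℝ) × ℝ => chordPoint j (clamp x.1.1) x.2) = fun x =>
          circlePoint g (stripCenter j) * ((Real.cos (chordAngle g (clamp x.1.1)) : ℂ) +
            ((Real.sin (chordAngle g (clamp x.1.1)) * (2 * x.2 - 1) : ℝ) : ℂ) * Complex.I) := by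
        funext x
        rw [chordPoint, Complex.mk_eq_add_mul_I]
      change Continuous fun x : (ℝ × ℝ) × ℝ => chordPoint j (clamp x.1.1) x.2
      rw [e]
      unfold chordAngle
      fun_prop
    · intro x
      rw [chordPoint_zero, chordPoint_one]
      exact M.map_side j (clamp_mem _)⟩

theorem annulus_of_mem (j : Fin g × Fin 2) {s r : ℝ} (hs : s ∈ Set.Icc (0 : ℝ) 1)
    (hr : r ∈ Set.Icc (0 : ℝ) 1) : M.annulus j (s, r) = M.map (chordPoint j s r) := by
  change M.map (chordPoint j (clamp s) (Int.fract r)) = _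
  rw [clamp_of_mem hs]
  rcases eq_or_lt_of_le hr.2 with h | h
  · rw [h, Int.fract_one, chordPoint_zero, chordPoint_one]
    exact M.map_side j hs
  · rw [Int.fract_eq_self.2 ⟨hr.1, h⟩]

theorem annulus_add_int (j : Fin g × Fin 2) (s r : ℝ) (n : ℤ) :
    M.annulus j (s, r + n) = M.annulus j (s, r) := by
  change M.map (chordPoint j (clamp s) (Int.fract (r + n))) = _
  rw [Int.fract_add_intCast]
  rfl

theorem map_eq_annulus (hg : g ≠ 0) (j : Fin g × Fin 2) {z : ℂ} (hz : ‖z‖ ≤ 1)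
    (hs : stripCoord j z ∈ Set.Icc (0 : ℝ) 1) :
    M.map z = M.annulus j (stripCoord j z, chordCoord j z) := by
  obtain ⟨h1, h2⟩ := chordPoint_coord hg j hz hs
  rw [M.annulus_of_mem j hs h2, h1]

open Classical in
/-- The `n`-fold twist along a strip, as a map defined on the polygon: the chord with coordinate
`s` is rotated by the fraction `n * s` of its length, and the complement of the strip is fixed. -/
noncomputable def twistDisc (n : ℤ) (j : Fin g × Fin 2) (z : ℂ) : X :=
  if stripCoord j z ≤ 0 then M.map z else
    if 1 ≤ stripCoord j z then M.map z else
      M.annulus j (stripCoord j z, chordCoord j z + n * stripCoord j z)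

theorem twistDisc_of_mem (hg : g ≠ 0) (n : ℤ) (j : Fin g × Fin 2) {z : ℂ} (hz : ‖z‖ ≤ 1)
    (hs : stripCoord j z ∈ Set.Icc (0 : ℝ) 1) :
    M.twistDisc n j z = M.annulus j (stripCoord j z, chordCoord j z + n * stripCoord j z) := by
  have h := M.map_eq_annulus hg j hz hs
  unfold twistDisc
  split_ifs with h0 h1
  · have e : stripCoord j z = 0 := le_antisymm h0 hs.1
    rw [h, e, mul_zero, add_zero]
  · have e : stripCoord j z = 1 := le_antisymm hs.2 h1
    rw [h, e, mul_one, annulus_add_int]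
  · rfl

theorem twistDisc_of_outside (n : ℤ) (j : Fin g × Fin 2) {z : ℂ}
    (h : stripCoord j z ≤ 0 ∨ 1 ≤ stripCoord j z) : M.twistDisc n j z = M.map z := by
  unfold twistDisc
  split_ifs with h0 h1
  · rfl
  · rfl
  · exact absurd h (not_or.2 ⟨h0, h1⟩)

theorem continuous_twistDisc (hg : g ≠ 0) (n : ℤ) (j : Fin g × Fin 2) :
    Continuous fun p : Metric.closedBall (0 : ℂ) 1 => M.twistDisc n j p := by
  have hc := continuous_chordCoord hg j
  have hpn : ∀ p : Metric.closedBall (0 : ℂ) 1, ‖(p : ℂ)‖ ≤ 1 :=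
    fun p => mem_closedBall_zero_iff.1 p.2
  have hm : Continuous fun p : Metric.closedBall (0 : ℂ) 1 => M.map p := by fun_prop
  have ha : Continuous fun p : Metric.closedBall (0 : ℂ) 1 =>
      M.annulus j (stripCoord j p, chordCoord j p + n * stripCoord j p) := by fun_prop
  have hS : Continuous fun p : Metric.closedBall (0 : ℂ) 1 => stripCoord j (p : ℂ) := by fun_prop
  unfold twistDisc
  refine Continuous.if_le hm (Continuous.if_le hm ha continuous_const hS ?_) hS continuous_const ?_
  · intro p hp
    rw [M.map_eq_annulus hg j (hpn p) (by rw [← hp]; simp), ← hp, mul_one, annulus_add_int]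
  · intro p hp
    rw [if_neg (by rw [hp]; simp), M.map_eq_annulus hg j (hpn p) (by rw [hp]; simp), hp, mul_zero,
      add_zero]

theorem twistDisc_chordPoint (hg : g ≠ 0) (n : ℤ) (j : Fin g × Fin 2) {s r : ℝ}
    (hs : s ∈ Set.Icc (0 : ℝ) 1) (hr : r ∈ Set.Icc (0 : ℝ) 1) :
    M.twistDisc n j (chordPoint j s r) = M.annulus j (s, r + n * s) := by
  have e := stripCoord_chordPoint hg j hs r
  rw [M.twistDisc_of_mem hg n j (norm_chordPoint_le j s hr) (by rwa [e]), e,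
    chordCoord_chordPoint hg j hs]

theorem exists_twistMap (hg : g ≠ 0) (n : ℤ) (j : Fin g × Fin 2) :
    ∃ T : C(X, X), ∀ z : ℂ, ‖z‖ ≤ 1 → T (M.map z) = M.twistDisc n j z := by
  obtain ⟨T, hT⟩ := M.exists_descent
    ((⟨_, M.continuous_twistDisc hg n j⟩ : C(Metric.closedBall (0 : ℂ) 1, X)).comp discRetraction)
    fun k s hs => by
      change M.twistDisc n j (discRetraction _ : ℂ) = M.twistDisc n j (discRetraction _ : ℂ)
      rw [discRetraction_of_norm_le (norm_circlePoint _).le,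
        discRetraction_of_norm_le (norm_circlePoint _).le]
      change M.twistDisc n j (circlePoint g _) = M.twistDisc n j (circlePoint g _)
      by_cases hk : k = j
      · subst hk
        rw [← chordPoint_zero, ← chordPoint_one, M.twistDisc_chordPoint hg n k hs (by simp),
          M.twistDisc_chordPoint hg n k hs (by simp), zero_add, add_comm (1 : ℝ)]
        exact_mod_cast (M.annulus_add_int k s (n * s) 1).symm
      · obtain ⟨h1, h2⟩ := stripCoord_other_side hg hk
        rw [M.twistDisc_of_outside n j (h1.imp (fun h => h s hs) fun h => h s hs),
          M.twistDisc_of_outside n j (h2.imp (fun h => h s hs) fun h => h s hs)]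
        exact M.map_side k hs
  refine ⟨T, fun z hz => (hT z hz).trans ?_⟩
  change M.twistDisc n j (discRetraction z : ℂ) = _
  rw [discRetraction_of_norm_le hz]

/-- The twist along the strip `j`. -/
noncomputable def twistMap (hg : g ≠ 0) (n : ℤ) (j : Fin g × Fin 2) : C(X, X) :=
  (M.exists_twistMap hg n j).choose

theorem twistMap_map (hg : g ≠ 0) (n : ℤ) (j : Fin g × Fin 2) {z : ℂ} (hz : ‖z‖ ≤ 1) :
    M.twistMap hg n j (M.map z) = M.twistDisc n j z :=
  (M.exists_twistMap hg n j).choose_spec z hz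

theorem twistMap_annulus (hg : g ≠ 0) (n : ℤ) (j : Fin g × Fin 2) {s : ℝ}
    (hs : s ∈ Set.Icc (0 : ℝ) 1) (r : ℝ) :
    M.twistMap hg n j (M.annulus j (s, r)) = M.annulus j (s, r + n * s) := by
  have hf : Int.fract r ∈ Set.Icc (0 : ℝ) 1 := ⟨Int.fract_nonneg r, (Int.fract_lt_one r).le⟩
  have h1 : M.annulus j (s, r) = M.map (chordPoint j s (Int.fract r)) := by
    change M.map (chordPoint j (clamp s) (Int.fract r)) = _
    rw [clamp_of_mem hs]
  rw [h1, M.twistMap_map hg n j (norm_chordPoint_le j s hf), M.twistDisc_chordPoint hg n j hs hf,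
    ← M.annulus_add_int j s _ ⌊r⌋, add_right_comm, Int.fract_add_floor]

theorem twistMap_neg (hg : g ≠ 0) (n : ℤ) (j : Fin g × Fin 2) (x : X) :
    M.twistMap hg n j (M.twistMap hg (-n) j x) = x := by
  obtain ⟨z, hz, rfl⟩ := M.exists_map_eq x
  by_cases h : stripCoord j z ≤ 0 ∨ 1 ≤ stripCoord j z
  · rw [M.twistMap_map hg _ j hz, M.twistDisc_of_outside _ j h, M.twistMap_map hg _ j hz,
      M.twistDisc_of_outside _ j h]
  · rw [not_or, not_le, not_le] at h
    have hs : stripCoord j z ∈ Set.Icc (0 : ℝ) 1 := ⟨h.1.le, h.2.le⟩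
    rw [M.map_eq_annulus hg j hz hs, M.twistMap_annulus hg _ j hs, M.twistMap_annulus hg _ j hs]
    push_cast
    ring_nf

/-- The Dehn twist along the strip `j`, as a homeomorphism. -/
noncomputable def twist (hg : g ≠ 0) (j : Fin g × Fin 2) : X ≃ₜ X where
  toFun := M.twistMap hg 1 j
  invFun := M.twistMap hg (-1) j
  left_inv x := by simpa using M.twistMap_neg hg (-1) j x
  right_inv := M.twistMap_neg hg 1 j
  continuous_toFun := (M.twistMap hg 1 j).continuous
  continuous_invFun := (M.twistMap hg (-1) j).continuous

/-- The action of a Dehn twist on periods. Only the side `j` crosses the strip, and its image goes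
once around the annulus while crossing it. In the universal cover of the annulus this is the
diagonal of the unit square, so the period changes by the increment of a potential along the
last chord, from `corner j + 1` to `corner j + 2`. -/
theorem period_twist (hg : g ≠ 0) (j : Fin g × Fin 2) {A : Type v} [CommRing A]
    (u : Cohomology X A 1) :
    M.period A (pullback (M.twist hg j : C(X, X)) A 1 u) =
      Function.update (M.period A u) j (M.period A u j +
        if j.2 = 0 then M.period A u (j.1, 1) else -M.period A u (j.1, 0)) := by
  obtain ⟨α, rfl⟩ := Cohomology.mk_surjective X A 1 u
  funext k
  change α.1 (pathSimplex ((M.twistMap hg 1 j).comp (M.sidePath k))) = _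
  have hval : ∀ s : ℝ, (M.twistMap hg 1 j).comp (M.sidePath k) s =
      M.twistDisc 1 j (circlePoint g (corner k + s)) :=
    fun s => M.twistMap_map hg 1 j (norm_circlePoint _).le
  by_cases hk : k = j
  · subst hk
    rw [Function.update_self]
    obtain ⟨ψ, hψ⟩ := exists_potential α (M.annulus k)
    obtain ⟨φ, hφ⟩ := M.exists_isPotential α
    have e1 : α.1 (pathSimplex ((M.twistMap hg 1 k).comp (M.sidePath k))) =
        ψ (1, 1) - ψ (0, 0) := by
      refine Eq.trans (congrArg α.1 (pathSimplex_congr fun s hs => ?_))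
        (hψ ⟨fun s => (s, s), by fun_prop⟩)
      rw [hval, ← chordPoint_zero, M.twistDisc_chordPoint hg 1 k hs (by simp)]
      simp
    have e2 : M.period A (Cohomology.mk X A 1 α) k = ψ (1, 0) - ψ (0, 0) := by
      rw [period_mk]
      refine Eq.trans (congrArg α.1 (pathSimplex_congr fun s hs => ?_))
        (hψ ⟨fun s => (s, 0), by fun_prop⟩)
      change M.map (circlePoint g _) = M.annulus k (s, 0)
      rw [M.annulus_of_mem k hs (by simp), chordPoint_zero]
    have e3 : φ (circlePoint g (corner k + 2)) - φ (circlePoint g (corner k + 1)) =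
        ψ (1, 1) - ψ (1, 0) := by
      have hcont : Continuous fun r : ℝ => chordPoint k 1 r := by
        have e : (fun r : ℝ => chordPoint k 1 r) = fun r =>
            circlePoint g (stripCenter k) * ((Real.cos (chordAngle g 1) : ℂ) +
              ((Real.sin (chordAngle g 1) * (2 * r - 1) : ℝ) : ℂ) * Complex.I) := by
          funext r
          rw [chordPoint, Complex.mk_eq_add_mul_I]
        rw [e]
        fun_prop
      have h1 : _ = φ (chordPoint k 1 1) - φ (chordPoint k 1 0) := hφ ⟨_, hcont⟩
      have h2 : _ = ψ (1, 1) - ψ (1, 0) := hψ ⟨fun r => (1, r), by fun_prop⟩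
      rw [chordPoint_one, chordPoint_zero,
        show corner k + 3 - 1 = corner k + 2 by ring] at h1
      rw [← h1, ← h2]
      refine congrArg α.1 (pathSimplex_congr fun r hr => ?_)
      exact (M.annulus_of_mem k (by simp) hr).symm
    have e4 : (if k.2 = 0 then M.period A (Cohomology.mk X A 1 α) (k.1, 1)
        else -M.period A (Cohomology.mk X A 1 α) (k.1, 0)) =
        φ (circlePoint g (corner k + 2)) - φ (circlePoint g (corner k + 1)) := by
      obtain ⟨i, e⟩ := k
      obtain ⟨v1, v2, v3, -⟩ := hφ.corner_values i
      fin_cases e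
      · simp only [corner, Fin.zero_eta, Nat.cast_zero, add_zero, if_true]
        rw [v1, v2]
        ring
      · simp only [corner, Fin.mk_one, Nat.cast_one]
        rw [if_neg (by decide), show (4 * (i : ℕ) + 1 + 2 : ℝ) = 4 * (i : ℕ) + 3 by ring,
          show (4 * (i : ℕ) + 1 + 1 : ℝ) = 4 * (i : ℕ) + 2 by ring, v2, v3]
        ring
    rw [e1, e2, e4, e3]
    ring
  · rw [Function.update_of_ne hk, period_mk]
    refine congrArg α.1 (pathSimplex_congr fun s hs => ?_)
    rw [hval, M.twistDisc_of_outside 1 j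
      ((stripCoord_other_side hg hk).1.imp (fun h => h s hs) fun h => h s hs)]
    rfl

theorem symplecticForm_update {A : Type v} [CommRing A] (j : Fin g × Fin 2)
    (p q : Fin g × Fin 2 → A) :
    symplecticForm (Function.update p j (p j + if j.2 = 0 then p (j.1, 1) else -p (j.1, 0)))
      (Function.update q j (q j + if j.2 = 0 then q (j.1, 1) else -q (j.1, 0))) =
    symplecticForm p q := by
  refine Finset.sum_congr rfl fun i _ => ?_
  obtain ⟨i', e⟩ := j
  by_cases hi : i = i'
  · subst hi
    fin_cases e <;> simp <;> ring
  · simp [hi]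

theorem symplecticForm_nextHandle {A : Type v} [CommRing A] (p q : Fin g × Fin 2 → A) :
    symplecticForm (fun j => p (nextHandle j)) (fun j => q (nextHandle j)) =
      symplecticForm p q := by
  let f : Fin g → Fin g := fun i => (nextHandle (i, 0)).1
  have hf : Function.Bijective f := by
    refine Finite.surjective_iff_bijective.1 fun i => ?_
    obtain ⟨k, hk⟩ := exists_nextHandle_eq (i, (0 : Fin 2))
    exact ⟨k.1, congrArg Prod.fst hk⟩
  exact Function.Bijective.sum_comp hf fun i => p (i, 0) * q (i, 1) - p (i, 1) * q (i, 0)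

end PolygonModel

end Twist

/-! ### The second symmetric power of the reals -/

section SymmetricSquare

theorem update_pair_zero {V : Type*} (a b x : V) : Function.update ![a, b] 0 x = ![x, b] := by
  funext i
  fin_cases i <;> simp

theorem update_pair_one {V : Type*} (a b x : V) : Function.update ![a, b] 1 x = ![a, x] := by
  funext i
  fin_cases i <;> simp

theorem symMul_add_left (a a' b : ℝ) : symMul (a + a') b = symMul a b + symMul a' b := by
  have := (SymmetricPower.tprod ℚ (ι := Fin 2) (M := ℝ)).map_update_add ![a, b] 0 a a'
  rwa [update_pair_zero, update_pair_zero, update_pair_zero] at this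

theorem symMul_smul_left (r : ℚ) (a b : ℝ) : symMul (r • a) b = r • symMul a b := by
  have := (SymmetricPower.tprod ℚ (ι := Fin 2) (M := ℝ)).map_update_smul ![a, b] 0 r a
  rwa [update_pair_zero, update_pair_zero] at this

theorem symMul_comm (a b : ℝ) : symMul a b = symMul b a := by
  have := SymmetricPower.tprod_equiv (R := ℚ) (Equiv.swap (0 : Fin 2) 1) ![b, a]
  rw [symMul, symMul, ← this]
  congr 1
  funext i
  fin_cases i <;> simp

/-- The symmetric product as a bilinear map. -/
noncomputable def symMulHom : ℝ →ₗ[ℚ] ℝ →ₗ[ℚ] SymSq :=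
  LinearMap.mk₂ ℚ symMul symMul_add_left symMul_smul_left
    (fun a b b' => by rw [symMul_comm, symMul_add_left, symMul_comm b, symMul_comm b'])
    (fun r a b => by rw [symMul_comm, symMul_smul_left, symMul_comm b])

theorem symMulHom_apply (a b : ℝ) : symMulHom a b = symMul a b := rfl

variable {N : Type*} [AddCommGroup N]

/-- A biadditive map on a rational vector space is automatically balanced over `ℚ`, even if its
target is only an abelian group. -/
theorem biadditive_rat_smul {V : Type*} [AddCommGroup V] [Module ℚ V] (D : V →+ V →+ N) (r : ℚ)
    (x y : V) : D (r • x) y = D x (r • y) := by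
  have hd : (r.den : ℚ) ≠ 0 := by exact_mod_cast r.den_nz
  have key : ∀ z : V, z = (r.den : ℤ) • ((r.den : ℚ)⁻¹ • z) ∧
      r • z = r.num • ((r.den : ℚ)⁻¹ • z) := by
    intro z
    constructor
    · rw [← Int.cast_smul_eq_zsmul ℚ, smul_smul, Int.cast_natCast, mul_inv_cancel₀ hd, one_smul]
    · rw [← Int.cast_smul_eq_zsmul ℚ, smul_smul, ← div_eq_mul_inv, Rat.num_div_den]
  rw [(key x).2, (key y).2]
  nth_rewrite 1 [(key y).1]
  nth_rewrite 2 [(key x).1]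
  simp only [map_zsmul, AddMonoidHom.zsmul_apply, smul_smul, mul_comm]

/-- A symmetric biadditive map factors through the symmetric square over `ℚ`. -/
theorem exists_symSq_lift (D : ℝ →+ ℝ →+ N) (hD : ∀ x y, D x y = D y x) :
    ∃ Ψ : SymSq →+ N, ∀ x y, Ψ (symMul x y) = D x y := by
  let Ψ₀ : PiTensorProduct ℚ (fun _ : Fin 2 => ℝ) →+ N :=
    PiTensorProduct.liftAddHom (fun p => D (p.1 • p.2 0) (p.2 1))
      (by
        intro r f i hf
        fin_cases i
        · have h0 : f 0 = 0 := hf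
          simp [h0]
        · have h1 : f 1 = 0 := hf
          simp [h1])
      (by intro f; simp)
      (by
        intro _ r f i x y
        fin_cases i
        · simp [smul_add]
        · simp)
      (by intro r r' f; simp [add_smul])
      (by
        intro _ r f i r'
        fin_cases i
        · simp [smul_smul, mul_comm]
        · simp only [Fin.mk_one, Function.update_self, Fin.isValue, ne_eq, zero_ne_one,
            not_false_eq_true, Function.update_of_ne]
          rw [← biadditive_rat_smul, smul_smul])
  have hΨ₀ : ∀ f : Fin 2 → ℝ, Ψ₀ (PiTensorProduct.tprod ℚ f) = D (f 0) (f 1) := by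
    intro f
    change D ((1 : ℚ) • f 0) (f 1) = _
    rw [one_smul]
  let Ψ : SymSq →+ N := AddCon.lift (addConGen (SymmetricPower.Rel ℚ (Fin 2) ℝ)) Ψ₀
    (AddCon.addConGen_le.2 (by
      rintro _ _ ⟨e, f⟩
      refine (AddCon.ker_rel _).2 ?_
      rw [hΨ₀, hΨ₀]
      have he : e 0 = 0 ∧ e 1 = 1 ∨ e 0 = 1 ∧ e 1 = 0 := by
        revert e
        decide
      rcases he with ⟨h0, h1⟩ | ⟨h0, h1⟩
      · rw [h0, h1]
      · rw [h0, h1, hD]))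
  exact ⟨Ψ, fun x y => hΨ₀ ![x, y]⟩

theorem symSq_hom_ext {f f' : SymSq →+ SymSq} (h : ∀ x y, f (symMul x y) = f' (symMul x y)) :
    f = f' := by
  have : f.toRatLinearMap = f'.toRatLinearMap := by
    refine LinearMap.ext_on (SymmetricPower.span_tprod_eq_top (R := ℚ) (ι := Fin 2) (M := ℝ)) ?_
    rintro _ ⟨x, rfl⟩
    have e : x = ![x 0, x 1] := by funext i; fin_cases i <;> rfl
    have := h (x 0) (x 1)
    rw [symMul, ← e] at this
    exact this
  exact AddMonoidHom.ext fun x => congrArg (fun l => l x) this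

end SymmetricSquare

/-! ### Coinvariants of the exterior square -/

section Wedge

variable {X : Type u} [TopologicalSpace X] {o : Homology X 2}

/-- The class of `x ∧ y`, as a biadditive map. -/
noncomputable def wedgeHom (o : Homology X 2) :
    Cohomology X ℝ 1 →+ Cohomology X ℝ 1 →+ (mcgActionExtSq X o).Coinvariants :=
  AddMonoidHom.mk' (fun x => AddMonoidHom.mk' (fun y => wedgeClass o x y) fun y y' => by
      have := (exteriorPower.ιMulti ℤ 2 (M := Cohomology X ℝ 1)).map_update_add ![x, y] 1 y y'
      rw [update_pair_one, update_pair_one, update_pair_one] at this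
      rw [wedgeClass, this, map_add]
      rfl) fun x x' => by
    ext y
    have := (exteriorPower.ιMulti ℤ 2 (M := Cohomology X ℝ 1)).map_update_add ![x, y] 0 x x'
    rw [update_pair_zero, update_pair_zero, update_pair_zero] at this
    change wedgeClass o (x + x') y = wedgeClass o x y + wedgeClass o x' y
    rw [wedgeClass, this, map_add]
    rfl

theorem wedgeHom_apply (x y : Cohomology X ℝ 1) : wedgeHom o x y = wedgeClass o x y := rfl

theorem wedgeClass_self (x : Cohomology X ℝ 1) : wedgeClass o x x = 0 := by
  have : exteriorPower.ιMulti ℤ 2 ![x, x] = 0 :=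
    AlternatingMap.map_eq_zero_of_eq _ _ (i := 0) (j := 1) rfl (by decide)
  rw [wedgeClass, this, map_zero]

theorem wedgeClass_swap (x y : Cohomology X ℝ 1) : wedgeClass o x y = -wedgeClass o y x := by
  have h := wedgeClass_self (o := o) (x + y)
  simp only [← wedgeHom_apply, map_add, AddMonoidHom.add_apply] at h
  simp only [wedgeHom_apply, wedgeClass_self, zero_add, add_zero] at h
  exact eq_neg_of_add_eq_zero_right h

theorem wedgeClass_pullback {h : X ≃ₜ X} (hh : h ∈ HomeoPlus X o) (x y : Cohomology X ℝ 1) :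
    wedgeClass o (pullback (h : C(X, X)) ℝ 1 x) (pullback (h : C(X, X)) ℝ 1 y) =
      wedgeClass o x y := by
  let f : HomeoPlus X o := (⟨h, hh⟩ : HomeoPlus X o)⁻¹
  have e := Representation.Coinvariants.mk_self_apply (mcgActionExtSq X o) (QuotientGroup.mk f)
    (exteriorPower.ιMulti ℤ 2 ![x, y])
  rw [wedgeClass, wedgeClass, ← e]
  congr 1
  refine Eq.trans ?_ (exteriorPower.map_apply_ιMulti _ _).symm
  congr 1
  funext i
  fin_cases i <;> rfl

theorem coinvariants_hom_ext {N : Type*} [AddCommGroup N]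
    {f f' : (mcgActionExtSq X o).Coinvariants →+ N}
    (h : ∀ x y, f (wedgeClass o x y) = f' (wedgeClass o x y)) : f = f' := by
  have : f.toIntLinearMap = f'.toIntLinearMap := by
    refine Representation.Coinvariants.hom_ext (exteriorPower.linearMap_ext ?_)
    ext x
    have e : x = ![x 0, x 1] := by funext i; fin_cases i <;> rfl
    have := h (x 0) (x 1)
    rw [wedgeClass, ← e] at this
    exact this
  exact AddMonoidHom.ext fun x => congrArg (fun l => l x) this

/-- An additive map out of the coinvariants is given by an invariant alternating biadditive
map. -/
theorem exists_coinvariants_lift {N : Type*} [AddCommGroup N]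
    (B : Cohomology X ℝ 1 →+ Cohomology X ℝ 1 →+ N) (halt : ∀ x, B x x = 0)
    (hinv : ∀ h ∈ HomeoPlus X o, ∀ x y,
      B (pullback (h : C(X, X)) ℝ 1 x) (pullback (h : C(X, X)) ℝ 1 y) = B x y) :
    ∃ F : (mcgActionExtSq X o).Coinvariants →+ N, ∀ x y, F (wedgeClass o x y) = B x y := by
  let B' : (Cohomology X ℝ 1) [⋀^Fin 2]→ₗ[ℤ] N :=
    { toFun := fun m => B (m 0) (m 1)
      map_update_add' := by
        intro _ m i x y
        fin_cases i <;> simp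
      map_update_smul' := by
        intro _ m i c x
        fin_cases i <;> simp
      map_eq_zero_of_eq' := by
        intro m i j hm hij
        have : m 0 = m 1 := by
          fin_cases i <;> fin_cases j <;> simp_all
        change B (m 0) (m 1) = 0
        rw [this, halt] }
  let L := exteriorPower.alternatingMapLinearEquiv B'
  have hL : ∀ φ, L ∘ₗ mcgActionExtSq X o φ = L := by
    intro φ
    obtain ⟨f, rfl⟩ := QuotientGroup.mk_surjective φ
    refine exteriorPower.linearMap_ext ?_
    ext m
    change L (exteriorPower.map 2 ((mcgAction X o ℝ (QuotientGroup.mk f)).restrictScalars ℤ)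
      (exteriorPower.ιMulti ℤ 2 m)) = L (exteriorPower.ιMulti ℤ 2 m)
    rw [exteriorPower.map_apply_ιMulti, exteriorPower.alternatingMapLinearEquiv_apply_ιMulti,
      exteriorPower.alternatingMapLinearEquiv_apply_ιMulti]
    exact hinv _ (f⁻¹).2 (m 0) (m 1)
  exact ⟨(Representation.Coinvariants.lift (mcgActionExtSq X o) L hL).toAddMonoidHom, fun x y =>
    exteriorPower.alternatingMapLinearEquiv_apply_ιMulti B' ![x, y]⟩

end Wedge

/-! ### Mapping classes and dual classes -/

namespace PolygonModel

variable {g : ℕ} {X : Type u} [TopologicalSpace X] (M : PolygonModel g X)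

theorem twist_mem_homeoPlus (hg : g ≠ 0) {o : Homology X 2} (ho : IsFundamentalClass o)
    (j : Fin g × Fin 2) : M.twist hg j ∈ HomeoPlus X o := by
  refine M.mem_homeoPlus hg ho _ fun u v => ?_
  rw [period_twist, period_twist, symplecticForm_update]

theorem exists_rotation_mem_homeoPlus (hg : g ≠ 0) {o : Homology X 2}
    (ho : IsFundamentalClass o) : ∃ R ∈ HomeoPlus X o, ∀ (u : Cohomology X ℝ 1) (j),
      M.period ℝ (pullback (R : C(X, X)) ℝ 1 u) j = M.period ℝ u (nextHandle j) := by
  obtain ⟨R, hR⟩ := M.exists_rotation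
  refine ⟨R, M.mem_homeoPlus hg ho R fun u v => ?_, hR ℝ⟩
  rw [← symplecticForm_nextHandle (M.period ℚ u)]
  congr 1 <;> exact funext (hR ℚ _)

/-- The class whose only nonzero period is `x`, along the side starting at `corner j`. -/
noncomputable def dualClass (hg : g ≠ 0) (j : Fin g × Fin 2) : ℝ →+ Cohomology X ℝ 1 :=
  (M.periodEquiv hg ℝ).symm.toAddMonoidHom.comp (AddMonoidHom.single (fun _ => ℝ) j)

theorem period_dualClass (hg : g ≠ 0) (j : Fin g × Fin 2) (x : ℝ) :
    M.period ℝ (M.dualClass hg j x) = Pi.single j x :=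
  (M.periodEquiv hg ℝ).apply_symm_apply _

theorem sum_dualClass (hg : g ≠ 0) (u : Cohomology X ℝ 1) :
    ∑ j, M.dualClass hg j (M.period ℝ u j) = u := by
  refine period_injective hg M ?_
  rw [map_sum]
  simp only [period_dualClass]
  exact Finset.univ_sum_single _

theorem dualClass_rat (hg : g ≠ 0) (j : Fin g × Fin 2) : ∃ u : Cohomology X ℚ 1,
    ∀ x : ℝ, M.dualClass hg j x = x • changeCoeff X (algebraMap ℚ ℝ) 1 u := by
  obtain ⟨u, hu⟩ := M.exists_period_eq_single hg ℚ j
  refine ⟨u, fun x => period_injective hg M (funext fun k => ?_)⟩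
  rw [period_dualClass, map_smul, Pi.smul_apply, period_changeCoeff, hu]
  by_cases hk : k = j
  · subst hk
    simp
  · simp [hk]

theorem exists_realCombination (M : PolygonModel g X) (hg : g ≠ 0) (u : Cohomology X ℝ 1) :
    ∃ (m : ℕ) (a : Fin m → ℝ) (x : Fin m → Cohomology X ℚ 1), realCombination a x = u := by
  choose e he using M.dualClass_rat hg
  let s := Fintype.equivFin (Fin g × Fin 2)
  refine ⟨_, fun i => M.period ℝ u (s.symm i), fun i => e (s.symm i), ?_⟩
  rw [realCombination]
  simp only [← he]
  rw [s.symm.sum_comp fun j => M.dualClass hg j (M.period ℝ u j), M.sum_dualClass hg u]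

/-! ### Relations among the coinvariants coming from twists and rotations -/

variable {o : Homology X 2}

theorem pullback_twist_dualClass_of_ne (hg : g ≠ 0) {j k : Fin g × Fin 2}
    (hjk : k.1 = j.1 → k.2 = j.2) (x : ℝ) :
    pullback (M.twist hg j : C(X, X)) ℝ 1 (M.dualClass hg k x) = M.dualClass hg k x := by
  refine period_injective hg M ?_
  obtain ⟨i, e⟩ := j
  obtain ⟨i', e'⟩ := k
  rw [period_twist, period_dualClass]
  funext l
  by_cases hl : l = (i, e)
  · subst hl
    by_cases hi : i' = i
    · subst hi
      obtain rfl := hjk rfl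
      fin_cases e' <;> simp
    · fin_cases e <;> simp [Ne.symm hi]
  · rw [Function.update_of_ne hl]

theorem pullback_twist_zero (hg : g ≠ 0) (i : Fin g) (x : ℝ) :
    pullback (M.twist hg (i, 0) : C(X, X)) ℝ 1 (M.dualClass hg (i, 1) x) =
      M.dualClass hg (i, 1) x + M.dualClass hg (i, 0) x := by
  refine period_injective hg M ?_
  rw [period_twist, map_add, period_dualClass, period_dualClass]
  funext l
  by_cases hl : l = (i, 0)
  · subst hl
    simp
  · rw [Function.update_of_ne hl]
    simp [hl]

theorem pullback_twist_one (hg : g ≠ 0) (i : Fin g) (x : ℝ) :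
    pullback (M.twist hg (i, 1) : C(X, X)) ℝ 1 (M.dualClass hg (i, 0) x) =
      M.dualClass hg (i, 0) x - M.dualClass hg (i, 1) x := by
  refine period_injective hg M ?_
  rw [period_twist, map_sub, period_dualClass, period_dualClass]
  funext l
  by_cases hl : l = (i, 1)
  · subst hl
    simp
  · rw [Function.update_of_ne hl]
    simp [hl]

/-- Two dual classes belonging to sides of different handles, or to the same side, have vanishing
wedge product in the coinvariants: the twist along `j` fixes the second class and changes the
partner of the first class in its handle by `±` the first class. -/
theorem wedgeClass_dualClass_eq_zero (hg : g ≠ 0) (ho : IsFundamentalClass o)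
    {j k : Fin g × Fin 2} (hjk : k.1 = j.1 → k.2 = j.2) (x y : ℝ) :
    wedgeClass o (M.dualClass hg j x) (M.dualClass hg k y) = 0 := by
  obtain ⟨i, e⟩ := j
  have hk := M.pullback_twist_dualClass_of_ne hg hjk y
  fin_cases e
  · have h := wedgeClass_pullback (M.twist_mem_homeoPlus hg ho (i, 0)) (M.dualClass hg (i, 1) x)
      (M.dualClass hg k y)
    have hk' : pullback (M.twist hg (i, 0) : C(X, X)) ℝ 1 (M.dualClass hg k y) =
      M.dualClass hg k y := hk
    rw [hk', pullback_twist_zero] at h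
    simp only [← wedgeHom_apply, map_add, AddMonoidHom.add_apply, add_eq_left] at h
    exact h
  · have h := wedgeClass_pullback (M.twist_mem_homeoPlus hg ho (i, 1)) (M.dualClass hg (i, 0) x)
      (M.dualClass hg k y)
    have hk' : pullback (M.twist hg (i, 1) : C(X, X)) ℝ 1 (M.dualClass hg k y) =
      M.dualClass hg k y := hk
    rw [hk', pullback_twist_one] at h
    simp only [← wedgeHom_apply, map_sub, AddMonoidHom.sub_apply, sub_eq_self] at h
    exact h

/-- The twist sends `b(x) ∧ b(y)` to `(b(x) + a(x)) ∧ (b(y) + a(y))`, where the terms `a ∧ a` and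
`b ∧ b` vanish in the coinvariants; hence `a(x) ∧ b(y) + b(x) ∧ a(y)` vanishes. -/
theorem wedgeClass_dualClass_symm (hg : g ≠ 0) (ho : IsFundamentalClass o) (i : Fin g)
    (x y : ℝ) : wedgeClass o (M.dualClass hg (i, 0) x) (M.dualClass hg (i, 1) y) =
      wedgeClass o (M.dualClass hg (i, 0) y) (M.dualClass hg (i, 1) x) := by
  have h := wedgeClass_pullback (M.twist_mem_homeoPlus hg ho (i, 0)) (M.dualClass hg (i, 1) x)
    (M.dualClass hg (i, 1) y)
  rw [pullback_twist_zero, pullback_twist_zero] at h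
  simp only [← wedgeHom_apply, map_add, AddMonoidHom.add_apply] at h
  simp only [wedgeHom_apply] at h
  rw [M.wedgeClass_dualClass_eq_zero hg ho (j := (i, 0)) (k := (i, 0)) fun _ => rfl,
    M.wedgeClass_dualClass_eq_zero hg ho (j := (i, 1)) (k := (i, 1)) fun _ => rfl,
    wedgeClass_swap (M.dualClass hg (i, 1) x)] at h
  simp only [zero_add, add_zero] at h
  exact neg_add_eq_zero.1 ((add_comm _ _).trans h) |>.symm

theorem wedgeClass_dualClass_nextHandle (hg : g ≠ 0) (ho : IsFundamentalClass o)
    (j k : Fin g × Fin 2) (x y : ℝ) :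
    wedgeClass o (M.dualClass hg (nextHandle j) x) (M.dualClass hg (nextHandle k) y) =
      wedgeClass o (M.dualClass hg j x) (M.dualClass hg k y) := by
  obtain ⟨R, hR, hRp⟩ := M.exists_rotation_mem_homeoPlus hg ho
  have hinj : Function.Injective (nextHandle (g := g)) :=
    Finite.injective_iff_surjective.2 exists_nextHandle_eq
  have key : ∀ j x, pullback (R : C(X, X)) ℝ 1 (M.dualClass hg (nextHandle j) x) =
      M.dualClass hg j x := by
    intro j x
    refine period_injective hg M (funext fun l => ?_)
    rw [hRp, period_dualClass, period_dualClass]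
    by_cases hl : l = j
    · subst hl
      simp
    · rw [Pi.single_eq_of_ne hl, Pi.single_eq_of_ne (hinj.ne hl)]
  rw [← wedgeClass_pullback hR, key, key]

theorem wedgeClass_dualClass_eq_first (hg : g ≠ 0) (ho : IsFundamentalClass o) (i : Fin g)
    (x y : ℝ) : wedgeClass o (M.dualClass hg (i, 0) x) (M.dualClass hg (i, 1) y) =
      wedgeClass o (M.dualClass hg (⟨0, Nat.pos_of_ne_zero hg⟩, 0) x)
        (M.dualClass hg (⟨0, Nat.pos_of_ne_zero hg⟩, 1) y) := by
  obtain ⟨n, hn⟩ := i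
  induction n with
  | zero => rfl
  | succ n ih =>
    have e : ∀ e : Fin 2, ((⟨n + 1, hn⟩ : Fin g), e) = nextHandle (⟨n, by omega⟩, e) := by
      intro e
      simp [nextHandle, Nat.mod_eq_of_lt hn]
    rw [e, e, M.wedgeClass_dualClass_nextHandle hg ho, ih]

/-- In the coinvariants every `u ∧ v` is a sum of classes supported on the first handle. -/
theorem wedgeClass_eq_sum (hg : g ≠ 0) (ho : IsFundamentalClass o) (u v : Cohomology X ℝ 1)
    (D : ℝ →+ ℝ →+ (mcgActionExtSq X o).Coinvariants)
    (hD : ∀ x y, D x y = wedgeClass o (M.dualClass hg (⟨0, Nat.pos_of_ne_zero hg⟩, 0) x)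
        (M.dualClass hg (⟨0, Nat.pos_of_ne_zero hg⟩, 1) y)) :
    wedgeClass o u v = ∑ i, (D (M.period ℝ u (i, 0)) (M.period ℝ v (i, 1)) -
      D (M.period ℝ u (i, 1)) (M.period ℝ v (i, 0))) := by
  have hu := M.sum_dualClass hg u
  have hv := M.sum_dualClass hg v
  set p := M.period ℝ u
  set q := M.period ℝ v
  rw [← hu, ← hv, ← wedgeHom_apply, map_sum (wedgeHom o), AddMonoidHom.finsetSum_apply,
    Fintype.sum_prod_type]
  refine Finset.sum_congr rfl fun i _ => ?_
  simp only [map_sum, map_add, Fin.sum_univ_two, Fintype.sum_prod_type]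
  simp only [wedgeHom_apply]
  have hself : ∀ (e : Fin 2) (x y : ℝ),
      wedgeClass o (M.dualClass hg (i, e) x) (M.dualClass hg (i, e) y) = 0 := fun e x y =>
    M.wedgeClass_dualClass_eq_zero hg ho (fun _ => rfl) x y
  have hne : ∀ i', i' ≠ i → ∀ (e e' : Fin 2) (x y : ℝ),
      wedgeClass o (M.dualClass hg (i, e) x) (M.dualClass hg (i', e') y) = 0 :=
    fun i' hi e e' x y => M.wedgeClass_dualClass_eq_zero hg ho (fun h => absurd h hi) x y
  rw [Finset.sum_eq_single i, Finset.sum_eq_single i]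
  · rw [hself, hself, wedgeClass_swap (M.dualClass hg (i, 1) (p (i, 1))), zero_add, add_zero,
      sub_eq_add_neg]
    congr 1
    · exact (M.wedgeClass_dualClass_eq_first hg ho i _ _).trans (hD _ _).symm
    · refine congrArg Neg.neg ?_
      exact (M.wedgeClass_dualClass_symm hg ho i _ _).trans
        ((M.wedgeClass_dualClass_eq_first hg ho i _ _).trans (hD _ _).symm)
  · intro i' _ hi
    rw [hne i' hi, hne i' hi, add_zero]
  · simp
  · intro i' _ hi
    rw [hne i' hi, hne i' hi, add_zero]
  · simp

/-! ### The invariant pairing with values in the symmetric square -/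

/-- The extension of `c` times the standard symplectic form to a biadditive form on real classes
with values in the symmetric square. -/
noncomputable def symPairing (c : ℚ) : Cohomology X ℝ 1 →+ Cohomology X ℝ 1 →+ SymSq :=
  AddMonoidHom.mk' (fun u => AddMonoidHom.mk' (fun v => c • ∑ i,
      (symMulHom (M.period ℝ u (i, 0)) (M.period ℝ v (i, 1)) -
        symMulHom (M.period ℝ u (i, 1)) (M.period ℝ v (i, 0)))) fun v v' => by
      rw [← smul_add, ← Finset.sum_add_distrib]
      congr 1
      refine Finset.sum_congr rfl fun i _ => ?_
      simp only [map_add, Pi.add_apply]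
      abel) fun u u' => by
    ext v
    simp only [AddMonoidHom.mk'_apply, AddMonoidHom.add_apply]
    rw [← smul_add, ← Finset.sum_add_distrib]
    congr 1
    refine Finset.sum_congr rfl fun i _ => ?_
    simp only [map_add, Pi.add_apply, LinearMap.add_apply]
    abel

theorem symPairing_apply (c : ℚ) (u v : Cohomology X ℝ 1) : M.symPairing c u v = c • ∑ i,
      (symMul (M.period ℝ u (i, 0)) (M.period ℝ v (i, 1)) -
        symMul (M.period ℝ u (i, 1)) (M.period ℝ v (i, 0))) := rfl

theorem symPairing_self (c : ℚ) (u : Cohomology X ℝ 1) : M.symPairing c u u = 0 := by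
  rw [symPairing_apply, Finset.sum_eq_zero, smul_zero]
  intro i _
  rw [symMul_comm, sub_self]

theorem symPairing_smul (c : ℚ) (a b : ℝ) (u v : Cohomology X ℚ 1) :
    M.symPairing c (a • changeCoeff X (algebraMap ℚ ℝ) 1 u)
      (b • changeCoeff X (algebraMap ℚ ℝ) 1 v) =
      (c * symplecticForm (M.period ℚ u) (M.period ℚ v)) • symMul a b := by
  have h : ∀ r s : ℚ, symMul (a * (algebraMap ℚ ℝ r)) (b * (algebraMap ℚ ℝ s)) =
      (r * s) • symMul a b := by
    intro r s
    rw [mul_comm a, mul_comm b, ← Algebra.smul_def, ← Algebra.smul_def, ← symMulHom_apply,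
      map_smul, map_smul symMulHom, LinearMap.smul_apply, smul_smul, mul_comm, symMulHom_apply]
  rw [symPairing_apply, mul_smul, symplecticForm, Finset.sum_smul]
  congr 1
  refine Finset.sum_congr rfl fun i _ => ?_
  simp only [map_smul, Pi.smul_apply, period_changeCoeff, smul_eq_mul, h, sub_smul]

theorem symPairing_realCombination {c : ℚ}
    (hc : ∀ u v : Cohomology X ℚ 1, intersectionPairing o ℚ u v =
      c * symplecticForm (M.period ℚ u) (M.period ℚ v))
    {m n : ℕ} (a : Fin m → ℝ) (u : Fin m → Cohomology X ℚ 1) (b : Fin n → ℝ)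
    (v : Fin n → Cohomology X ℚ 1) :
    M.symPairing c (realCombination a u) (realCombination b v) =
      ∑ i, ∑ j, intersectionPairing o ℚ (u i) (v j) • symMul (a i) (b j) := by
  rw [realCombination, realCombination, map_sum (M.symPairing c), AddMonoidHom.finsetSum_apply]
  refine Finset.sum_congr rfl fun i _ => ?_
  rw [map_sum]
  refine Finset.sum_congr rfl fun j _ => ?_
  rw [symPairing_smul, hc]

theorem pullback_realCombination (f : C(X, X)) {m : ℕ} (a : Fin m → ℝ)
    (u : Fin m → Cohomology X ℚ 1) : pullback f ℝ 1 (realCombination a u) =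
      realCombination a fun i => pullback f ℚ 1 (u i) := by
  simp only [realCombination, map_sum, map_smul, pullback_changeCoeff]

/-- The pairing is invariant under all orientation preserving homeomorphisms, since it is determined
by its values on rational classes, where it is the intersection pairing. -/
theorem symPairing_pullback (hg : g ≠ 0) {c : ℚ}
    (hc : ∀ u v : Cohomology X ℚ 1, intersectionPairing o ℚ u v =
      c * symplecticForm (M.period ℚ u) (M.period ℚ v))
    {h : X ≃ₜ X} (hh : h ∈ HomeoPlus X o) (x y : Cohomology X ℝ 1) :
    M.symPairing c (pullback (h : C(X, X)) ℝ 1 x) (pullback (h : C(X, X)) ℝ 1 y) =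
      M.symPairing c x y := by
  obtain ⟨m, a, u, rfl⟩ := M.exists_realCombination hg x
  obtain ⟨n, b, v, rfl⟩ := M.exists_realCombination hg y
  have ho : pushforward (h : C(X, X)) 2 o = o := hh
  simp only [pullback_realCombination, M.symPairing_realCombination hc,
    ← intersectionPairing_pushforward, ho]

/-! ### The isomorphism -/

/-- In the first handle, the wedge product of the two dual classes is a biadditive function of
their coefficients. -/
noncomputable def handleWedge (hg : g ≠ 0) (o : Homology X 2) :
    ℝ →+ ℝ →+ (mcgActionExtSq X o).Coinvariants :=
  AddMonoidHom.mk' (fun x => (wedgeHom o (M.dualClass hg (⟨0, Nat.pos_of_ne_zero hg⟩, 0) x)).comp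
    (M.dualClass hg (⟨0, Nat.pos_of_ne_zero hg⟩, 1))) fun x x' => by
      rw [map_add, map_add]
      rfl

theorem handleWedge_apply (hg : g ≠ 0) (x y : ℝ) : M.handleWedge hg o x y =
    wedgeClass o (M.dualClass hg (⟨0, Nat.pos_of_ne_zero hg⟩, 0) x)
      (M.dualClass hg (⟨0, Nat.pos_of_ne_zero hg⟩, 1) y) := rfl

theorem symPairing_dualClass (hg : g ≠ 0) (c : ℚ) (i : Fin g) (x y : ℝ) :
    M.symPairing c (M.dualClass hg (i, 0) x) (M.dualClass hg (i, 1) y) = c • symMul x y := by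
  have h0 : ∀ b : ℝ, symMul 0 b = 0 := fun b => by
    rw [← symMulHom_apply, map_zero, LinearMap.zero_apply]
  rw [symPairing_apply, Finset.sum_eq_single i]
  · simp [period_dualClass, h0]
  · intro i' _ hi
    simp [period_dualClass, hi, h0]
  · simp

/-- If the intersection pairing is `c` times the standard symplectic form, then `symPairing c`
induces an isomorphism of the coinvariants with the symmetric square. -/
theorem exists_addEquiv (hg : g ≠ 0) (ho : IsFundamentalClass o) {c : ℚ} (hc0 : c ≠ 0)
    (hc : ∀ u v : Cohomology X ℚ 1, intersectionPairing o ℚ u v =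
      c * symplecticForm (M.period ℚ u) (M.period ℚ v)) :
    ∃ Φ : (mcgActionExtSq X o).Coinvariants ≃+ SymSq,
      ∀ x y, Φ (wedgeClass o x y) = M.symPairing c x y := by
  obtain ⟨F, hF⟩ := exists_coinvariants_lift (o := o) (M.symPairing c) (M.symPairing_self c)
    fun h hh => M.symPairing_pullback hg hc hh
  have hsymm : ∀ x y, M.handleWedge hg o x y = M.handleWedge hg o y x := fun x y =>
    M.wedgeClass_dualClass_symm hg ho _ x y
  -- The inverse sends `â b̂` to the class whose pairing is `c • c⁻¹ • â b̂`.
  obtain ⟨Ψ, hΨ⟩ := exists_symSq_lift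
    ((M.handleWedge hg o).comp (DistribSMul.toAddMonoidHom ℝ c⁻¹)) fun x y => by
      change M.handleWedge hg o (c⁻¹ • x) y = M.handleWedge hg o (c⁻¹ • y) x
      rw [biadditive_rat_smul, hsymm]
  have hΨ' : ∀ x y, Ψ (c • symMul x y) = M.handleWedge hg o x y := by
    intro x y
    rw [← symMul_smul_left, hΨ]
    change M.handleWedge hg o (c⁻¹ • c • x) y = _
    rw [inv_smul_smul₀ hc0]
  refine ⟨AddMonoidHom.toAddEquiv F Ψ (coinvariants_hom_ext fun x y => ?_)
    (symSq_hom_ext fun x y => ?_), hF⟩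
  · change Ψ (F (wedgeClass o x y)) = wedgeClass o x y
    rw [hF, symPairing_apply, M.wedgeClass_eq_sum hg ho x y (M.handleWedge hg o) fun _ _ => rfl,
      Finset.smul_sum, map_sum]
    refine Finset.sum_congr rfl fun i _ => ?_
    rw [smul_sub, map_sub, hΨ', hΨ']
  · change F (Ψ (symMul x y)) = symMul x y
    rw [hΨ]
    change F (M.handleWedge hg o (c⁻¹ • x) y) = symMul x y
    rw [handleWedge_apply, hF, symPairing_dualClass, ← symMul_smul_left, smul_inv_smul₀ hc0]

end PolygonModel
end SurfaceTopology

theorem proposition2p1 (g : ℕ) (hg : 2 ≤ g) (X : Type*) [TopologicalSpace X]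
    (hX : SurfaceTopology.IsSurfaceOfGenus g X)
    (o : SurfaceTopology.Homology X 2) (ho : SurfaceTopology.IsFundamentalClass o) :
    ∃! Φ : (SurfaceTopology.mcgActionExtSq X o).Coinvariants ≃+ SurfaceTopology.SymSq,
      ∀ (m n : ℕ) (a : Fin m → ℝ) (u : Fin m → SurfaceTopology.Cohomology X ℚ 1)
        (b : Fin n → ℝ) (v : Fin n → SurfaceTopology.Cohomology X ℚ 1),
        Φ (SurfaceTopology.wedgeClass o (SurfaceTopology.realCombination a u)
            (SurfaceTopology.realCombination b v)) =
          ∑ i, ∑ j, SurfaceTopology.intersectionPairing o ℚ (u i) (v j) •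
            SurfaceTopology.symMul (a i) (b j) := by
  have hg0 : g ≠ 0 := by omega
  obtain ⟨M⟩ := hX.nonempty_model
  obtain ⟨k, hk0, hk⟩ := M.exists_intersectionPairing_eq hg0 ho
  have hc : ∀ u v : SurfaceTopology.Cohomology X ℚ 1,
      SurfaceTopology.intersectionPairing o ℚ u v =
        k⁻¹ * SurfaceTopology.symplecticForm (M.period ℚ u) (M.period ℚ v) := fun u v => by
    rw [hk, inv_mul_cancel_left₀ hk0]
  obtain ⟨Φ, hΦ⟩ := M.exists_addEquiv hg0 ho (inv_ne_zero hk0) hc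
  have hΦ' : ∀ (m n : ℕ) (a : Fin m → ℝ) (u : Fin m → SurfaceTopology.Cohomology X ℚ 1)
      (b : Fin n → ℝ) (v : Fin n → SurfaceTopology.Cohomology X ℚ 1),
      Φ (SurfaceTopology.wedgeClass o (SurfaceTopology.realCombination a u)
        (SurfaceTopology.realCombination b v)) =
          ∑ i, ∑ j, SurfaceTopology.intersectionPairing o ℚ (u i) (v j) •
            SurfaceTopology.symMul (a i) (b j) := fun m n a u b v => by
    rw [hΦ, M.symPairing_realCombination hc]
  refine ⟨Φ, hΦ', fun Φ' h' => ?_⟩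
  -- Every real class is a real combination of rational ones, so the formula determines the map.
  have : Φ'.toAddMonoidHom = Φ.toAddMonoidHom :=
    SurfaceTopology.coinvariants_hom_ext fun x y => by
      obtain ⟨m, a, u, rfl⟩ := M.exists_realCombination hg0 x
      obtain ⟨n, b, v, rfl⟩ := M.exists_realCombination hg0 y
      exact (h' m n a u b v).trans (hΦ' m n a u b v).symm
  exact AddEquiv.ext fun x => DFunLike.congr_fun this x
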